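/- For complex $s_1=\sigma_1+it_1$, $s_2=\sigma_2+it_2$ let $\zeta_2(s_1,s_2)$ denote the Euler double zeta-function $$\zeta_2(s_1,s_2)=\sum_{m=1}^{\infty}\frac1{m^{s_1}}\sum_{n=1}^{\infty}\frac1{(m+n)^{s_2}}\qquad(\sigma_2>1,\ \sigma_1+\sigma_2>2),$$ continued analytically to $\{(s_1,s_2)\in\mathbb C^2 : s_2\neq 1,\ s_1+s_2\notin\{2,1,0,-2,-4,-6,\dots\}\}$, and put $$\zeta_2^{[2]}(s_1,\sigma)=\sum_{n=2}^{\infty}\Bigl|\sum_{m=1}^{n-1}\frac1{m^{s_1}}\Bigr|^2\frac1{n^{\sigma}} .$$ The series $\zeta_2^{[2]}(s_1,2\sigma_2)$ converges whenever $\sigma_2>1/2$ and $\sigma_1+\sigma_2>3/2$. Fix $s_1\in\mathbb C$ and $\sigma_2\in\mathbb R$ such that no point $(s_1,\sigma_2+it_2)$ with $t_2\ge 2$ lies on one of the excluded (singular) hyperplanes, and for $T\ge2$ let $$I^{[2]}(T)=\int_2^T|\zeta_2(s_1,\sigma_2+it_2)|^2\,dt_2 .$$ This integral exists in each of the following cases,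 and the following estimates hold for all $T\ge 2$, with implied constants depending only on $s_1$ and $\sigma_2$. 1. If $\sigma_2>1$ and $\sigma_1+\sigma_2>2$, then $I^{[2]}(T)=\zeta_2^{[2]}(s_1,2\sigma_2)T+O(1)$. 2. If $\sigma_1>1$ and $1/2<\sigma_2\le1$, then $I^{[2]}(T)=\zeta_2^{[2]}(s_1,2\sigma_2)T+O(T^{2-2\sigma_2})$ when $\sigma_2\ne1$, and with error $O((\log T)^2)$ when $\sigma_2=1$. 3. If $\sigma_1\le1$, $s_1\ne1$ and $3/2<\sigma_1+\sigma_2\le2$, then $I^{[2]}(T)=\zeta_2^{[2]}(s_1,2\sigma_2)T+O(T^{4-2\sigma_1-2\sigma_2})$ when $\sigma_1+\sigma_2\neq2$, and with error $O((\log T)^2)$ when $\sigma_1+\sigma_2=2$. 4. If $s_1=1$ and $1/2<\sigma_2\le1$, then $I^{[2]}(T)=\zeta_2^{[2]}(s_1,2\sigma_2)T+O(T^{2-2\sigma_2}(\log T)^2)$ when $\sigma_2\ne1$, and with error $O((\log T)^4)$ when $\sigma_2=1$. 5. If $\sigma_1>1$ and $\sigma_2=1/2$, then $I^{[2]}(T)=|\zeta(s_1)|^2\,T\log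 T+O(T)$, where $\zeta$ is the Riemann zeta-function. 6. If $\sigma_1+\sigma_2=3/2$ and $\sigma_2>1/2$, then $I^{[2]}(T)=|s_1-1|^{-2}\,T\log T+O(T)$. 7. If $\sigma_1=1$, $\sigma_2=1/2$ and $s_1\ne1$, then $I^{[2]}(T)=\bigl(|s_1-1|^{-2}+|\zeta(s_1)|^2\bigr)T\log T+O(T)$. 8. If $s_1=1$ and $\sigma_2=1/2$, then $I^{[2]}(T)=\tfrac13T(\log T)^3+O(T(\log T)^2)$. In particular (Matsumoto–Tsumura's conjecture (ii)), if $\sigma_1+\sigma_2=3/2$ and $\sigma_2\ge1/2$, there is no constant $C$ with $I^{[2]}(T)=CT+o(T)$ as $T\to\infty$. -/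

import Mathlib

open Filter Topology Asymptotics

noncomputable section

namespace EulerDoubleZeta

/-- The defining double series of the Euler double zeta-function,
`∑_{m ≥ 1} m^{-s₁} ∑_{n ≥ 1} (m + n)^{-s₂}` (the indices are shifted by one). -/
def series (s : ℂ × ℂ) : ℂ :=
  ∑' m : ℕ, 1 / ((m : ℂ) + 1) ^ s.1 *
    ∑' n : ℕ, 1 / (((m : ℂ) + 1) + ((n : ℂ) + 1)) ^ s.2

/-- The convex tube domain `Re s₂ > c`, `Re (s₁ + s₂) > 1 + c`. For `c = 1` it is the domain of
absolute convergence of the double series; these domains exhaust `ℂ²` as `c → -∞`. -/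
def tube (c : ℝ) : Set (ℂ × ℂ) :=
  {s | c < s.2.re ∧ 1 + c < (s.1 + s.2).re}

/-- The complement in `ℂ²` of the singular hyperplanes of the Euler double zeta-function:
`s₂ ≠ 1` and `s₁ + s₂ ∉ {2, 1, 0, -2, -4, -6, …}`. -/
def regularSet : Set (ℂ × ℂ) :=
  {s | s.2 ≠ 1 ∧ s.1 + s.2 ≠ 2 ∧ s.1 + s.2 ≠ 1 ∧ ∀ k : ℕ, s.1 + s.2 ≠ -(2 * (k : ℂ))}

/-- `w` is the value at `s` of the analytic continuation of the double series: some function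
which is holomorphic on the domain `regularSet ∩ tube c`, and which is given by the double series
where that converges absolutely, takes the value `w` at the point `s` of that domain.

Each `regularSet ∩ tube c` is a convex open set with complex hyperplanes (locally finitely many)
removed, hence open and connected. So the function is determined by `c`, the functions for
different `c` agree on the common part of their domains, and together they are the
continuation to `regularSet`. -/
def IsValue (s : ℂ × ℂ) (w : ℂ) : Prop :=
  ∃ (c : ℝ) (f : ℂ × ℂ → ℂ),
    DifferentiableOn ℂ f (regularSet ∩ tube c) ∧
    (∀ z ∈ tube 1, f z = series z) ∧
    s ∈ regularSet ∩ tube c ∧ f s = w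

open Classical in
/-- The Euler double zeta-function `ζ₂(s₁, s₂)`, continued analytically to `regularSet`
(and given the value `0` on the singular hyperplanes). -/
def zeta₂ (s₁ s₂ : ℂ) : ℂ :=
  if h : ∃ w, IsValue (s₁, s₂) w then h.choose else 0

/-- The `n`-th term `|∑_{m=1}^{n-1} m^{-s₁}|² n^{-σ}` of the series `ζ₂^{[2]}(s₁, σ)`.
It is zero for `n = 0` and `n = 1`. -/
def zeta₂SqTerm (s₁ : ℂ) (σ : ℝ) (n : ℕ) : ℝ :=
  ‖∑ m ∈ Finset.Ico 1 n, 1 / (m : ℂ) ^ s₁‖ ^ 2 * (1 / (n : ℝ) ^ σ)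

/-- `ζ₂^{[2]}(s₁, σ) = ∑_{n ≥ 2} |∑_{m=1}^{n-1} m^{-s₁}|² n^{-σ}`. -/
def zeta₂Sq (s₁ : ℂ) (σ : ℝ) : ℝ :=
  ∑' n : ℕ, zeta₂SqTerm s₁ σ n

/-- The mean value `I^{[2]}(T) = ∫_2^T |ζ₂(s₁, σ₂ + i t₂)|² dt₂`. -/
def meanSq (s₁ : ℂ) (σ₂ : ℝ) (T : ℝ) : ℝ :=
  ∫ t in (2 : ℝ)..T, ‖zeta₂ s₁ ((σ₂ : ℂ) + (t : ℂ) * Complex.I)‖ ^ 2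

end EulerDoubleZeta

end

/-! ### Holomorphic series in several variables and the identity theorem along a segment -/

namespace EulerDoubleZeta

/-! As a function of s₂, ζ₂(s₁, s₂) is the Dirichlet series ∑ aₙ n^{-s₂} with aₙ = ∑_{m<n} m^{-s₁}.
Put xₙ = aₙ n^{-σ₂}. The mean square up to T should be T ∑ |xₙ|², truncated at n of order T when the
series diverges, and the cases record how aₙ grows: like n^{1-s₁}/(1-s₁) for σ₁ < 1, bounded for σ₁
≥ 1 and s₁ ≠ 1, like log n for s₁ = 1. For s₁ ≠ 1 this gives xₙ = O(n^{-α}) with α = min(σ₂,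
σ₁+σ₂-1). All errors are O(V²) with V = ∑ n^{-α} over n up to a multiple of T, that is O(1), O((log
T)²) or O(T^{2-2α}). If s₁ = 1, then α = σ₂ and V gains a factor log T. For α = 1/2, V² has order T,
and the diagonal sum is κ log N + O(1), or (log N)³/3 + O((log N)²) for s₁ = 1, which gives the
boundary cases.

Three ingredients make this rigorous.

Approximation. Comparing ∑_{n>m} n^{-s₂} with m^{1-s₂}/(s₂-1) continues the double series to Re s₂ >
0, Re(s₁+s₂) > 1 (`doubleZeta`), and the identity theorem shows that it is the continuation. The
comparison is uniform for |s| ≤ N (`exists_norm_zetaCorr_le_of_norm_le`), so a Dirichlet polynomial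
of length N ≥ T + O(1) approximates ζ₂ for all t ≤ T, up to one explicit oscillating term a_N
N^{1-s₂}/(s₂-1) and a remainder with factor 1/t² + 1/N (`exists_doubleZeta_approx`).

Mean values. For Dirichlet polynomials, Hilbert's inequality and the approximation of 1/(log n - log
m) by √(mn)/(n-m) give an error O(∑ n|xₙ|² + (∑|xₙ|)²) (`abs_integral_norm_expSum_log_sq_sub_le`).

Two lengths. Bounding the cross term of the polynomial with the oscillating term trivially would be
too expensive. The approximation is therefore used with both N and 2N
(`abs_integral_norm_sq_sub_le`). The terms n < N have frequencies at distance at least log 2 from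
log 2N, so their cross term is handled by integration by parts; the block N ≤ n < 2N is the
difference of two approximations of the same function, hence O(1/t) times the size of the
oscillating term, and its product with that term is integrable. -/

/-- A series of holomorphic functions on an open subset of a complex normed space which is
dominated by a convergent series is holomorphic. -/
theorem differentiableOn_tsum_of_norm_le {E ι : Type*} [NormedAddCommGroup E] [NormedSpace ℂ E]
    {f : ι → E → ℂ} {u : ι → ℝ} {U : Set E} (hU : IsOpen U) (hu : Summable u)
    (hf : ∀ i, DifferentiableOn ℂ (f i) U) (hb : ∀ i, ∀ x ∈ U, ‖f i x‖ ≤ u i) :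
    DifferentiableOn ℂ (fun x => ∑' i, f i x) U := by
  intro p hp
  obtain ⟨ε, hε, hball⟩ := Metric.isOpen_iff.1 hU p hp
  have hsub : ∀ x ∈ Metric.ball p (ε / 2), Metric.ball x (ε / 2) ⊆ U := fun x hx =>
    (Metric.ball_subset_ball' (by
      have := Metric.mem_ball.1 hx
      linarith)).trans hball
  have hmem : ∀ x ∈ Metric.ball p (ε / 2), x ∈ U := fun x hx =>
    hsub x hx (Metric.mem_ball_self (by positivity))
  -- Cauchy's estimate dominates the series of derivatives: on a ball of radius ε/2 inside U each
  -- term varies by at most 2uᵢ, so its derivative is at most 2uᵢ/(ε/2).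
  have hd := hasFDerivAt_tsum_of_isPreconnected (𝕜 := ℂ) (f := f)
    (f' := fun i x => fderiv ℂ (f i) x) (x₀ := p) (x := p)
    (hu.mul_left (2 / (ε / 2))) Metric.isOpen_ball (convex_ball p (ε / 2)).isPreconnected
    (fun i x hx => ((hf i).differentiableAt (hU.mem_nhds (hmem x hx))).hasFDerivAt)
    (fun i x hx => by
      have h := Complex.norm_fderiv_le_div_of_mapsTo_ball (f := f i) (c := x) (R₁ := ε / 2)
        (R₂ := 2 * u i) ((hf i).mono (hsub x hx)) (fun y hy => by
          rw [mem_closedBall_iff_norm]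
          have h1 := hb i y (hsub x hx hy)
          have h2 := hb i x (hmem x hx)
          linarith [norm_sub_le (f i y) (f i x)]) (by positivity)
      calc _ ≤ _ := h
        _ = _ := by ring)
    (Metric.mem_ball_self (by positivity))
    (.of_norm_bounded hu fun i => hb i p hp) (Metric.mem_ball_self (by positivity))
  exact hd.differentiableAt.differentiableWithinAt

/-- Identity theorem along a segment. -/
theorem eq_of_differentiableOn_of_segment_subset {E : Type*} [NormedAddCommGroup E]
    [NormedSpace ℂ E] {f g : E → ℂ} {U : Set E} (hU : IsOpen U) (hf : DifferentiableOn ℂ f U)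
    (hg : DifferentiableOn ℂ g U) {s p : E} (hsp : segment ℝ s p ⊆ U) (h : f =ᶠ[𝓝 p] g) :
    f s = g s := by
  -- Restriction to the complex line through s and p reduces to one variable. By compactness a
  -- thickening of [0, 1] in ℂ is still mapped into U, and it is convex, hence connected.
  set l : ℂ → E := fun z => s + z • (p - s) with hl
  have hld : Differentiable ℂ l := by fun_prop
  have hK : IsCompact (segment ℝ (0 : ℂ) 1) := by
    rw [← convexHull_pair]
    exact Set.Finite.isCompact_convexHull ℝ (Set.toFinite _)
  have hKU : segment ℝ (0 : ℂ) 1 ⊆ l ⁻¹' U := by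
    rintro z ⟨a, b, ha, hb, hab, rfl⟩
    refine hsp ⟨a, b, ha, hb, hab, ?_⟩
    have : a • s = s - b • s := by rw [eq_sub_of_add_eq hab, sub_smul, one_smul]
    simp only [hl, smul_zero, zero_add]
    rw [this, Complex.real_smul, mul_one, Complex.coe_smul, smul_sub]
    abel
  obtain ⟨δ, hδ, hV⟩ := hK.exists_thickening_subset_open (hU.preimage hld.continuous) hKU
  have hKV : segment ℝ (0 : ℂ) 1 ⊆ Metric.thickening δ (segment ℝ (0 : ℂ) 1) :=
    Metric.self_subset_thickening hδ _
  have hVo : IsOpen (Metric.thickening δ (segment ℝ (0 : ℂ) 1)) := Metric.isOpen_thickening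
  have key : Set.EqOn (f ∘ l) (g ∘ l) (Metric.thickening δ (segment ℝ (0 : ℂ) 1)) := by
    refine AnalyticOnNhd.eqOn_of_preconnected_of_eventuallyEq (𝕜 := ℂ) (z₀ := 1)
      ((hf.comp hld.differentiableOn hV).analyticOnNhd hVo)
      ((hg.comp hld.differentiableOn hV).analyticOnNhd hVo)
      ((convex_segment _ _).thickening δ).isPreconnected (hKV (right_mem_segment ℝ _ _)) ?_
    have h1 : Tendsto l (𝓝 1) (𝓝 p) := by
      have := hld.continuous.tendsto 1
      simpa [hl] using this
    exact h1.eventually h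
  have := key (hKV (left_mem_segment ℝ _ _))
  simpa [hl] using this

end EulerDoubleZeta
namespace EulerDoubleZeta

/-! ### The logarithmic step `log (m + 1) - log m` -/

/-- `log (m + 1) - log m`. -/
noncomputable def logStep (m : ℕ) : ℝ := Real.log (m + 1) - Real.log m

theorem logStep_eq_log {m : ℕ} (hm : 1 ≤ m) : logStep m = Real.log ((m + 1) / m) := by
  have : (0 : ℝ) < m := by exact_mod_cast hm
  rw [logStep, Real.log_div (by positivity) (by positivity)]

theorem inv_succ_le_logStep {m : ℕ} (hm : 1 ≤ m) : 1 / ((m : ℝ) + 1) ≤ logStep m := by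
  have hm' : (0 : ℝ) < m := by exact_mod_cast hm
  rw [logStep_eq_log hm]
  refine le_trans (le_of_eq ?_) (Real.one_sub_inv_le_log_of_pos (by positivity))
  field_simp
  ring

theorem logStep_le_inv {m : ℕ} (hm : 1 ≤ m) : logStep m ≤ 1 / (m : ℝ) := by
  have hm' : (0 : ℝ) < m := by exact_mod_cast hm
  rw [logStep_eq_log hm]
  refine (Real.log_le_sub_one_of_pos (by positivity)).trans (le_of_eq ?_)
  field_simp
  ring

theorem logStep_nonneg {m : ℕ} (hm : 1 ≤ m) : 0 ≤ logStep m :=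
  le_trans (by positivity) (inv_succ_le_logStep hm)

theorem mul_logStep_le_one {m : ℕ} (hm : 1 ≤ m) : m * logStep m ≤ 1 := by
  have hm' : (0 : ℝ) < m := by exact_mod_cast hm
  calc m * logStep m ≤ m * (1 / m) := by gcongr; exact logStep_le_inv hm
    _ = 1 := by field_simp

theorem one_sub_mul_logStep_le {m : ℕ} (hm : 1 ≤ m) : 1 - m * logStep m ≤ 1 / (m : ℝ) := by
  have hm' : (0 : ℝ) < m := by exact_mod_cast hm
  have h : (m : ℝ) * (1 / (m + 1)) ≤ m * logStep m := by
    gcongr; exact inv_succ_le_logStep hm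
  have h2 : (m : ℝ) * (1 / (m + 1)) = 1 - 1 / (m + 1) := by field_simp; ring
  have h3 : 1 / ((m : ℝ) + 1) ≤ 1 / m := by gcongr; linarith
  linarith

theorem natCast_cpow_eq_exp {m : ℕ} (hm : 1 ≤ m) (s : ℂ) :
    (m : ℂ) ^ s = Complex.exp (Real.log m * s) := by
  rw [Complex.cpow_def_of_ne_zero (by exact_mod_cast (by omega : m ≠ 0)), Complex.natCast_log]

theorem natCast_succ_cpow {m : ℕ} (hm : 1 ≤ m) (s : ℂ) :
    ((m + 1 : ℕ) : ℂ) ^ s = (m : ℂ) ^ s * Complex.exp (logStep m * s) := by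
  rw [natCast_cpow_eq_exp hm, natCast_cpow_eq_exp (by omega), ← Complex.exp_add, logStep]
  congr 1
  push_cast
  ring

theorem norm_natCast_cpow {m : ℕ} (hm : 1 ≤ m) (s : ℂ) : ‖(m : ℂ) ^ s‖ = (m : ℝ) ^ s.re :=
  Complex.norm_natCast_cpow_of_pos hm s

/-! ### Sums of powers -/

/-- A telescoping substitute for the integral test, from 1 + x ≤ eˣ at x = q (log(m+1) - log m). -/
theorem mul_rpow_succ_le_sub {q : ℝ} (hq : 0 ≤ q) {m : ℕ} (hm : 1 ≤ m) :
    q * ((m : ℝ) + 1) ^ (-q - 1) ≤ (m : ℝ) ^ (-q) - ((m : ℝ) + 1) ^ (-q) := by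
  have hm' : (0 : ℝ) < m := by exact_mod_cast hm
  have h1 : (m : ℝ) ^ (-q) = ((m : ℝ) + 1) ^ (-q) * Real.exp (q * logStep m) := by
    rw [Real.rpow_def_of_pos hm', Real.rpow_def_of_pos (by positivity), ← Real.exp_add, logStep]
    congr 1
    ring
  rw [h1, Real.rpow_sub_one (by positivity)]
  have h2 : q * logStep m + 1 ≤ Real.exp (q * logStep m) := Real.add_one_le_exp _
  have h3 : q * (1 / ((m : ℝ) + 1)) ≤ q * logStep m := by
    gcongr; exact inv_succ_le_logStep hm
  have h4 : 0 < ((m : ℝ) + 1) ^ (-q) := by positivity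
  calc q * (((m : ℝ) + 1) ^ (-q) / (m + 1)) = ((m : ℝ) + 1) ^ (-q) * (q * (1 / ((m : ℝ) + 1))) := by
        ring
    _ ≤ ((m : ℝ) + 1) ^ (-q) * (Real.exp (q * logStep m) - 1) := by gcongr; linarith
    _ = _ := by ring

theorem sum_range_rpow_tail_le {q : ℝ} (hq : 0 < q) {N : ℕ} (hN : 1 ≤ N) (J : ℕ) :
    ∑ j ∈ Finset.range J, ((N + j : ℕ) : ℝ) ^ (-q - 1) ≤ (1 + 1 / q) * (N : ℝ) ^ (-q) := by
  have hN' : (1 : ℝ) ≤ N := by exact_mod_cast hN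
  -- The telescoping bound controls only the terms from N + 1 on, so the first one is kept apart;
  -- truncated subtraction makes the claim hold at J = 0 too.
  have key : ∀ J : ℕ, ∑ j ∈ Finset.range J, ((N + j : ℕ) : ℝ) ^ (-q - 1) ≤
      (N : ℝ) ^ (-q - 1) + 1 / q * ((N : ℝ) ^ (-q) - ((N + (J - 1) : ℕ) : ℝ) ^ (-q)) := by
    intro J
    induction J with
    | zero => simp; positivity
    | succ J ih =>
      rcases Nat.eq_zero_or_pos J with rfl | hJ
      · simp
      · rw [Finset.sum_range_succ]
        have h := mul_rpow_succ_le_sub hq.le (m := N + (J - 1)) (by omega)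
        have e : ((N + (J - 1) : ℕ) : ℝ) + 1 = ((N + J : ℕ) : ℝ) := by
          exact_mod_cast (by omega : N + (J - 1) + 1 = N + J)
        rw [e] at h
        have h' : ((N + J : ℕ) : ℝ) ^ (-q - 1) ≤
            1 / q * (((N + (J - 1) : ℕ) : ℝ) ^ (-q) - ((N + J : ℕ) : ℝ) ^ (-q)) := by
          rw [one_div, inv_mul_eq_div, le_div_iff₀ hq]
          linarith
        simp only [Nat.add_sub_cancel]
        linarith
  have h1 : (N : ℝ) ^ (-q - 1) ≤ (N : ℝ) ^ (-q) :=
    Real.rpow_le_rpow_of_exponent_le hN' (by linarith)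
  have h2 : 0 ≤ 1 / q * ((N + (J - 1) : ℕ) : ℝ) ^ (-q) := by positivity
  linarith [key J, mul_sub (1 / q) ((N : ℝ) ^ (-q)) (((N + (J - 1) : ℕ) : ℝ) ^ (-q))]

theorem summable_rpow_tail {q : ℝ} (hq : 0 < q) (N : ℕ) :
    Summable fun j : ℕ => ((N + j : ℕ) : ℝ) ^ (-q - 1) := by
  have h : Summable fun n : ℕ => (n : ℝ) ^ (-q - 1) := Real.summable_nat_rpow.2 (by linarith)
  simpa [add_comm] using (summable_nat_add_iff N).2 h

theorem tsum_rpow_tail_le {q : ℝ} (hq : 0 < q) {N : ℕ} (hN : 1 ≤ N) :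
    ∑' j : ℕ, ((N + j : ℕ) : ℝ) ^ (-q - 1) ≤ (1 + 1 / q) * (N : ℝ) ^ (-q) :=
  (summable_rpow_tail hq N).tsum_le_of_sum_range_le (sum_range_rpow_tail_le hq hN)

/-! ### The entire function `(1 - e^{-w}) / w` -/

/-- The entire function `(1 - e^{-w}) / w`. -/
noncomputable def expQuot (w : ℂ) : ℂ := dslope (fun z => -Complex.exp (-z)) 0 w

theorem mul_expQuot (w : ℂ) : w * expQuot w = 1 - Complex.exp (-w) := by
  have := sub_smul_dslope (fun z => -Complex.exp (-z)) 0 w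
  simp only [sub_zero, smul_eq_mul, neg_zero, Complex.exp_zero] at this
  rw [expQuot, this]
  ring

theorem expQuot_zero : expQuot 0 = 1 := by
  rw [expQuot, dslope_same]
  have : HasDerivAt (fun z : ℂ => -Complex.exp (-z)) 1 0 := by
    simpa using ((hasDerivAt_neg (0 : ℂ)).cexp).fun_neg
  exact this.deriv

theorem differentiable_expQuot : Differentiable ℂ expQuot := by
  rw [← differentiableOn_univ]
  exact (Complex.differentiableOn_dslope univ_mem).2 (by fun_prop)

/-- The derivative is continuous, hence bounded, on the smaller closed ball, and the mean value
inequality applies there by convexity. -/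
theorem exists_lipschitz_of_differentiableOn {f : ℂ → ℂ} {R R' : ℝ} (hR : R < R')
    (hf : DifferentiableOn ℂ f (Metric.ball 0 R')) :
    ∃ C : ℝ, 0 ≤ C ∧ ∀ u v : ℂ, ‖u‖ ≤ R → ‖v‖ ≤ R → ‖f u - f v‖ ≤ C * ‖u - v‖ := by
  have hsub : Metric.closedBall (0 : ℂ) R ⊆ Metric.ball 0 R' :=
    Metric.closedBall_subset_ball hR
  have hc : ContinuousOn (deriv f) (Metric.closedBall 0 R) :=
    (hf.deriv Metric.isOpen_ball).continuousOn.mono hsub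
  obtain ⟨C, hC⟩ := (isCompact_closedBall (0 : ℂ) R).exists_bound_of_continuousOn hc
  refine ⟨max C 0, le_max_right _ _, fun u v hu hv => ?_⟩
  exact (convex_closedBall (0 : ℂ) R).norm_image_sub_le_of_norm_deriv_le
    (fun x hx => hf.differentiableAt (Metric.isOpen_ball.mem_nhds (hsub hx)))
    (fun x hx => (hC x hx).trans (le_max_left _ _)) (by simpa using hv) (by simpa using hu)

theorem exists_lipschitz_expQuot (R : ℝ) :
    ∃ C : ℝ, 0 ≤ C ∧ ∀ u v : ℂ, ‖u‖ ≤ R → ‖v‖ ≤ R →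
      ‖expQuot u - expQuot v‖ ≤ C * ‖u - v‖ :=
  exists_lipschitz_of_differentiableOn (lt_add_one R) differentiable_expQuot.differentiableOn

/-! ### The continuation of the tails of the zeta series -/

/-- The entire function `m^{-s} - (m^{1-s} - (m+1)^{1-s}) / (s-1)`, the difference between the
term `m^{-s}` and the integral of `x^{-s}` over `[m, m + 1]`. -/
noncomputable def zetaStep (m : ℕ) (s : ℂ) : ℂ :=
  (m : ℂ) ^ (-s) * (1 - m * logStep m * expQuot ((s - 1) * logStep m))

/-- Since (m+1)^{1-s} = m^{1-s} e^{-w} with w = (s-1) log((m+1)/m), dividing by s - 1 is the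
division already performed inside `expQuot`, which removes the singularity at s = 1. -/
theorem zetaStep_eq {m : ℕ} (hm : 1 ≤ m) {s : ℂ} (hs : s ≠ 1) :
    zetaStep m s =
      (m : ℂ) ^ (-s) - ((m : ℂ) ^ (1 - s) - ((m + 1 : ℕ) : ℂ) ^ (1 - s)) / (s - 1) := by
  have hs' : s - 1 ≠ 0 := sub_ne_zero.2 hs
  have hm0 : (m : ℂ) ≠ 0 := by exact_mod_cast (by omega : m ≠ 0)
  have h1 := mul_expQuot ((s - 1) * logStep m)
  have h2 : (m : ℂ) ^ (1 - s) = m * (m : ℂ) ^ (-s) := by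
    rw [show 1 - s = 1 + -s by ring, Complex.cpow_add _ _ hm0, Complex.cpow_one]
  have h3 : ((logStep m : ℂ)) * (1 - s) = -((s - 1) * logStep m) := by ring
  rw [natCast_succ_cpow hm, h3, zetaStep, h2]
  generalize expQuot ((s - 1) * logStep m) = φ at *
  generalize Complex.exp (-((s - 1) * logStep m)) = e at *
  have h4 : (m * (m : ℂ) ^ (-s) - m * (m : ℂ) ^ (-s) * e) / (s - 1) =
      (m : ℂ) ^ (-s) * (m * logStep m * φ) := by
    rw [div_eq_iff hs']
    linear_combination (-(m : ℂ) * (m : ℂ) ^ (-s)) * h1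
  rw [h4]
  ring

theorem differentiable_zetaStep {m : ℕ} (hm : 1 ≤ m) : Differentiable ℂ (zetaStep m) := by
  have hm0 : (m : ℂ) ≠ 0 := by exact_mod_cast (by omega : m ≠ 0)
  intro s
  unfold zetaStep
  have h1 : DifferentiableAt ℂ (fun s : ℂ => (m : ℂ) ^ (-s)) s :=
    (differentiableAt_id.neg).const_cpow (Or.inl hm0)
  have h2 : DifferentiableAt ℂ (fun s : ℂ => expQuot ((s - 1) * logStep m)) s :=
    (differentiable_expQuot _).comp s (by fun_prop)
  exact h1.mul ((differentiableAt_const _).sub (h2.const_mul _))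

theorem norm_sub_one_mul_logStep_le {m : ℕ} (hm : 1 ≤ m) {s : ℂ} {R : ℝ} (hs : ‖s‖ ≤ R) :
    ‖(s - 1) * (logStep m : ℂ)‖ ≤ (R + 1) / m := by
  rw [norm_mul, Complex.norm_real, Real.norm_of_nonneg (logStep_nonneg hm), div_eq_mul_one_div]
  have := norm_sub_le s 1
  rw [norm_one] at this
  have hR : 0 ≤ R := (norm_nonneg s).trans hs
  exact mul_le_mul (by linarith) (logStep_le_inv hm) (logStep_nonneg hm) (by linarith)

/-- Both m·`logStep m` and the value of `expQuot` differ from 1 by O(1/m). The constant depends on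
R; uniformity in s is obtained separately. -/
theorem exists_norm_zetaStep_le (R : ℝ) :
    ∃ C : ℝ, 0 ≤ C ∧ ∀ (m : ℕ) (s : ℂ), 1 ≤ m → ‖s‖ ≤ R →
      ‖zetaStep m s‖ ≤ C * (m : ℝ) ^ (-s.re - 1) := by
  rcases lt_or_ge R 0 with hR | hR
  · exact ⟨0, le_rfl, fun m s _ hs => absurd (hs.trans_lt hR) (norm_nonneg s).not_gt⟩
  obtain ⟨C, hC0, hC⟩ := exists_lipschitz_expQuot (R + 1)
  refine ⟨1 + C * (R + 1), by positivity, fun m s hm hs => ?_⟩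
  have hm' : (0 : ℝ) < m := by exact_mod_cast hm
  have hm1 : (1 : ℝ) ≤ m := by exact_mod_cast hm
  set w : ℂ := (s - 1) * logStep m with hw
  have hwn : ‖w‖ ≤ (R + 1) / m := norm_sub_one_mul_logStep_le hm hs
  have hwR : ‖w‖ ≤ R + 1 := hwn.trans (div_le_self (by positivity) hm1)
  have h1 : ‖expQuot 0 - expQuot w‖ ≤ C * ((R + 1) / m) := by
    refine (hC 0 w (by simp; positivity) hwR).trans ?_
    rw [zero_sub, norm_neg]
    gcongr
  rw [expQuot_zero] at h1
  have h2 : ‖1 - (m : ℂ) * logStep m * expQuot w‖ ≤ (1 + C * (R + 1)) / m := by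
    have e : 1 - (m : ℂ) * logStep m * expQuot w =
        ((1 - m * logStep m : ℝ) : ℂ) + ((m * logStep m : ℝ) : ℂ) * (1 - expQuot w) := by
      push_cast; ring
    rw [e]
    refine (norm_add_le _ _).trans ?_
    rw [norm_mul, Complex.norm_real, Complex.norm_real,
      Real.norm_of_nonneg (sub_nonneg.2 (mul_logStep_le_one hm)),
      Real.norm_of_nonneg (mul_nonneg hm'.le (logStep_nonneg hm)), add_div]
    refine add_le_add (one_sub_mul_logStep_le hm) ?_
    calc m * logStep m * ‖1 - expQuot w‖ ≤ 1 * (C * ((R + 1) / m)) := by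
          gcongr; exact mul_logStep_le_one hm
      _ = _ := by ring
  rw [zetaStep, norm_mul, norm_natCast_cpow hm, Complex.neg_re, Real.rpow_sub_one hm'.ne']
  calc _ ≤ (m : ℝ) ^ (-s.re) * ((1 + C * (R + 1)) / m) := by gcongr
    _ = _ := by ring

/-- `zetaCorr N s` is the difference between the continuations of `∑_{n ≥ N} n^{-s}` and of
`∫_N^∞ x^{-s} dx`. -/
noncomputable def zetaCorr (N : ℕ) (s : ℂ) : ℂ := ∑' j : ℕ, zetaStep (N + j) s

theorem summable_zetaStep {s : ℂ} (hs : 0 < s.re) {N : ℕ} (hN : 1 ≤ N) :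
    Summable fun j : ℕ => zetaStep (N + j) s := by
  obtain ⟨C, -, hC⟩ := exists_norm_zetaStep_le ‖s‖
  exact .of_norm_bounded ((summable_rpow_tail hs N).mul_left C)
    fun j => hC (N + j) s (by omega) le_rfl

theorem zetaCorr_eq_add {s : ℂ} (hs : 0 < s.re) {N : ℕ} (hN : 1 ≤ N) :
    zetaCorr N s = zetaStep N s + zetaCorr (N + 1) s := by
  rw [zetaCorr, (summable_zetaStep hs hN).tsum_eq_zero_add, zetaCorr]
  simp only [add_zero, add_comm, add_left_comm]

theorem exists_norm_zetaCorr_le (R : ℝ) {δ : ℝ} (hδ : 0 < δ) :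
    ∃ C : ℝ, 0 ≤ C ∧ ∀ (N : ℕ) (s : ℂ), 1 ≤ N → ‖s‖ ≤ R → δ ≤ s.re →
      ‖zetaCorr N s‖ ≤ C * (N : ℝ) ^ (-s.re) := by
  obtain ⟨C, hC0, hC⟩ := exists_norm_zetaStep_le R
  refine ⟨C * (1 + 1 / δ), by positivity, fun N s hN hs hsδ => ?_⟩
  have hs0 : 0 < s.re := hδ.trans_le hsδ
  calc ‖zetaCorr N s‖ ≤ ∑' j : ℕ, C * ((N + j : ℕ) : ℝ) ^ (-s.re - 1) :=
        tsum_of_norm_bounded ((summable_rpow_tail hs0 N).mul_left C).hasSum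
          fun j => hC (N + j) s (by omega) hs
    _ = C * ∑' j : ℕ, ((N + j : ℕ) : ℝ) ^ (-s.re - 1) := tsum_mul_left
    _ ≤ C * ((1 + 1 / s.re) * (N : ℝ) ^ (-s.re)) := by gcongr; exact tsum_rpow_tail_le hs0 hN
    _ ≤ C * ((1 + 1 / δ) * (N : ℝ) ^ (-s.re)) := by gcongr
    _ = _ := by ring

theorem differentiableOn_zetaCorr {N : ℕ} (hN : 1 ≤ N) :
    DifferentiableOn ℂ (zetaCorr N) {s | 0 < s.re} := by
  intro p hp
  have hp' : 0 < p.re := hp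
  obtain ⟨C, hC0, hC⟩ := exists_norm_zetaStep_le (‖p‖ + 1)
  have hU : IsOpen ({s : ℂ | p.re / 2 < s.re} ∩ Metric.ball p 1) :=
    (isOpen_lt continuous_const Complex.continuous_re).inter Metric.isOpen_ball
  have hpU : p ∈ ({s : ℂ | p.re / 2 < s.re} ∩ Metric.ball p 1) :=
    ⟨by simp only [Set.mem_ofPred_eq]; linarith, Metric.mem_ball_self one_pos⟩
  refine DifferentiableAt.differentiableWithinAt ?_
  refine (differentiableOn_tsum_of_norm_le hU
    ((summable_rpow_tail (half_pos hp') N).mul_left C)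
    (fun j => (differentiable_zetaStep (m := N + j) (by omega)).differentiableOn)
    fun j s hs => ?_).differentiableAt (hU.mem_nhds hpU)
  have h1 : (1 : ℝ) ≤ ((N + j : ℕ) : ℝ) := by exact_mod_cast (by omega : 1 ≤ N + j)
  have h2 : ‖s‖ ≤ ‖p‖ + 1 := by
    have := mem_ball_iff_norm.1 hs.2
    linarith [norm_le_norm_add_norm_sub' s p]
  have h3 : p.re / 2 < s.re := hs.1
  refine (hC _ s (by omega) h2).trans ?_
  gcongr

/-- The analytic continuation of `∑_{n ≥ N} n^{-s}` to `Re s > 0`, `s ≠ 1`. -/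
noncomputable def zetaTail (N : ℕ) (s : ℂ) : ℂ := (N : ℂ) ^ (1 - s) / (s - 1) + zetaCorr N s

theorem zetaTail_eq_add {s : ℂ} (hs : 0 < s.re) (hs1 : s ≠ 1) {N : ℕ} (hN : 1 ≤ N) :
    zetaTail N s = (N : ℂ) ^ (-s) + zetaTail (N + 1) s := by
  rw [zetaTail, zetaCorr_eq_add hs hN, zetaStep_eq hN hs1, zetaTail]
  ring

theorem differentiableAt_zetaTail {N : ℕ} (hN : 1 ≤ N) {s : ℂ} (hs : 0 < s.re) (hs1 : s ≠ 1) :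
    DifferentiableAt ℂ (zetaTail N) s := by
  have hN0 : (N : ℂ) ≠ 0 := by exact_mod_cast (by omega : N ≠ 0)
  have h1 : DifferentiableAt ℂ (fun s : ℂ => (N : ℂ) ^ (1 - s)) s :=
    DifferentiableAt.const_cpow (by fun_prop) (Or.inl hN0)
  have hU : {s : ℂ | 0 < s.re} ∈ 𝓝 s :=
    (isOpen_lt continuous_const Complex.continuous_re).mem_nhds hs
  have h2 : DifferentiableAt ℂ (zetaCorr N) s :=
    (differentiableOn_zetaCorr hN).differentiableAt hU
  have h4 : DifferentiableAt ℂ (fun s : ℂ => s - 1) s := by fun_prop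
  have h5 : DifferentiableAt ℂ (fun s : ℂ => (N : ℂ) ^ (1 - s) / (s - 1)) s :=
    h1.fun_div h4 (sub_ne_zero.2 hs1)
  have h6 := h5.fun_add h2
  exact h6

theorem sum_range_cpow_eq_zetaTail_sub {s : ℂ} (hs : 0 < s.re) (hs1 : s ≠ 1) {N : ℕ}
    (hN : 1 ≤ N) (J : ℕ) :
    ∑ j ∈ Finset.range J, ((N + j : ℕ) : ℂ) ^ (-s) = zetaTail N s - zetaTail (N + J) s := by
  induction J with
  | zero => simp
  | succ J ih =>
    rw [Finset.sum_range_succ, ih, zetaTail_eq_add hs hs1 (N := N + J) (by omega), add_assoc N]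
    ring

/-- The partial sums telescope to a difference of two tails, and both parts of the far tail tend to
0 when Re s > 1. -/
theorem hasSum_zetaTail {s : ℂ} (hs : 1 < s.re) {N : ℕ} (hN : 1 ≤ N) :
    HasSum (fun j : ℕ => ((N + j : ℕ) : ℂ) ^ (-s)) (zetaTail N s) := by
  have hs0 : 0 < s.re := by linarith
  have hs1 : s ≠ 1 := by rintro rfl; simp at hs
  have hsum : Summable fun j : ℕ => ((N + j : ℕ) : ℂ) ^ (-s) := by
    refine .of_norm_bounded (summable_rpow_tail (q := s.re - 1) (by linarith) N) fun j => ?_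
    rw [norm_natCast_cpow (by omega)]
    exact le_of_eq (by congr 1; simp)
  have htend : Tendsto (fun J : ℕ => zetaTail (N + J) s) atTop (𝓝 0) := by
    obtain ⟨C, hC0, hC⟩ := exists_norm_zetaCorr_le ‖s‖ hs0
    have hcast : Tendsto (fun J : ℕ => ((N + J : ℕ) : ℝ)) atTop atTop :=
      tendsto_natCast_atTop_atTop.comp (tendsto_add_atTop_nat N |>.congr fun J => add_comm J N)
    have h1 : Tendsto (fun J : ℕ => ((N + J : ℕ) : ℝ) ^ (-(s.re - 1)) / ‖s - 1‖ +
        C * ((N + J : ℕ) : ℝ) ^ (-s.re)) atTop (𝓝 (0 / ‖s - 1‖ + C * 0)) :=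
      (((tendsto_rpow_neg_atTop (by linarith)).comp hcast).div_const _).add
        (((tendsto_rpow_neg_atTop hs0).comp hcast).const_mul _)
    rw [zero_div, mul_zero, add_zero] at h1
    refine squeeze_zero_norm (fun J => ?_) h1
    refine (norm_add_le _ _).trans (add_le_add (le_of_eq ?_) (hC _ s (by omega) le_rfl le_rfl))
    rw [norm_div, norm_natCast_cpow (by omega)]
    congr 2
    simp
  have h2 := hsum.hasSum.tendsto_sum_nat
  simp only [sum_range_cpow_eq_zetaTail_sub hs0 hs1 hN] at h2
  have h3 : Tendsto (fun J : ℕ => zetaTail N s - zetaTail (N + J) s) atTop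
      (𝓝 (zetaTail N s - 0)) := tendsto_const_nhds.sub htend
  rw [sub_zero] at h3
  rw [← tendsto_nhds_unique h2 h3]
  exact hsum.hasSum

/-- On Re s > 1 both sides are the same series; the line Re s = 1, needed for the case σ₁ = 1,
follows by letting a real shift tend to 0 from the right. -/
theorem zetaTail_one_eq_riemannZeta {s : ℂ} (hs : 1 ≤ s.re) (hs1 : s ≠ 1) :
    zetaTail 1 s = riemannZeta s := by
  have h1 : ∀ z : ℂ, 1 < z.re → zetaTail 1 z = riemannZeta z := fun z hz => by
    rw [zeta_eq_tsum_one_div_nat_add_one_cpow hz, ← (hasSum_zetaTail hz le_rfl).tsum_eq]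
    refine tsum_congr fun j => ?_
    rw [Complex.cpow_neg, one_div]
    push_cast
    rw [add_comm]
  have hlim : Tendsto (fun x : ℝ => s + x) (𝓝[>] 0) (𝓝 s) := by
    have : Tendsto (fun x : ℝ => s + x) (𝓝 0) (𝓝 (s + (0 : ℝ))) := by
      refine Continuous.tendsto ?_ 0
      fun_prop
    rw [Complex.ofReal_zero, add_zero] at this
    exact this.mono_left nhdsWithin_le_nhds
  have h2 := (differentiableAt_zetaTail le_rfl (by linarith) hs1).continuousAt.tendsto.comp hlim
  have h3 := (differentiableAt_riemannZeta hs1).continuousAt.tendsto.comp hlim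
  refine tendsto_nhds_unique (h2.congr' ?_) h3
  filter_upwards [self_mem_nhdsWithin] with x hx
  have hx' : (0 : ℝ) < x := hx
  exact h1 _ (by simp; linarith)

end EulerDoubleZeta
namespace EulerDoubleZeta

/-! ### A uniform bound for the tails of the zeta series -/

/-- The nonzero solutions of e^{-u} = 1 have modulus at least 2π; 2 is merely a convenient smaller
radius. -/
theorem expQuot_ne_zero {u : ℂ} (hu : ‖u‖ < 2) : expQuot u ≠ 0 := by
  intro h
  have h1 := mul_expQuot u
  rw [h, mul_zero, eq_comm, sub_eq_zero, eq_comm, Complex.exp_eq_one_iff] at h1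
  obtain ⟨n, hn⟩ := h1
  rcases eq_or_ne n 0 with rfl | hn0
  · have : u = 0 := by simpa using hn
    rw [this, expQuot_zero] at h
    exact one_ne_zero h
  · have h2 : ‖u‖ = |(n : ℝ)| * (2 * Real.pi) := by
      rw [← norm_neg, hn]
      simp [abs_of_pos Real.pi_pos]
    have h3 : (1 : ℝ) ≤ |(n : ℝ)| := by exact_mod_cast Int.one_le_abs hn0
    nlinarith [Real.pi_gt_three]

/-- The function `1 / (1 - e^{-u}) - 1 / u`, holomorphic for `|u| < 2π`. -/
noncomputable def bernoulliQuot (u : ℂ) : ℂ := -dslope expQuot 0 u / expQuot u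

theorem bernoulliQuot_mul {u : ℂ} (hu : ‖u‖ < 2) :
    bernoulliQuot u * (1 - Complex.exp (-u)) = 1 - expQuot u := by
  have h1 := sub_smul_dslope expQuot 0 u
  rw [sub_zero, smul_eq_mul, expQuot_zero] at h1
  rw [← mul_expQuot, bernoulliQuot]
  have := expQuot_ne_zero hu
  field_simp
  linear_combination -h1

theorem exists_lipschitz_bernoulliQuot :
    ∃ C : ℝ, 0 ≤ C ∧ ∀ u v : ℂ, ‖u‖ ≤ 1 → ‖v‖ ≤ 1 →
      ‖bernoulliQuot u - bernoulliQuot v‖ ≤ C * ‖u - v‖ := by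
  refine exists_lipschitz_of_differentiableOn (R' := 2) (by norm_num) fun u hu => ?_
  have h : DifferentiableOn ℂ (dslope expQuot 0) Set.univ :=
    (Complex.differentiableOn_dslope univ_mem).2 differentiable_expQuot.differentiableOn
  have h1 : DifferentiableAt ℂ (dslope expQuot 0) u := h.differentiableAt univ_mem
  have h2 : DifferentiableAt ℂ (fun u => -dslope expQuot 0 u / expQuot u) u :=
    h1.fun_neg.fun_div (differentiable_expQuot u) (expQuot_ne_zero (by simpa using hu))
  exact h2.differentiableWithinAt

/-- Near m the sequence n^{-s} resembles a geometric progression of ratio e^{-u}, u = s/m. For an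
exact progression the sum minus the integral is the first term times 1/(1-e^{-u}) - 1/u. Hence
`zetaStep` is nearly a difference of consecutive values of m^{-s}·`bernoulliQuot (s / m)`, with
constants uniform in |s| ≤ m, and summation telescopes. -/
theorem exists_norm_zetaStep_sub_le :
    ∃ C : ℝ, 0 ≤ C ∧ ∀ (m : ℕ) (s : ℂ), 1 ≤ m → ‖s‖ ≤ m →
      ‖zetaStep m s - ((m : ℂ) ^ (-s) * bernoulliQuot (s / m) -
        ((m + 1 : ℕ) : ℂ) ^ (-s) * bernoulliQuot (s / (m + 1 : ℕ)))‖ ≤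
      C * (m : ℝ) ^ (-s.re - 1) := by
  obtain ⟨A, hA0, hA⟩ := exists_lipschitz_expQuot 2
  obtain ⟨B, hB0, hB⟩ := exists_lipschitz_bernoulliQuot
  obtain ⟨D, hD0, hD⟩ := exists_lipschitz_of_differentiableOn (f := Complex.exp) (R := 1)
    (R' := 2) (by norm_num) (by fun_prop)
  set M : ℝ := B + ‖bernoulliQuot 0‖ with hM
  refine ⟨2 * A + (1 + 2 * A) + D * M + Real.exp 1 * B, by positivity, fun m s hm hs => ?_⟩
  have hm' : (0 : ℝ) < m := by exact_mod_cast hm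
  have hm1 : (1 : ℝ) ≤ m := by exact_mod_cast hm
  have hmC : (m : ℂ) ≠ 0 := by exact_mod_cast hm'.ne'
  have hm2 : ((m : ℂ) + 1) ≠ 0 := by exact_mod_cast (by omega : m + 1 ≠ 0)
  have hL0 := logStep_nonneg hm
  have hL1 := logStep_le_inv hm
  have hL2 := mul_logStep_le_one hm
  have hL3 := one_sub_mul_logStep_le hm
  set u : ℂ := s / m with hu
  set u' : ℂ := s / (m + 1 : ℕ) with hu'
  set w : ℂ := (s - 1) * logStep m with hw
  have hun : ‖u‖ ≤ 1 := by
    rw [hu, norm_div, Complex.norm_natCast]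
    exact div_le_one_of_le₀ hs hm'.le
  have hu'n : ‖u'‖ ≤ 1 := by
    rw [hu', norm_div, Complex.norm_natCast]
    exact div_le_one_of_le₀ (hs.trans (by push_cast; linarith)) (by positivity)
  have hwn : ‖w‖ ≤ 2 := by
    refine (norm_sub_one_mul_logStep_le hm hs).trans ?_
    rw [div_le_iff₀ hm']
    linarith
  have hsL : ‖-(s * logStep m)‖ ≤ 1 := by
    rw [norm_neg, norm_mul, Complex.norm_real, Real.norm_of_nonneg hL0]
    exact (mul_le_mul_of_nonneg_right hs hL0).trans hL2
  have hdiff : ‖s * (logStep m : ℂ) - u‖ ≤ 1 / m := by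
    have e : s * (logStep m : ℂ) - u = -(u * ((1 - m * logStep m : ℝ) : ℂ)) := by
      rw [hu]; push_cast; field_simp; ring
    rw [e, norm_neg, norm_mul, Complex.norm_real, Real.norm_of_nonneg (by linarith)]
    calc ‖u‖ * (1 - m * logStep m) ≤ 1 * (1 / m) := by gcongr
      _ = _ := one_mul _
  have huw : ‖u - w‖ ≤ 2 / m := by
    have e : u - w = -(s * (logStep m : ℂ) - u) + (logStep m : ℂ) := by rw [hw]; ring
    rw [e]
    refine (norm_add_le _ _).trans ?_
    rw [norm_neg, Complex.norm_real, Real.norm_of_nonneg hL0]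
    calc _ ≤ 1 / (m : ℝ) + 1 / m := add_le_add hdiff hL1
      _ = _ := by ring
  have hφw : ‖expQuot w‖ ≤ 1 + 2 * A := by
    have h1 := hA w 0 hwn (by simp)
    rw [expQuot_zero, sub_zero] at h1
    have h2 := norm_le_norm_add_norm_sub' (expQuot w) 1
    rw [norm_one] at h2
    nlinarith
  have hβ : ‖bernoulliQuot u'‖ ≤ M := by
    have h1 := hB u' 0 hu'n (by simp)
    rw [sub_zero] at h1
    have h2 := norm_le_norm_add_norm_sub' (bernoulliQuot u') (bernoulliQuot 0)
    nlinarith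
  have huu : ‖u' - u‖ ≤ 1 / m := by
    have e : u' - u = -(u * (1 / (m + 1 : ℕ) : ℂ)) := by
      rw [hu, hu']; push_cast; field_simp; ring
    have e' : ‖(1 / (m + 1 : ℕ) : ℂ)‖ = 1 / ((m + 1 : ℕ) : ℝ) := by
      rw [norm_div, norm_one, Complex.norm_natCast]
    rw [e, norm_neg, norm_mul, e']
    calc ‖u‖ * (1 / ((m + 1 : ℕ) : ℝ)) ≤ 1 * (1 / m) := by
          gcongr; linarith
      _ = _ := one_mul _
  have t1 : ‖expQuot u - m * logStep m * expQuot w‖ ≤ (2 * A + (1 + 2 * A)) / m := by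
    have e : expQuot u - m * logStep m * expQuot w =
        (expQuot u - expQuot w) + ((1 - m * logStep m : ℝ) : ℂ) * expQuot w := by
      push_cast; ring
    rw [e]
    refine (norm_add_le _ _).trans ?_
    rw [norm_mul, Complex.norm_real, Real.norm_of_nonneg (by linarith)]
    calc _ ≤ A * (2 / m) + 1 / m * (1 + 2 * A) := by
          refine add_le_add ((hA u w (hun.trans (by norm_num)) hwn).trans ?_) ?_ <;> gcongr
      _ = _ := by ring
  have t2 : ‖(Complex.exp (-(s * logStep m)) - Complex.exp (-u)) * bernoulliQuot u'‖ ≤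
      D * M / m := by
    rw [norm_mul]
    calc _ ≤ D * (1 / m) * M := by
          gcongr
          refine (hD _ _ hsL (by rwa [norm_neg])).trans ?_
          gcongr
          rwa [show -(s * (logStep m : ℂ)) - -u = -(s * (logStep m : ℂ) - u) by ring, norm_neg]
      _ = _ := by ring
  have t3 : ‖Complex.exp (-u) * (bernoulliQuot u' - bernoulliQuot u)‖ ≤ Real.exp 1 * B / m := by
    rw [norm_mul]
    calc _ ≤ Real.exp 1 * (B * (1 / m)) := by
          gcongr
          · refine (Complex.norm_exp_le_exp_norm _).trans (Real.exp_le_exp.2 ?_)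
            rwa [norm_neg]
          · refine (hB u' u hu'n hun).trans ?_
            gcongr
      _ = _ := by ring
  have hkey := bernoulliQuot_mul (hun.trans_lt (by norm_num))
  -- The identity for `bernoulliQuot` cancels the main parts. Three replacements remain, each
  -- costing O(1/m): w by u, s·`logStep m` by u, and s/(m+1) by s/m.
  have hfac : zetaStep m s - ((m : ℂ) ^ (-s) * bernoulliQuot u -
        ((m + 1 : ℕ) : ℂ) ^ (-s) * bernoulliQuot u') =
      (m : ℂ) ^ (-s) * ((expQuot u - m * logStep m * expQuot w) +
        (Complex.exp (-(s * logStep m)) - Complex.exp (-u)) * bernoulliQuot u' +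
        Complex.exp (-u) * (bernoulliQuot u' - bernoulliQuot u)) := by
    rw [natCast_succ_cpow hm, zetaStep, ← hw,
      show (logStep m : ℂ) * -s = -(s * logStep m) by ring]
    linear_combination (-(m : ℂ) ^ (-s)) * hkey
  rw [hfac, norm_mul, norm_natCast_cpow hm, Complex.neg_re, Real.rpow_sub_one hm'.ne']
  calc _ ≤ (m : ℝ) ^ (-s.re) * ((2 * A + (1 + 2 * A)) / m + D * M / m + Real.exp 1 * B / m) := by
        gcongr
        exact (norm_add₃_le).trans (add_le_add (add_le_add t1 t2) t3)
    _ = _ := by ring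

/-- For `|s| ≤ N` the tail `∑_{n ≥ N} n^{-s}` differs from `N^{1-s} / (s - 1)` by
`O(N^{-Re s})`. -/
theorem exists_norm_zetaCorr_le_of_norm_le {σ : ℝ} (hσ : 0 < σ) :
    ∃ C : ℝ, 0 ≤ C ∧ ∀ (N : ℕ) (s : ℂ), 1 ≤ N → s.re = σ → ‖s‖ ≤ N →
      ‖zetaCorr N s‖ ≤ C * (N : ℝ) ^ (-σ) := by
  obtain ⟨A, hA0, hA⟩ := exists_norm_zetaStep_sub_le
  obtain ⟨B, hB0, hB⟩ := exists_lipschitz_bernoulliQuot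
  set M : ℝ := B + ‖bernoulliQuot 0‖ with hM
  refine ⟨A * (1 + 1 / σ) + M, by positivity, fun N s hN hs hsN => ?_⟩
  set G : ℕ → ℂ := fun m => (m : ℂ) ^ (-s) * bernoulliQuot (s / m) with hG
  have hs0 : 0 < s.re := hs ▸ hσ
  have hGn : ∀ m : ℕ, N ≤ m → ‖G m‖ ≤ M * (m : ℝ) ^ (-σ) := fun m hm => by
    have hm1 : 1 ≤ m := hN.trans hm
    have hm' : (0 : ℝ) < m := by exact_mod_cast hm1
    have hu : ‖s / m‖ ≤ 1 := by
      rw [norm_div, Complex.norm_natCast]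
      exact div_le_one_of_le₀ (hsN.trans (by exact_mod_cast hm)) hm'.le
    have h1 := hB (s / m) 0 hu (by simp)
    rw [sub_zero] at h1
    have h2 := norm_le_norm_add_norm_sub' (bernoulliQuot (s / m)) (bernoulliQuot 0)
    rw [hG, norm_mul, norm_natCast_cpow hm1, Complex.neg_re, hs, mul_comm]
    gcongr
    nlinarith
  -- The correction minus its model G is pushed from N to N + J; only the uniform step errors
  -- accumulate.
  have hfin : ∀ J : ℕ, ‖zetaCorr N s - G N‖ ≤
      A * ∑ j ∈ Finset.range J, ((N + j : ℕ) : ℝ) ^ (-σ - 1) +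
        ‖zetaCorr (N + J) s - G (N + J)‖ := by
    intro J
    induction J with
    | zero => simp
    | succ J ih =>
      refine ih.trans ?_
      rw [Finset.sum_range_succ, mul_add, add_assoc, add_le_add_iff_left]
      have h := hA (N + J) s (by omega) (hsN.trans (by exact_mod_cast Nat.le_add_right N J))
      rw [hs] at h
      have e : zetaCorr (N + J) s - G (N + J) = (zetaStep (N + J) s - (G (N + J) - G (N + J + 1))) +
          (zetaCorr (N + J + 1) s - G (N + J + 1)) := by
        rw [zetaCorr_eq_add hs0 (N := N + J) (by omega)]
        ring
      rw [e]
      exact (norm_add_le _ _).trans (add_le_add h le_rfl)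
  -- This constant depends on s, but it multiplies (N + J)^{-σ} and disappears as J tends to
  -- infinity.
  obtain ⟨C, hC0, hC⟩ := exists_norm_zetaCorr_le ‖s‖ hs0
  have hcast : Tendsto (fun J : ℕ => ((N + J : ℕ) : ℝ)) atTop atTop :=
    tendsto_natCast_atTop_atTop.comp (tendsto_add_atTop_nat N |>.congr fun J => add_comm J N)
  have hlim : Tendsto (fun J : ℕ => A * ((1 + 1 / σ) * (N : ℝ) ^ (-σ)) +
      (C + M) * ((N + J : ℕ) : ℝ) ^ (-σ)) atTop
      (𝓝 (A * ((1 + 1 / σ) * (N : ℝ) ^ (-σ)) + (C + M) * 0)) :=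
    tendsto_const_nhds.add (((tendsto_rpow_neg_atTop hσ).comp hcast).const_mul _)
  rw [mul_zero, add_zero] at hlim
  have hmain : ‖zetaCorr N s - G N‖ ≤ A * ((1 + 1 / σ) * (N : ℝ) ^ (-σ)) := by
    refine ge_of_tendsto' hlim fun J => (hfin J).trans (add_le_add ?_ ?_)
    · gcongr
      exact sum_range_rpow_tail_le hσ hN J
    · have h1 := hC (N + J) s (by omega) le_rfl le_rfl
      rw [hs] at h1
      refine (norm_sub_le _ _).trans ?_
      rw [add_mul]
      exact add_le_add h1 (hGn _ (by omega))
  have h1 := norm_le_norm_add_norm_sub' (zetaCorr N s) (G N)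
  have h2 := hGn N le_rfl
  linarith

end EulerDoubleZeta
namespace EulerDoubleZeta

/-! ### The continuation of the double series -/

/-- `zetaDiff m s` is the continuation of `∑_{n > m} n^{-s} - m^{1-s} / (s - 1)`. -/
noncomputable def zetaDiff (m : ℕ) (s : ℂ) : ℂ := zetaCorr m s - (m : ℂ) ^ (-s)

theorem zetaTail_succ_eq {s : ℂ} (hs : 0 < s.re) (hs1 : s ≠ 1) {m : ℕ} (hm : 1 ≤ m) :
    zetaTail (m + 1) s = (m : ℂ) ^ (1 - s) / (s - 1) + zetaDiff m s := by
  have h := zetaTail_eq_add hs hs1 hm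
  rw [zetaTail] at h
  rw [zetaDiff]
  linear_combination -h

theorem norm_zetaDiff_le {C : ℝ} {m : ℕ} (hm : 1 ≤ m) {s : ℂ}
    (h : ‖zetaCorr m s‖ ≤ C * (m : ℝ) ^ (-s.re)) :
    ‖zetaDiff m s‖ ≤ (C + 1) * (m : ℝ) ^ (-s.re) := by
  refine (norm_sub_le _ _).trans ?_
  rw [norm_natCast_cpow hm, Complex.neg_re]
  linarith

theorem norm_cpow_mul_le {m : ℕ} (hm : 1 ≤ m) {s₁ z : ℂ} {C σ : ℝ}
    (h : ‖z‖ ≤ C * (m : ℝ) ^ (-σ)) :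
    ‖(m : ℂ) ^ (-s₁) * z‖ ≤ C * (m : ℝ) ^ (-(s₁.re + σ - 1) - 1) := by
  have hm' : (0 : ℝ) < m := by exact_mod_cast hm
  rw [norm_mul, norm_natCast_cpow hm, Complex.neg_re,
    show -(s₁.re + σ - 1) - 1 = -s₁.re + -σ by ring, Real.rpow_add hm']
  calc _ ≤ (m : ℝ) ^ (-s₁.re) * (C * (m : ℝ) ^ (-σ)) := by gcongr
    _ = _ := by ring

/-- The continuation of `∑_{m ≥ N} m^{-s₁} (∑_{n > m} n^{-s₂} - m^{1-s₂} / (s₂ - 1))`. -/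
noncomputable def doubleCorr (N : ℕ) (s : ℂ × ℂ) : ℂ :=
  ∑' j : ℕ, ((N + j : ℕ) : ℂ) ^ (-s.1) * zetaDiff (N + j) s.2

theorem mem_tube_zero {s : ℂ × ℂ} : s ∈ tube 0 ↔ 0 < s.2.re ∧ 1 < s.1.re + s.2.re := by
  simp [tube]

theorem isOpen_tube (c : ℝ) : IsOpen (tube c) :=
  (isOpen_lt continuous_const (Complex.continuous_re.comp continuous_snd)).inter
    (isOpen_lt continuous_const (Complex.continuous_re.comp (continuous_fst.add continuous_snd)))

theorem summable_doubleCorr {s : ℂ × ℂ} (hs : s ∈ tube 0) {N : ℕ} (hN : 1 ≤ N) :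
    Summable fun j : ℕ => ((N + j : ℕ) : ℂ) ^ (-s.1) * zetaDiff (N + j) s.2 := by
  rw [mem_tube_zero] at hs
  obtain ⟨C, hC0, hC⟩ := exists_norm_zetaCorr_le ‖s.2‖ hs.1
  refine .of_norm_bounded ((summable_rpow_tail (q := s.1.re + s.2.re - 1)
    (by linarith) N).mul_left (C + 1)) fun j => ?_
  exact norm_cpow_mul_le (by omega)
    (norm_zetaDiff_le (by omega) (hC (N + j) s.2 (by omega) le_rfl le_rfl))

theorem doubleCorr_eq_add {s : ℂ × ℂ} (hs : s ∈ tube 0) {N : ℕ} (hN : 1 ≤ N) :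
    doubleCorr N s = (N : ℂ) ^ (-s.1) * zetaDiff N s.2 + doubleCorr (N + 1) s := by
  rw [doubleCorr, (summable_doubleCorr hs hN).tsum_eq_zero_add, doubleCorr]
  simp only [add_zero, add_comm, add_left_comm]

/-- If |s₂| ≤ N then |s₂| ≤ m for every m ≥ N, so the uniform bound for the zeta tails applies to
each term and the constant does not depend on the imaginary parts. -/
theorem exists_norm_doubleCorr_le {σ₁ σ₂ : ℝ} (h2 : 0 < σ₂) (h12 : 1 < σ₁ + σ₂) :
    ∃ C : ℝ, 0 ≤ C ∧ ∀ (N : ℕ) (s : ℂ × ℂ), 1 ≤ N → s.1.re = σ₁ → s.2.re = σ₂ → ‖s.2‖ ≤ N →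
      ‖doubleCorr N s‖ ≤ C * (N : ℝ) ^ (1 - σ₁ - σ₂) := by
  obtain ⟨C, hC0, hC⟩ := exists_norm_zetaCorr_le_of_norm_le h2
  have hq : 0 < σ₁ + σ₂ - 1 := by linarith
  refine ⟨(C + 1) * (1 + 1 / (σ₁ + σ₂ - 1)), by positivity, fun N s hN hs1 hs2 hs => ?_⟩
  calc ‖doubleCorr N s‖ ≤ ∑' j : ℕ, (C + 1) * ((N + j : ℕ) : ℝ) ^ (-(σ₁ + σ₂ - 1) - 1) := by
        refine tsum_of_norm_bounded ((summable_rpow_tail hq N).mul_left _).hasSum fun j => ?_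
        rw [← hs1]
        refine norm_cpow_mul_le (by omega) ?_
        rw [← hs2]
        refine norm_zetaDiff_le (by omega) ?_
        rw [hs2]
        exact hC (N + j) s.2 (by omega) hs2 (hs.trans (by exact_mod_cast Nat.le_add_right N j))
    _ = (C + 1) * ∑' j : ℕ, ((N + j : ℕ) : ℝ) ^ (-(σ₁ + σ₂ - 1) - 1) := tsum_mul_left
    _ ≤ (C + 1) * ((1 + 1 / (σ₁ + σ₂ - 1)) * (N : ℝ) ^ (-(σ₁ + σ₂ - 1))) := by
        gcongr; exact tsum_rpow_tail_le hq hN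
    _ = _ := by rw [show -(σ₁ + σ₂ - 1) = 1 - σ₁ - σ₂ by ring]; ring

theorem differentiableOn_doubleCorr {N : ℕ} (hN : 1 ≤ N) :
    DifferentiableOn ℂ (doubleCorr N) (tube 0) := by
  intro p hp
  obtain ⟨hp1, hp2⟩ := mem_tube_zero.1 hp
  set δ : ℝ := (p.1.re + p.2.re - 1) / 2 with hδ
  have hδ0 : 0 < δ := by rw [hδ]; linarith
  obtain ⟨C, hC0, hC⟩ := exists_norm_zetaCorr_le (‖p.2‖ + 1) (half_pos hp1)
  have hU : IsOpen {s : ℂ × ℂ | (p.2.re / 2 < s.2.re ∧ 1 + δ < s.1.re + s.2.re) ∧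
      ‖s.2‖ < ‖p.2‖ + 1} :=
    ((isOpen_lt (by fun_prop) (by fun_prop)).and (isOpen_lt (by fun_prop) (by fun_prop))).and
      (isOpen_lt (by fun_prop) (by fun_prop))
  refine DifferentiableAt.differentiableWithinAt ?_
  refine (differentiableOn_tsum_of_norm_le hU ((summable_rpow_tail hδ0 N).mul_left (C + 1))
    (fun j => ?_) fun j s hs => ?_).differentiableAt (hU.mem_nhds ?_)
  · have hm0 : ((N + j : ℕ) : ℂ) ≠ 0 := by exact_mod_cast (by omega : N + j ≠ 0)
    intro s hs
    have hs2 : 0 < s.2.re := (half_pos hp1).trans hs.1.1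
    have hnhds : {z : ℂ | 0 < z.re} ∈ 𝓝 s.2 :=
      (isOpen_lt continuous_const Complex.continuous_re).mem_nhds hs2
    have h1 : DifferentiableAt ℂ (fun s : ℂ × ℂ => ((N + j : ℕ) : ℂ) ^ (-s.1)) s :=
      (differentiableAt_fst.fun_neg).const_cpow (Or.inl hm0)
    have h2 : DifferentiableAt ℂ (fun s : ℂ × ℂ => ((N + j : ℕ) : ℂ) ^ (-s.2)) s :=
      (differentiableAt_snd.fun_neg).const_cpow (Or.inl hm0)
    have h3 : DifferentiableAt ℂ (zetaCorr (N + j)) s.2 :=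
      (differentiableOn_zetaCorr (by omega)).differentiableAt hnhds
    have h4 : DifferentiableAt ℂ (fun s : ℂ × ℂ => zetaCorr (N + j) s.2) s :=
      h3.comp s differentiableAt_snd
    exact (h1.fun_mul (h4.fun_sub h2)).differentiableWithinAt
  · have h1 : (1 : ℝ) ≤ ((N + j : ℕ) : ℝ) := by exact_mod_cast (by omega : 1 ≤ N + j)
    refine (norm_cpow_mul_le (by omega)
      (norm_zetaDiff_le (by omega) (hC (N + j) s.2 (by omega) hs.2.le hs.1.1.le))).trans ?_
    have h3 := hs.1.2
    gcongr
    linarith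
  · refine ⟨⟨by linarith, by rw [hδ]; linarith⟩, by linarith⟩

/-- The analytic continuation of the double series to `Re s₂ > 0`, `Re (s₁ + s₂) > 1`. -/
noncomputable def doubleZeta (s : ℂ × ℂ) : ℂ :=
  zetaTail 1 (s.1 + s.2 - 1) / (s.2 - 1) + doubleCorr 1 s

/-- Here Re(s₁ + s₂) > 1, which excludes all the hyperplanes s₁ + s₂ = 1, 0, -2, … at once. -/
theorem mem_regularSet_iff_of_mem_tube {s : ℂ × ℂ} (hs : s ∈ tube 0) :
    s ∈ regularSet ↔ s.2 ≠ 1 ∧ s.1 + s.2 ≠ 2 := by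
  obtain ⟨-, h⟩ := mem_tube_zero.1 hs
  refine ⟨fun h => ⟨h.1, h.2.1⟩, fun h' => ⟨h'.1, h'.2, fun e => ?_, fun k e => ?_⟩⟩
  · have := congrArg Complex.re e
    simp at this
    linarith
  · have := congrArg Complex.re e
    have hk : (0 : ℝ) ≤ k := Nat.cast_nonneg k
    simp at this
    linarith

theorem tube_anti {c d : ℝ} (h : c ≤ d) : tube d ⊆ tube c := fun _ hs =>
  ⟨h.trans_lt hs.1, (add_le_add_right h 1).trans_lt hs.2⟩

theorem isOpen_regularSet_inter_tube {c : ℝ} (hc : 0 ≤ c) : IsOpen (regularSet ∩ tube c) := by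
  have h : regularSet ∩ tube c = {s : ℂ × ℂ | s.2 ≠ 1 ∧ s.1 + s.2 ≠ 2} ∩ tube c := by
    ext s
    exact and_congr_left fun hs => mem_regularSet_iff_of_mem_tube (tube_anti hc hs)
  rw [h]
  exact ((isOpen_ne_fun (by fun_prop) (by fun_prop)).inter
    (isOpen_ne_fun (by fun_prop) (by fun_prop))).inter (isOpen_tube c)

theorem differentiableOn_doubleZeta : DifferentiableOn ℂ doubleZeta (regularSet ∩ tube 0) := by
  intro s hs
  obtain ⟨h1, h2⟩ := (mem_regularSet_iff_of_mem_tube hs.2).1 hs.1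
  obtain ⟨h3, h4⟩ := mem_tube_zero.1 hs.2
  have d1 : DifferentiableAt ℂ (zetaTail 1) (s.1 + s.2 - 1) :=
    differentiableAt_zetaTail le_rfl (by simp; linarith)
      (fun e => h2 (by linear_combination e))
  have d2 : DifferentiableAt ℂ (fun s : ℂ × ℂ => zetaTail 1 (s.1 + s.2 - 1)) s :=
    d1.comp s (f := fun s : ℂ × ℂ => s.1 + s.2 - 1) (by fun_prop)
  have d3 : DifferentiableAt ℂ (fun s : ℂ × ℂ => s.2 - 1) s := by fun_prop
  have h1' : s.2 - 1 ≠ 0 := sub_ne_zero.2 h1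
  have d4 : DifferentiableAt ℂ (fun s : ℂ × ℂ => zetaTail 1 (s.1 + s.2 - 1) / (s.2 - 1)) s := by
    simp only [div_eq_mul_inv]
    exact d2.fun_mul (d3.fun_inv h1')
  have d5 : DifferentiableAt ℂ (doubleCorr 1) s :=
    (differentiableOn_doubleCorr le_rfl).differentiableAt ((isOpen_tube 0).mem_nhds hs.2)
  exact (d4.fun_add d5).differentiableWithinAt

/-- The main part m^{1-s₂}/(s₂-1) of the inner sum, multiplied by m^{-s₁}, sums to
ζ(s₁+s₂-1)/(s₂-1); the rest is `doubleCorr`. -/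
theorem doubleZeta_eq_series {s : ℂ × ℂ} (hs : s ∈ tube 1) : doubleZeta s = series s := by
  have hs' : 1 < s.2.re ∧ 1 + 1 < (s.1 + s.2).re := hs
  rw [Complex.add_re] at hs'
  have hs1 : s.2 ≠ 1 := fun e => by simp [e] at hs'
  have hw : HasSum (fun j : ℕ => ((1 + j : ℕ) : ℂ) ^ (-(s.1 + s.2 - 1)))
      (zetaTail 1 (s.1 + s.2 - 1)) := hasSum_zetaTail (by simp; linarith) le_rfl
  have hc := (summable_doubleCorr (tube_anti zero_le_one hs) le_rfl).hasSum
  have hadd := (hw.div_const (s.2 - 1)).add hc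
  rw [series, doubleZeta, doubleCorr, ← hadd.tsum_eq]
  refine tsum_congr fun j => ?_
  have hm0 : ((1 + j : ℕ) : ℂ) ≠ 0 := by exact_mod_cast (by omega : 1 + j ≠ 0)
  have hin : ∑' n : ℕ, 1 / (((j : ℂ) + 1) + ((n : ℂ) + 1)) ^ s.2 = zetaTail (1 + j + 1) s.2 := by
    rw [← (hasSum_zetaTail hs'.1 (N := 1 + j + 1) (by omega)).tsum_eq]
    refine tsum_congr fun n => ?_
    rw [Complex.cpow_neg, one_div]
    congr 2
    push_cast
    ring
  rw [hin, zetaTail_succ_eq (by linarith) hs1 (by omega), mul_add, one_div,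
    show (j : ℂ) + 1 = ((1 + j : ℕ) : ℂ) by push_cast; ring, ← Complex.cpow_neg, ← mul_div_assoc,
    ← Complex.cpow_add _ _ hm0]
  congr 4
  ring

theorem isValue_doubleZeta {s : ℂ × ℂ} (hs : s ∈ regularSet ∩ tube 0) :
    IsValue s (doubleZeta s) :=
  ⟨0, doubleZeta, differentiableOn_doubleZeta, fun _ => doubleZeta_eq_series, hs, rfl⟩

/-- `zeta₂` picks a value by choice, so any witness, on whatever tube, has to agree with
`doubleZeta`. Both are holomorphic on the smaller of the two domains and equal on `tube 1`; a
segment from s to a point of `tube 1` transports the equality. -/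
theorem IsValue.eq_doubleZeta {s : ℂ × ℂ} {w : ℂ} (h : IsValue s w)
    (hs : s ∈ regularSet ∩ tube 0) (him : s.2.im ≠ 0) : w = doubleZeta s := by
  obtain ⟨c, f, hf, hfs, hsc, rfl⟩ := h
  obtain ⟨hreg, hs0⟩ := hs
  -- The sign of ε makes Im(s₁ + s₂) move away from 0 along the segment, which keeps it off s₁ + s₂
  -- = 2.
  obtain ⟨ε, hε, hεs⟩ : ∃ ε : ℝ, ε ≠ 0 ∧ 0 ≤ ε * (s.1 + s.2).im := by
    rcases le_total 0 (s.1 + s.2).im with h | h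
    · exact ⟨1, one_ne_zero, by simpa using h⟩
    · exact ⟨-1, by norm_num, by linarith⟩
  set d : ℝ := max c 0 with hd
  have hsd : s ∈ tube d := by
    rcases max_choice c 0 with h | h
    · rw [hd, h]; exact hsc.2
    · rw [hd, h]; exact hs0
  have hs0' := mem_tube_zero.1 hs0
  -- The shift of s₂ by 2 leads into `tube 1` and leaves Im s₂ ≠ 0 unchanged, so s₂ = 1 is never
  -- met.
  set p : ℂ × ℂ := (s.1 + ε * Complex.I, s.2 + 2) with hp
  have hp1 : p ∈ tube 1 := by
    simp [tube, hp]
    constructor <;> linarith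
  refine eq_of_differentiableOn_of_segment_subset
    (isOpen_regularSet_inter_tube (le_max_right c 0)) (p := p)
    (hf.mono (Set.inter_subset_inter_right _ (tube_anti (le_max_left c 0))))
    (differentiableOn_doubleZeta.mono
      (Set.inter_subset_inter_right _ (tube_anti (le_max_right c 0)))) ?_ ?_
  · rw [segment_eq_image']
    rintro _ ⟨θ, ⟨hθ0, hθ1⟩, rfl⟩
    rcases hθ0.eq_or_lt with rfl | hθ
    · simpa only [zero_smul, add_zero] using ⟨hreg, hsd⟩
    have hmem : s + θ • (p - s) ∈ tube d := by
      obtain ⟨h1, h2⟩ := hsd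
      rw [Complex.add_re] at h2
      simp [tube, hp]
      constructor <;> linarith
    refine ⟨(mem_regularSet_iff_of_mem_tube (tube_anti (le_max_right c 0) hmem)).2
      ⟨fun e => him ?_, fun e => ?_⟩, hmem⟩
    · have := congrArg Complex.im e
      simpa [hp] using this
    · have := congrArg Complex.im e
      simp [hp] at this
      rw [Complex.add_im] at hεs
      have h3 : 0 < θ * ε ^ 2 := by positivity
      have h4 : ε * (s.1.im + s.2.im) = -(θ * ε ^ 2) := by linear_combination ε * this
      linarith
  · filter_upwards [(isOpen_tube 1).mem_nhds hp1] with z hz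
    rw [hfs z hz, doubleZeta_eq_series hz]

theorem zeta₂_eq_doubleZeta {s₁ s₂ : ℂ} (hs : (s₁, s₂) ∈ regularSet ∩ tube 0) (him : s₂.im ≠ 0) :
    zeta₂ s₁ s₂ = doubleZeta (s₁, s₂) := by
  have h : ∃ w, IsValue (s₁, s₂) w := ⟨_, isValue_doubleZeta hs⟩
  rw [zeta₂, dif_pos h]
  exact h.choose_spec.eq_doubleZeta hs him

/-! ### Approximation by Dirichlet polynomials -/

/-- The coefficients `∑_{m < n} m^{-s}`. -/
noncomputable def powerSum (s : ℂ) (n : ℕ) : ℂ := ∑ m ∈ Finset.Ico 1 n, 1 / (m : ℂ) ^ s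

theorem powerSum_succ (s : ℂ) {n : ℕ} (hn : 1 ≤ n) :
    powerSum s (n + 1) = powerSum s n + (n : ℂ) ^ (-s) := by
  rw [powerSum, Finset.sum_Ico_succ_top hn, powerSum, Complex.cpow_neg, one_div]

/-- Exact at every N, by induction: one term moves from the tail of ∑ n^{-s₂} into the polynomial,
and the growth of the coefficient from N to N + 1 is paid for by one step of each of the last two
terms. -/
theorem doubleZeta_eq {s : ℂ × ℂ} (hs : s ∈ regularSet ∩ tube 0) {N : ℕ} (hN : 1 ≤ N) :
    doubleZeta s = ∑ n ∈ Finset.Ico 1 N, powerSum s.1 n * (n : ℂ) ^ (-s.2) +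
      powerSum s.1 N * zetaTail N s.2 + zetaTail N (s.1 + s.2 - 1) / (s.2 - 1) +
      doubleCorr N s := by
  obtain ⟨h1, h2⟩ := (mem_regularSet_iff_of_mem_tube hs.2).1 hs.1
  obtain ⟨h3, h4⟩ := mem_tube_zero.1 hs.2
  induction N, hN using Nat.le_induction with
  | base => simp [powerSum, doubleZeta]
  | succ N hN ih =>
    have hN0 : (N : ℂ) ≠ 0 := by exact_mod_cast (by omega : N ≠ 0)
    have e : (N : ℂ) ^ (-(s.1 + s.2 - 1)) = (N : ℂ) ^ (-s.1) * (N : ℂ) ^ (1 - s.2) := by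
      rw [← Complex.cpow_add _ _ hN0]
      congr 1
      ring
    rw [ih, Finset.sum_Ico_succ_top hN, powerSum_succ _ hN, doubleCorr_eq_add hs.2 hN,
      zetaTail_eq_add (s := s.1 + s.2 - 1) (by simp; linarith)
        (fun e => h2 (by linear_combination e)) hN, e]
    have e1 := zetaTail_succ_eq h3 h1 hN
    have e2 := zetaTail_eq_add h3 h1 hN
    linear_combination powerSum s.1 N * e2 - (N : ℂ) ^ (-s.1) * e1

theorem exists_mul_le_norm_add_mul_I {b : ℂ} (hb : ∀ t : ℝ, 2 ≤ t → b + t * Complex.I ≠ 0) :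
    ∃ c : ℝ, 0 < c ∧ ∀ t : ℝ, 2 ≤ t → c * t ≤ ‖b + t * Complex.I‖ := by
  -- Beyond 2‖b‖ + 2 the triangle inequality gives at least t/2; the compact range below has a
  -- positive minimum.
  obtain ⟨x, hx, hmin⟩ := (isCompact_Icc (a := (2 : ℝ)) (b := 2 * ‖b‖ + 2)).exists_isMinOn
    ⟨2, by simp⟩
    (f := fun t : ℝ => ‖b + t * Complex.I‖) (by fun_prop)
  set μ : ℝ := ‖b + x * Complex.I‖ with hμ
  have hμ0 : 0 < μ := norm_pos_iff.2 (hb x hx.1)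
  have hbn := norm_nonneg b
  refine ⟨min (1 / 2) (μ / (2 * ‖b‖ + 2)), by positivity, fun t ht => ?_⟩
  rcases le_total t (2 * ‖b‖ + 2) with h | h
  · calc _ ≤ μ / (2 * ‖b‖ + 2) * (2 * ‖b‖ + 2) := by
          gcongr
          exact min_le_right _ _
      _ = μ := by field_simp
      _ ≤ _ := hmin ⟨ht, h⟩
  · have h1 : ‖(t : ℂ) * Complex.I‖ = t := by
      simp [abs_of_nonneg (by linarith : (0 : ℝ) ≤ t)]
    have h2 := norm_sub_le_norm_add (t * Complex.I) b
    rw [h1, add_comm] at h2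
    calc _ ≤ 1 / 2 * t := by
          gcongr
          exact min_le_left _ _
      _ ≤ _ := by linarith

theorem le_norm_add_mul_I_sub_one (σ t : ℝ) :
    t ≤ ‖(σ : ℂ) + t * Complex.I - 1‖ := by
  have h := Complex.abs_im_le_norm ((σ : ℂ) + t * Complex.I - 1)
  simp at h
  exact (le_abs_self t).trans h

/-- Of all the tails only a_N N^{1-s₂}/(s₂-1) is as large as 1/t, and it is kept explicitly. The
analogous part of the tail at s₁+s₂-1 carries two denominators of size t, hence 1/t²; the
corrections are smaller by a factor 1/N. -/
theorem exists_doubleZeta_approx {s₁ : ℂ} {σ₂ : ℝ} (h2 : 0 < σ₂) (h12 : 1 < s₁.re + σ₂)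
    (hreg : ∀ t : ℝ, 2 ≤ t → (s₁, (σ₂ : ℂ) + (t : ℂ) * Complex.I) ∈ regularSet) :
    ∃ A : ℝ, 0 ≤ A ∧ ∀ (N : ℕ) (t : ℝ), 1 ≤ N → 2 ≤ t → ‖(σ₂ : ℂ) + t * Complex.I‖ ≤ N →
      ‖s₁ + (σ₂ + t * Complex.I) - 1‖ ≤ N →
      ‖doubleZeta (s₁, σ₂ + t * Complex.I) -
        ∑ n ∈ Finset.Ico 1 N, powerSum s₁ n * (n : ℂ) ^ (-((σ₂ : ℂ) + t * Complex.I)) -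
        powerSum s₁ N * ((N : ℂ) ^ (1 - ((σ₂ : ℂ) + t * Complex.I)) /
          ((σ₂ : ℂ) + t * Complex.I - 1))‖ ≤
      A * (‖powerSum s₁ N‖ * (N : ℝ) ^ (1 - σ₂) + (N : ℝ) ^ (2 - s₁.re - σ₂)) *
        (1 / t ^ 2 + 1 / N) := by
  have htube : ∀ t : ℝ, (s₁, (σ₂ : ℂ) + (t : ℂ) * Complex.I) ∈ tube 0 := fun t =>
    mem_tube_zero.2 ⟨by simpa using h2, by simpa using h12⟩
  obtain ⟨c, hc0, hc⟩ := exists_mul_le_norm_add_mul_I (b := s₁ + σ₂ - 2) fun t ht e =>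
    ((mem_regularSet_iff_of_mem_tube (htube t)).1 (hreg t ht)).2 (by linear_combination e)
  obtain ⟨C₁, hC₁0, hC₁⟩ := exists_norm_zetaCorr_le_of_norm_le h2
  obtain ⟨C₂, hC₂0, hC₂⟩ := exists_norm_zetaCorr_le_of_norm_le (σ := s₁.re + σ₂ - 1) (by linarith)
  obtain ⟨C₃, hC₃0, hC₃⟩ := exists_norm_doubleCorr_le h2 h12
  refine ⟨C₁ + 1 / c + C₂ + C₃, by positivity, fun N t hN ht hn1 hn2 => ?_⟩
  have hN' : (0 : ℝ) < N := by exact_mod_cast hN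
  have ht0 : 0 < t := by linarith
  set s : ℂ := (σ₂ : ℂ) + t * Complex.I with hs
  set w : ℂ := s₁ + s - 1 with hw
  have hsre : s.re = σ₂ := by simp [hs]
  have hwre : w.re = s₁.re + σ₂ - 1 := by simp [hw, hsre]
  set X : ℝ := ‖powerSum s₁ N‖ * (N : ℝ) ^ (1 - σ₂) with hX
  set Y : ℝ := (N : ℝ) ^ (2 - s₁.re - σ₂) with hY
  have hX0 : 0 ≤ X := by positivity
  have hY0 : 0 ≤ Y := by positivity
  have e : doubleZeta (s₁, s) - ∑ n ∈ Finset.Ico 1 N, powerSum s₁ n * (n : ℂ) ^ (-s) -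
      powerSum s₁ N * ((N : ℂ) ^ (1 - s) / (s - 1)) =
      powerSum s₁ N * zetaCorr N s + (N : ℂ) ^ (1 - w) / (w - 1) / (s - 1) +
        zetaCorr N w / (s - 1) + doubleCorr N (s₁, s) := by
    rw [doubleZeta_eq ⟨hreg t ht, htube t⟩ hN]
    simp only [zetaTail]
    ring
  have hs1 : t ≤ ‖s - 1‖ := le_norm_add_mul_I_sub_one σ₂ t
  have hw1 : c * t ≤ ‖w - 1‖ := by
    have := hc t ht
    rwa [show s₁ + (σ₂ : ℂ) - 2 + t * Complex.I = w - 1 by rw [hw, hs]; ring] at this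
  have t1 : ‖powerSum s₁ N * zetaCorr N s‖ ≤ C₁ * (X * (1 / N)) := by
    rw [norm_mul]
    calc _ ≤ ‖powerSum s₁ N‖ * (C₁ * (N : ℝ) ^ (-σ₂)) := by
          gcongr; exact hC₁ N s hN hsre hn1
      _ = _ := by
          rw [hX, show 1 - σ₂ = -σ₂ + 1 by ring, Real.rpow_add_one hN'.ne']
          field_simp
  have t2 : ‖(N : ℂ) ^ (1 - w) / (w - 1) / (s - 1)‖ ≤ 1 / c * (Y * (1 / t ^ 2)) := by
    rw [norm_div, norm_div, norm_natCast_cpow hN, Complex.sub_re, Complex.one_re, hwre,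
      show 1 - (s₁.re + σ₂ - 1) = 2 - s₁.re - σ₂ by ring, ← hY]
    calc _ ≤ Y / (c * t) / t := by gcongr
      _ = _ := by field_simp
  have hYN : (N : ℝ) ^ (1 - s₁.re - σ₂) = Y * (1 / N) := by
    rw [hY, show 2 - s₁.re - σ₂ = 1 - s₁.re - σ₂ + 1 by ring, Real.rpow_add_one hN'.ne']
    field_simp
  have t3 : ‖zetaCorr N w / (s - 1)‖ ≤ C₂ * (Y * (1 / N)) := by
    rw [norm_div, ← hYN]
    refine (div_le_self (norm_nonneg _) (by linarith)).trans ?_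
    have := hC₂ N w hN hwre hn2
    rwa [show -(s₁.re + σ₂ - 1) = 1 - s₁.re - σ₂ by ring] at this
  have t4 : ‖doubleCorr N (s₁, s)‖ ≤ C₃ * (Y * (1 / N)) := by
    rw [← hYN]
    exact hC₃ N (s₁, s) hN rfl hsre hn1
  rw [e]
  refine (norm_add₄_le).trans ?_
  refine (add_le_add (add_le_add (add_le_add t1 t2) t3) t4).trans ?_
  have a1 : 0 ≤ 1 / t ^ 2 := by positivity
  have a2 : 0 ≤ 1 / (N : ℝ) := by positivity
  have b1 : X * (1 / N) ≤ (X + Y) * (1 / t ^ 2 + 1 / N) := by gcongr <;> linarith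
  have b2 : Y * (1 / t ^ 2) ≤ (X + Y) * (1 / t ^ 2 + 1 / N) := by gcongr <;> linarith
  have b3 : Y * (1 / N) ≤ (X + Y) * (1 / t ^ 2 + 1 / N) := by gcongr <;> linarith
  calc _ ≤ C₁ * ((X + Y) * (1 / t ^ 2 + 1 / N)) + 1 / c * ((X + Y) * (1 / t ^ 2 + 1 / N)) +
        C₂ * ((X + Y) * (1 / t ^ 2 + 1 / N)) + C₃ * ((X + Y) * (1 / t ^ 2 + 1 / N)) := by gcongr
    _ = _ := by ring

end EulerDoubleZeta
namespace EulerDoubleZeta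
open scoped ComplexConjugate

/-! ### Mean values of exponential sums -/

/-- The exponential sum `∑ xₙ e^{-i νₙ t}`. -/
noncomputable def expSum (S : Finset ℕ) (x : ℕ → ℂ) (ν : ℕ → ℝ) (t : ℝ) : ℂ :=
  ∑ n ∈ S, x n * Complex.exp (-(ν n * t) * Complex.I)

/-- The Hilbert type form `∑ x̄ₙ xₘ / (νₙ - νₘ)`, over `m` and `n` with `νₘ ≠ νₙ`. -/
noncomputable def hilbertForm (S : Finset ℕ) (x : ℕ → ℂ) (ν : ℕ → ℝ) : ℂ :=
  ∑ m ∈ S, ∑ n ∈ S, x m * conj (x n) / ((ν n - ν m : ℝ) : ℂ)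

theorem continuous_expSum (S : Finset ℕ) (x : ℕ → ℂ) (ν : ℕ → ℝ) :
    Continuous (expSum S x ν) := by
  unfold expSum
  fun_prop

theorem norm_exp_neg_mul_I (a t : ℝ) : ‖Complex.exp (-(a * t) * Complex.I)‖ = 1 := by
  rw [show (-((a : ℂ) * t) * Complex.I) = ((-(a * t) : ℝ) : ℂ) * Complex.I by push_cast; ring,
    Complex.norm_exp_ofReal_mul_I]

theorem exp_mul_conj_exp (a b t : ℝ) :
    Complex.exp (-(a * t) * Complex.I) * conj (Complex.exp (-(b * t) * Complex.I)) =
      Complex.exp (((b - a : ℝ) : ℂ) * Complex.I * t) := by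
  rw [← Complex.exp_conj, ← Complex.exp_add]
  congr 1
  simp
  ring

theorem norm_expSum_sq (S : Finset ℕ) (x : ℕ → ℂ) (ν : ℕ → ℝ) (t : ℝ) :
    ((‖expSum S x ν t‖ ^ 2 : ℝ) : ℂ) = ∑ m ∈ S, ∑ n ∈ S,
      x m * conj (x n) * Complex.exp (((ν n - ν m : ℝ) : ℂ) * Complex.I * t) := by
  rw [Complex.ofReal_pow, ← Complex.mul_conj', expSum, map_sum, Finset.sum_mul_sum]
  refine Finset.sum_congr rfl fun m _ => Finset.sum_congr rfl fun n _ => ?_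
  rw [← exp_mul_conj_exp, map_mul]
  ring

theorem norm_expSum_le (S : Finset ℕ) (x : ℕ → ℂ) (ν : ℕ → ℝ) (t : ℝ) :
    ‖expSum S x ν t‖ ≤ ∑ n ∈ S, ‖x n‖ := by
  refine (norm_sum_le _ _).trans (le_of_eq (Finset.sum_congr rfl fun n _ => ?_))
  rw [norm_mul, norm_exp_neg_mul_I, mul_one]

theorem integral_exp_mul_I {μ : ℝ} (hμ : μ ≠ 0) (a b : ℝ) :
    ∫ t in a..b, Complex.exp ((μ : ℂ) * Complex.I * t) =
      (Complex.exp ((μ : ℂ) * Complex.I * b) - Complex.exp ((μ : ℂ) * Complex.I * a)) /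
        (μ * Complex.I) :=
  integral_exp_mul_complex (mul_ne_zero (by exact_mod_cast hμ) Complex.I_ne_zero)

/-- Termwise integration: the diagonal gives the length of the interval, and the off-diagonal
antiderivatives at the endpoints are Hilbert forms with unimodular twists. Diagonal terms of
`hilbertForm` vanish because division by 0 gives 0. -/
theorem integral_norm_expSum_sq {S : Finset ℕ} (x : ℕ → ℂ) {ν : ℕ → ℝ}
    (hν : Set.InjOn ν S) (a b : ℝ) :
    ((∫ t in a..b, ‖expSum S x ν t‖ ^ 2 : ℝ) : ℂ) = ((b - a) * ∑ n ∈ S, ‖x n‖ ^ 2 : ℝ) +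
      (hilbertForm S (fun n => x n * Complex.exp (-(ν n * b) * Complex.I)) ν -
        hilbertForm S (fun n => x n * Complex.exp (-(ν n * a) * Complex.I)) ν) / Complex.I := by
  rw [← intervalIntegral.integral_ofReal]
  simp only [norm_expSum_sq]
  rw [intervalIntegral.integral_finsetSum fun m _ => Continuous.intervalIntegrable (by fun_prop) _ _]
  simp only [hilbertForm]
  rw [← Finset.sum_sub_distrib, Finset.sum_div, Finset.mul_sum, Complex.ofReal_sum,
    ← Finset.sum_add_distrib]
  refine Finset.sum_congr rfl fun m hm => ?_
  rw [intervalIntegral.integral_finsetSum fun n _ => Continuous.intervalIntegrable (by fun_prop) _ _,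
    ← Finset.sum_sub_distrib, Finset.sum_div]
  have hdiag : (((b - a) * ‖x m‖ ^ 2 : ℝ) : ℂ) =
      ∑ n ∈ S, if n = m then (((b - a) * ‖x m‖ ^ 2 : ℝ) : ℂ) else 0 := by
    rw [Finset.sum_ite_eq' S m, if_pos hm]
  rw [hdiag, ← Finset.sum_add_distrib]
  refine Finset.sum_congr rfl fun n hn => ?_
  have hexp : ∀ t : ℝ, x m * Complex.exp (-(ν m * t) * Complex.I) *
      conj (x n * Complex.exp (-(ν n * t) * Complex.I)) =
      x m * conj (x n) * Complex.exp (((ν n - ν m : ℝ) : ℂ) * Complex.I * t) := fun t => by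
    rw [← exp_mul_conj_exp, map_mul]
    ring
  rw [hexp, hexp, intervalIntegral.integral_const_mul]
  split_ifs with h
  · subst h
    simp [Complex.mul_conj']
    ring
  · have hne : ν n - ν m ≠ 0 := sub_ne_zero.2 fun e => h (hν hn hm e)
    have hne' : ((ν n - ν m : ℝ) : ℂ) ≠ 0 := by exact_mod_cast hne
    rw [integral_exp_mul_I hne, zero_add]
    field_simp

theorem hasDerivAt_sub_half_mul_exp {c : ℂ} (hc : c ≠ 0) (t : ℝ) :
    HasDerivAt (fun t : ℝ => ((t : ℂ) - 1 / 2) * Complex.exp (c * t) / c -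
      Complex.exp (c * t) / c ^ 2) (((t : ℂ) - 1 / 2) * Complex.exp (c * t)) t := by
  have h0 : HasDerivAt (fun t : ℝ => (t : ℂ)) 1 t := Complex.ofRealCLM.hasDerivAt
  have h1 : HasDerivAt (fun t : ℝ => Complex.exp (c * t)) (Complex.exp (c * t) * (c * 1)) t :=
    (h0.const_mul c).cexp
  have h2 := (((h0.sub_const (1 / 2)).fun_mul h1).div_const c).fun_sub (h1.div_const (c ^ 2))
  have e : (1 * Complex.exp (c * t) + ((t : ℂ) - 1 / 2) * (Complex.exp (c * t) * (c * 1))) / c -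
      Complex.exp (c * t) * (c * 1) / c ^ 2 = ((t : ℂ) - 1 / 2) * Complex.exp (c * t) := by
    field_simp
    ring
  rw [← e]
  exact h2

/-- The Fourier coefficients of the sawtooth; at k = 0 both sides are 0, the right one by the
convention 1/0 = 0. -/
theorem integral_sub_half_mul_exp (k : ℤ) :
    ∫ t in (0 : ℝ)..1, ((t : ℂ) - 1 / 2) * Complex.exp (2 * Real.pi * k * Complex.I * t) =
      1 / (2 * Real.pi * k * Complex.I) := by
  rcases eq_or_ne k 0 with rfl | hk
  · have : ∀ t : ℝ, ((t : ℂ) - 1 / 2) * Complex.exp (2 * Real.pi * (0 : ℤ) * Complex.I * t) =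
        ((t - 1 / 2 : ℝ) : ℂ) := fun t => by push_cast; simp
    simp only [this]
    rw [intervalIntegral.integral_ofReal, intervalIntegral.integral_sub
      (by simp) (by simp), integral_id]
    norm_num
  · set c : ℂ := 2 * Real.pi * k * Complex.I with hc
    have hc0 : c ≠ 0 := by
      have := Real.pi_ne_zero
      simp [hc, hk, this]
    rw [intervalIntegral.integral_eq_sub_of_hasDerivAt
      (fun t _ => hasDerivAt_sub_half_mul_exp hc0 t)
      (Continuous.intervalIntegrable (by fun_prop) _ _)]
    have he : Complex.exp c = 1 := by
      rw [hc, Complex.exp_eq_one_iff]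
      exact ⟨k, by ring⟩
    simp [he]
    field_simp
    ring

/-- **Hilbert's inequality**. -/
theorem norm_hilbertForm_natCast_le (S : Finset ℕ) (u : ℕ → ℂ) :
    ‖hilbertForm S u fun n => n‖ ≤ Real.pi * ∑ n ∈ S, ‖u n‖ ^ 2 := by
  set ν : ℕ → ℝ := fun n => 2 * Real.pi * n with hν
  have hpi := Real.pi_pos
  have hinj : Set.InjOn ν S := fun m _ n _ h => by
    have : (m : ℝ) = n := mul_left_cancel₀ (by positivity) h
    exact_mod_cast this
  -- Parseval: the twists at 0 and 1 are trivial, so the two Hilbert forms cancel.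
  have hpars : ∫ t in (0 : ℝ)..1, ‖expSum S u ν t‖ ^ 2 = ∑ n ∈ S, ‖u n‖ ^ 2 := by
    have h := integral_norm_expSum_sq u hinj 0 1
    have h1 : (fun n => u n * Complex.exp (-(ν n * (1 : ℝ)) * Complex.I)) = u := by
      ext n
      have : Complex.exp (-(ν n * (1 : ℝ)) * Complex.I) = 1 := by
        rw [Complex.exp_eq_one_iff]
        exact ⟨-n, by simp [hν]; ring⟩
      rw [this, mul_one]
    have h0 : (fun n => u n * Complex.exp (-(ν n * (0 : ℝ)) * Complex.I)) = u := by
      ext n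
      simp
    rw [h1, h0, sub_self, zero_div, add_zero, sub_zero, one_mul] at h
    exact_mod_cast h
  -- The form is an average of |∑|² against the sawtooth, whose absolute value is at most 1/2; this
  -- is where π comes from.
  have hint : ∫ t in (0 : ℝ)..1, ((t : ℂ) - 1 / 2) * ((‖expSum S u ν t‖ ^ 2 : ℝ) : ℂ) =
      hilbertForm S u (fun n => n) / (2 * Real.pi * Complex.I) := by
    simp only [norm_expSum_sq, Finset.mul_sum, hilbertForm, Finset.sum_div]
    rw [intervalIntegral.integral_finsetSum
      fun m _ => Continuous.intervalIntegrable (by fun_prop) _ _]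
    refine Finset.sum_congr rfl fun m _ => ?_
    rw [intervalIntegral.integral_finsetSum
      fun m _ => Continuous.intervalIntegrable (by fun_prop) _ _]
    refine Finset.sum_congr rfl fun n _ => ?_
    have h := integral_sub_half_mul_exp ((n : ℤ) - m)
    calc _ = ∫ t in (0 : ℝ)..1, (u m * conj (u n)) * (((t : ℂ) - 1 / 2) *
          Complex.exp (2 * Real.pi * ((n : ℤ) - m : ℤ) * Complex.I * t)) := by
          refine intervalIntegral.integral_congr fun t _ => ?_
          simp only [hν]
          push_cast
          ring_nf
      _ = _ := by
          rw [intervalIntegral.integral_const_mul, h]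
          push_cast
          rw [div_div, mul_one_div]
          congr 1
          ring
  have hle : ‖∫ t in (0 : ℝ)..1, ((t : ℂ) - 1 / 2) * ((‖expSum S u ν t‖ ^ 2 : ℝ) : ℂ)‖ ≤
      ∫ t in (0 : ℝ)..1, 1 / 2 * ‖expSum S u ν t‖ ^ 2 := by
    have hc := continuous_expSum S u ν
    refine intervalIntegral.norm_integral_le_of_norm_le zero_le_one
      (MeasureTheory.ae_of_all _ fun t ht => ?_) (Continuous.intervalIntegrable (by fun_prop) _ _)
    rw [norm_mul, Complex.norm_real, Real.norm_of_nonneg (by positivity),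
      show (t : ℂ) - 1 / 2 = ((t - 1 / 2 : ℝ) : ℂ) by push_cast; ring, Complex.norm_real]
    gcongr
    rw [Real.norm_eq_abs, abs_le]
    constructor <;> linarith [ht.1, ht.2]
  rw [hint, intervalIntegral.integral_const_mul, hpars, norm_div, div_le_iff₀ (by simp)] at hle
  simp [abs_of_pos hpi] at hle
  linarith

/-- The logarithmic mean (n-m)/(log n - log m) lies between the geometric and the arithmetic mean.
Dividing by n - m, the gap is at most (√n-√m)²/(2(n-m)) ≤ 1/2. -/
theorem inv_log_sub_log_aux {m n : ℝ} (hm : 0 < m) (hmn : m < n) :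
    0 ≤ 1 / (Real.log n - Real.log m) - √m * √n / (n - m) ∧
      1 / (Real.log n - Real.log m) - √m * √n / (n - m) ≤ 1 / 2 := by
  have hn : 0 < n := hm.trans hmn
  obtain ⟨a, ha, rfl⟩ : ∃ a : ℝ, 0 < a ∧ m = a ^ 2 := ⟨√m, by positivity, by rw [Real.sq_sqrt hm.le]⟩
  obtain ⟨b, hb, rfl⟩ : ∃ b : ℝ, 0 < b ∧ n = b ^ 2 := ⟨√n, by positivity, by rw [Real.sq_sqrt hn.le]⟩
  have hab : a < b := lt_of_pow_lt_pow_left₀ 2 hb.le hmn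
  rw [Real.sqrt_sq ha.le, Real.sqrt_sq hb.le]
  have hx : 1 < b / a := (one_lt_div ha).2 hab
  have hlog : Real.log (b ^ 2) - Real.log (a ^ 2) = 2 * Real.log (b / a) := by
    rw [Real.log_div hb.ne' ha.ne', Real.log_pow, Real.log_pow]
    push_cast
    ring
  have hlpos : 0 < Real.log (b / a) := Real.log_pos hx
  have h1 : 2 * Real.log (b / a) ≤ (b ^ 2 - a ^ 2) / (a * b) := by
    have h := Real.self_le_sinh_iff.2 hlpos.le
    rw [Real.sinh_log (by positivity)] at h
    have e : (b ^ 2 - a ^ 2) / (a * b) = b / a - (b / a)⁻¹ := by field_simp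
    linarith
  have hD : 0 < b ^ 2 - a ^ 2 := by linarith
  have h2 : 2 * (b ^ 2 - a ^ 2) / (a ^ 2 + b ^ 2) ≤ 2 * Real.log (b / a) := by
    have h := Real.le_log_one_add_of_nonneg (x := b ^ 2 / a ^ 2 - 1)
      (by rw [sub_nonneg, one_le_div (by positivity)]; exact hmn.le)
    rw [add_sub_cancel, ← div_pow, Real.log_pow] at h
    refine le_trans (le_of_eq ?_) h
    field_simp
    ring
  rw [hlog]
  constructor
  · rw [sub_nonneg, div_le_div_iff₀ hD (by positivity), one_mul]
    rw [le_div_iff₀ (by positivity)] at h1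
    linarith
  · have h3 : 1 / (2 * Real.log (b / a)) ≤ (a ^ 2 + b ^ 2) / (2 * (b ^ 2 - a ^ 2)) := by
      rw [div_le_iff₀ (by positivity)] at h2
      rw [div_le_div_iff₀ (by positivity) (by positivity)]
      linarith
    have h4 : (a ^ 2 + b ^ 2) / (2 * (b ^ 2 - a ^ 2)) - a * b / (b ^ 2 - a ^ 2) ≤ 1 / 2 := by
      rw [show (a ^ 2 + b ^ 2) / (2 * (b ^ 2 - a ^ 2)) - a * b / (b ^ 2 - a ^ 2) =
        (b - a) ^ 2 / (2 * (b ^ 2 - a ^ 2)) by field_simp; ring, div_le_iff₀ (by positivity)]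
      nlinarith
    linarith

theorem abs_inv_log_sub_log_sub_le {m n : ℕ} (hm : 1 ≤ m) (hn : 1 ≤ n) :
    |1 / (Real.log n - Real.log m) - √m * √n / ((n : ℝ) - m)| ≤ 1 / 2 := by
  have hm' : (0 : ℝ) < m := by exact_mod_cast hm
  have hn' : (0 : ℝ) < n := by exact_mod_cast hn
  rcases lt_trichotomy m n with h | rfl | h
  · have := inv_log_sub_log_aux hm' (Nat.cast_lt.2 h : (m : ℝ) < n)
    rw [abs_of_nonneg this.1]
    exact this.2
  · simp
  · have := inv_log_sub_log_aux hn' (Nat.cast_lt.2 h : (n : ℝ) < m)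
    rw [← abs_neg]
    have e : -(1 / (Real.log n - Real.log m) - √m * √n / ((n : ℝ) - m)) =
        1 / (Real.log m - Real.log n) - √n * √m / ((m : ℝ) - n) := by
      rw [← neg_sub (Real.log m), ← neg_sub (m : ℝ), div_neg, div_neg, mul_comm (√(m : ℝ))]
      ring
    rw [e, abs_of_nonneg this.1]
    exact this.2

/-- With √(mn)/(n-m) as kernel, the square roots go into the coefficients and Hilbert's inequality
applies; the bounded difference of the kernels costs (∑|xₙ|)²/2. -/
theorem norm_hilbertForm_log_le {S : Finset ℕ} (hS : ∀ n ∈ S, 1 ≤ n) (x : ℕ → ℂ) :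
    ‖hilbertForm S x fun n => Real.log n‖ ≤
      Real.pi * ∑ n ∈ S, n * ‖x n‖ ^ 2 + 1 / 2 * (∑ n ∈ S, ‖x n‖) ^ 2 := by
  have h1 := norm_hilbertForm_natCast_le S fun n => (√n : ℝ) * x n
  have e1 : ∑ n ∈ S, ‖((√n : ℝ) : ℂ) * x n‖ ^ 2 = ∑ n ∈ S, n * ‖x n‖ ^ 2 := by
    refine Finset.sum_congr rfl fun n _ => ?_
    rw [norm_mul, Complex.norm_real, mul_pow, Real.norm_eq_abs, sq_abs,
      Real.sq_sqrt (Nat.cast_nonneg n)]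
  rw [e1] at h1
  have h2 : ‖hilbertForm S x (fun n => Real.log n) -
      hilbertForm S (fun n => (√n : ℝ) * x n) (fun n => n)‖ ≤ 1 / 2 * (∑ n ∈ S, ‖x n‖) ^ 2 := by
    simp only [hilbertForm]
    rw [← Finset.sum_sub_distrib, sq, Finset.sum_mul_sum, Finset.mul_sum]
    refine (norm_sum_le _ _).trans (Finset.sum_le_sum fun m hm => ?_)
    rw [← Finset.sum_sub_distrib, Finset.mul_sum]
    refine (norm_sum_le _ _).trans (Finset.sum_le_sum fun n hn => ?_)
    have e : x m * conj (x n) / ((Real.log n - Real.log m : ℝ) : ℂ) -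
        (√m : ℝ) * x m * conj ((√n : ℝ) * x n) / (((n : ℝ) - m : ℝ) : ℂ) =
        ((1 / (Real.log n - Real.log m) - √m * √n / ((n : ℝ) - m) : ℝ) : ℂ) *
          (x m * conj (x n)) := by
      rw [map_mul, Complex.conj_ofReal]
      push_cast
      ring
    rw [e, norm_mul, norm_mul, Complex.norm_real, Complex.norm_conj, Real.norm_eq_abs]
    gcongr
    exact abs_inv_log_sub_log_sub_le (hS m hm) (hS n hn)
  linarith [norm_le_norm_add_norm_sub' (hilbertForm S x fun n => Real.log n)
    (hilbertForm S (fun n => (√n : ℝ) * x n) (fun n => n))]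

/-- A mean value theorem for Dirichlet polynomials. -/
theorem abs_integral_norm_expSum_log_sq_sub_le {S : Finset ℕ} (hS : ∀ n ∈ S, 1 ≤ n) (x : ℕ → ℂ)
    (a b : ℝ) :
    |(∫ t in a..b, ‖expSum S x (fun n => Real.log n) t‖ ^ 2) - (b - a) * ∑ n ∈ S, ‖x n‖ ^ 2| ≤
      2 * Real.pi * ∑ n ∈ S, n * ‖x n‖ ^ 2 + (∑ n ∈ S, ‖x n‖) ^ 2 := by
  have hinj : Set.InjOn (fun n : ℕ => Real.log n) S := fun m hm n hn h => by
    have hm' : (0 : ℝ) < m := by exact_mod_cast hS m hm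
    have hn' : (0 : ℝ) < n := by exact_mod_cast hS n hn
    exact_mod_cast Real.log_injOn_pos hm' hn' h
  have h := integral_norm_expSum_sq x hinj a b
  have hQ : ∀ t : ℝ, ‖hilbertForm S
      (fun n => x n * Complex.exp (-((Real.log n : ℝ) * t) * Complex.I)) fun n => Real.log n‖ ≤
      Real.pi * ∑ n ∈ S, n * ‖x n‖ ^ 2 + 1 / 2 * (∑ n ∈ S, ‖x n‖) ^ 2 := fun t => by
    have := norm_hilbertForm_log_le hS
      fun n => x n * Complex.exp (-((Real.log n : ℝ) * t) * Complex.I)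
    simpa only [norm_mul, norm_exp_neg_mul_I, mul_one] using this
  rw [← Real.norm_eq_abs, ← Complex.norm_real, Complex.ofReal_sub, h, add_sub_cancel_left, norm_div,
    Complex.norm_I, div_one]
  refine (norm_sub_le _ _).trans ?_
  linarith [hQ a, hQ b]

end EulerDoubleZeta
namespace EulerDoubleZeta
open scoped ComplexConjugate

/-! ### Mean squares of functions approximated by Dirichlet polynomials -/

theorem integral_one_div_sq_le {T : ℝ} (hT : 2 ≤ T) : ∫ t in (2 : ℝ)..T, 1 / t ^ 2 ≤ 1 / 2 := by
  have h : ∀ t ∈ Set.uIcc 2 T, HasDerivAt (fun t : ℝ => -t⁻¹) (1 / t ^ 2) t := fun t ht => by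
    rw [Set.uIcc_of_le hT] at ht
    have h0 : t ≠ 0 := by linarith [ht.1]
    have e : -(-(t ^ 2)⁻¹) = 1 / t ^ 2 := by rw [neg_neg, one_div]
    rw [← e]
    exact (hasDerivAt_inv h0).fun_neg
  have hc : ContinuousOn (fun t : ℝ => 1 / t ^ 2) (Set.uIcc 2 T) := by
    rw [Set.uIcc_of_le hT]
    refine continuousOn_const.div (by fun_prop) fun t ht => ?_
    have : 0 < t := by linarith [ht.1]
    positivity
  rw [intervalIntegral.integral_eq_sub_of_hasDerivAt h hc.intervalIntegrable]
  have : 0 ≤ T⁻¹ := by positivity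
  linarith

theorem intervalIntegrable_one_div_sq {T : ℝ} (hT : 2 ≤ T) :
    IntervalIntegrable (fun t : ℝ => 1 / t ^ 2) MeasureTheory.volume 2 T := by
  refine ContinuousOn.intervalIntegrable ?_
  rw [Set.uIcc_of_le hT]
  refine continuousOn_const.div (by fun_prop) fun t ht => ?_
  have : 0 < t := by linarith [ht.1]
  positivity

theorem le_norm_sub_mul_I (b t : ℝ) : t ≤ ‖(b : ℂ) - t * Complex.I‖ := by
  have h := Complex.abs_im_le_norm ((b : ℂ) - t * Complex.I)
  simp at h
  exact (le_abs_self t).trans h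

theorem sub_mul_I_ne_zero (b : ℝ) {t : ℝ} (ht : 0 < t) : (b : ℂ) - t * Complex.I ≠ 0 :=
  norm_pos_iff.1 (ht.trans_le (le_norm_sub_mul_I b t))

/-- The first derivative estimate for `∫ e^{iμt} / (b - it) dt`. -/
theorem norm_integral_exp_div_le {μ b T : ℝ} (hμ : 1 / 2 ≤ μ) (hT : 2 ≤ T) :
    ‖∫ t in (2 : ℝ)..T, Complex.exp ((μ : ℂ) * Complex.I * t) / ((b : ℂ) - t * Complex.I)‖ ≤ 3 := by
  have hμ0 : 0 < μ := by linarith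
  have hc0 : (μ : ℂ) * Complex.I ≠ 0 :=
    mul_ne_zero (by exact_mod_cast hμ0.ne') Complex.I_ne_zero
  have hcn : ‖(μ : ℂ) * Complex.I‖ = μ := by simp [abs_of_pos hμ0]
  set e : ℝ → ℂ := fun t => Complex.exp ((μ : ℂ) * Complex.I * t) with he
  have hen : ∀ t, ‖e t‖ = 1 := fun t => by
    rw [he]
    simp only
    rw [show (μ : ℂ) * Complex.I * t = ((μ * t : ℝ) : ℂ) * Complex.I by push_cast; ring,
      Complex.norm_exp_ofReal_mul_I]
  set d : ℝ → ℂ := fun t => (b : ℂ) - t * Complex.I with hd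
  have hd0 : ∀ t ∈ Set.uIcc 2 T, d t ≠ 0 := fun t ht => by
    rw [Set.uIcc_of_le hT] at ht
    exact sub_mul_I_ne_zero b (by linarith [ht.1])
  have hec : Continuous e := by fun_prop
  have hdc : Continuous d := by fun_prop
  -- Integration by parts, written as an antiderivative. The two endpoints and the integral of the
  -- extra term contribute at most 1 each, since μ ≥ 1/2 and |d t| ≥ t ≥ 2.
  have hF : ∀ t ∈ Set.uIcc 2 T, HasDerivAt (fun t => e t / (((μ : ℂ) * Complex.I) * d t))
      (e t / d t + e t / (μ * d t ^ 2)) t := fun t ht => by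
    have h0 : HasDerivAt (fun t : ℝ => (t : ℂ)) 1 t := Complex.ofRealCLM.hasDerivAt
    have h1 : HasDerivAt e (e t * (((μ : ℂ) * Complex.I) * 1)) t := (h0.const_mul _).cexp
    have h2 : HasDerivAt (fun t => ((μ : ℂ) * Complex.I) * d t)
        (((μ : ℂ) * Complex.I) * -(1 * Complex.I)) t :=
      ((h0.mul_const Complex.I).const_sub _).const_mul _
    have h3 := h1.fun_div h2 (mul_ne_zero hc0 (hd0 t ht))
    have e1 : (e t * (((μ : ℂ) * Complex.I) * 1) * (((μ : ℂ) * Complex.I) * d t) -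
        e t * (((μ : ℂ) * Complex.I) * -(1 * Complex.I))) / (((μ : ℂ) * Complex.I) * d t) ^ 2 =
        e t / d t + e t / (μ * d t ^ 2) := by
      have hμC : (μ : ℂ) ≠ 0 := by exact_mod_cast hμ0.ne'
      have := hd0 t ht
      field_simp
      ring
    rw [← e1]
    exact h3
  have hi1 : IntervalIntegrable (fun t => e t / d t) MeasureTheory.volume 2 T :=
    (hec.continuousOn.div hdc.continuousOn hd0).intervalIntegrable
  have hi2 : IntervalIntegrable (fun t => e t / (μ * d t ^ 2)) MeasureTheory.volume 2 T :=
    (hec.continuousOn.div (by fun_prop) fun t ht =>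
      mul_ne_zero (by exact_mod_cast hμ0.ne') (pow_ne_zero 2 (hd0 t ht))).intervalIntegrable
  have hint := intervalIntegral.integral_eq_sub_of_hasDerivAt hF (hi1.add hi2)
  rw [intervalIntegral.integral_add hi1 hi2, ← eq_sub_iff_add_eq] at hint
  rw [hint]
  have hend : ∀ t : ℝ, 2 ≤ t → ‖e t / (((μ : ℂ) * Complex.I) * d t)‖ ≤ 1 := fun t ht => by
    rw [norm_div, hen, norm_mul, hcn]
    refine div_le_one_of_le₀ ?_ (by positivity)
    calc (1 : ℝ) ≤ 1 / 2 * t := by linarith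
      _ ≤ _ := by gcongr; exact le_norm_sub_mul_I b t
  have hlast : ‖∫ t in (2 : ℝ)..T, e t / (μ * d t ^ 2)‖ ≤ 1 := by
    calc _ ≤ ∫ t in (2 : ℝ)..T, 2 * (1 / t ^ 2) := by
          refine intervalIntegral.norm_integral_le_of_norm_le hT (MeasureTheory.ae_of_all _
            fun t ht => ?_) ((intervalIntegrable_one_div_sq hT).const_mul 2)
          have ht0 : 0 < t := by linarith [ht.1]
          rw [norm_div, hen, norm_mul, norm_pow, Complex.norm_real, Real.norm_of_nonneg hμ0.le]
          calc _ ≤ 1 / (1 / 2 * t ^ 2) := by gcongr; exact le_norm_sub_mul_I b t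
            _ = _ := by field_simp
      _ = 2 * ∫ t in (2 : ℝ)..T, 1 / t ^ 2 := intervalIntegral.integral_const_mul _ _
      _ ≤ 1 := by linarith [integral_one_div_sq_le hT]
  refine (norm_sub_le _ _).trans ?_
  have := norm_sub_le (e T / (((μ : ℂ) * Complex.I) * d T)) (e 2 / (((μ : ℂ) * Complex.I) * d 2))
  have h1 := hend T hT
  have h2 := hend 2 le_rfl
  linarith

/-- The condition 2n ≤ M separates the frequencies: log M - log n ≥ log 2 > 1/2, so the first
derivative estimate applies termwise. -/
theorem norm_integral_expSum_mul_conj_le {S : Finset ℕ} {M : ℕ} (hS : ∀ n ∈ S, 1 ≤ n ∧ 2 * n ≤ M)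
    (x : ℕ → ℂ) (y : ℂ) (b : ℝ) {T : ℝ} (hT : 2 ≤ T) :
    ‖∫ t in (2 : ℝ)..T, expSum S x (fun n => Real.log n) t *
      conj (y * Complex.exp (-((Real.log M : ℝ) * t) * Complex.I) / ((b : ℂ) + t * Complex.I))‖ ≤
      3 * ‖y‖ * ∑ n ∈ S, ‖x n‖ := by
  have hterm : ∀ t : ℝ, expSum S x (fun n => Real.log n) t *
      conj (y * Complex.exp (-((Real.log M : ℝ) * t) * Complex.I) / ((b : ℂ) + t * Complex.I)) =
      ∑ n ∈ S, x n * conj y * (Complex.exp (((Real.log M - Real.log n : ℝ) : ℂ) * Complex.I * t) /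
        ((b : ℂ) - t * Complex.I)) := fun t => by
    rw [expSum, Finset.sum_mul]
    refine Finset.sum_congr rfl fun n _ => ?_
    rw [← exp_mul_conj_exp, map_div₀, map_mul, map_add, map_mul, Complex.conj_ofReal,
      Complex.conj_ofReal, Complex.conj_I]
    ring
  simp only [hterm]
  rw [intervalIntegral.integral_finsetSum fun n _ => ?_]
  · refine (norm_sum_le _ _).trans ?_
    rw [Finset.mul_sum]
    refine Finset.sum_le_sum fun n hn => ?_
    rw [intervalIntegral.integral_const_mul, norm_mul, norm_mul, Complex.norm_conj]
    have hn0 : (0 : ℝ) < n := by exact_mod_cast (hS n hn).1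
    have hμ : 1 / 2 ≤ Real.log M - Real.log n := by
      have h2n : (2 : ℝ) * n ≤ M := by exact_mod_cast (hS n hn).2
      have := Real.log_le_log (by positivity) h2n
      rw [Real.log_mul two_ne_zero hn0.ne'] at this
      linarith [Real.log_two_gt_d9]
    calc _ ≤ ‖x n‖ * ‖y‖ * 3 := by gcongr; exact norm_integral_exp_div_le hμ hT
      _ = _ := by ring
  · refine ContinuousOn.intervalIntegrable (continuousOn_const.mul
      (ContinuousOn.div (by fun_prop) (by fun_prop) fun t ht => ?_))
    rw [Set.uIcc_of_le hT] at ht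
    exact sub_mul_I_ne_zero b (by linarith [ht.1])

/-- To be used with p the short polynomial, q the block up to double length, g the oscillating term
and l the remainder. Only the product of p and g needs cancellation. The block q enters through q +
(g + l), the error of the short approximation; τ balances the product of p with the r' part of l. -/
theorem abs_norm_add_sq_sub_le (p q g l : ℂ) {τ : ℝ} (hτ : 0 < τ) {s r r' : ℝ}
    (hp : ‖p‖ ≤ s) (hr : 0 ≤ r) (hl : ‖l‖ ≤ r + r') :
    |‖p + q + (g + l)‖ ^ 2 - ‖p + q‖ ^ 2 - 2 * (p * conj g).re| ≤
      2 * s * r + τ⁻¹ * ‖p‖ ^ 2 + τ * r' ^ 2 + ‖q + (g + l)‖ ^ 2 + 4 * ‖g + l‖ ^ 2 := by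
  have e1 : ‖p + q + (g + l)‖ ^ 2 - ‖p + q‖ ^ 2 - 2 * (p * conj g).re =
      2 * (p * conj l).re + 2 * (q * conj (g + l)).re + ‖g + l‖ ^ 2 := by
    rw [← Complex.normSq_eq_norm_sq, ← Complex.normSq_eq_norm_sq, ← Complex.normSq_eq_norm_sq,
      Complex.normSq_add]
    simp only [map_add, mul_add, add_mul, Complex.add_re]
    ring
  have h1 : |(p * conj l).re| ≤ ‖p‖ * (r + r') := by
    refine (Complex.abs_re_le_norm _).trans ?_
    rw [norm_mul, Complex.norm_conj]
    gcongr
  have h2 : |(q * conj (g + l)).re| ≤ ‖q‖ * ‖g + l‖ := by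
    refine (Complex.abs_re_le_norm _).trans ?_
    rw [norm_mul, Complex.norm_conj]
  have h3 : ‖q‖ ≤ ‖q + (g + l)‖ + ‖g + l‖ := by
    have := norm_sub_le (q + (g + l)) (g + l)
    rwa [add_sub_cancel_right] at this
  have h4 : 2 * (‖p‖ * r') ≤ τ⁻¹ * ‖p‖ ^ 2 + τ * r' ^ 2 := by
    have : 0 ≤ τ⁻¹ * (‖p‖ - τ * r') ^ 2 := by positivity
    have e : τ⁻¹ * (‖p‖ - τ * r') ^ 2 = τ⁻¹ * ‖p‖ ^ 2 + τ * r' ^ 2 - 2 * (‖p‖ * r') := by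
      field_simp
      ring
    linarith
  have h5 : ‖p‖ * r ≤ s * r := by gcongr
  have h6 : ‖q‖ * ‖g + l‖ ≤ (‖q + (g + l)‖ + ‖g + l‖) * ‖g + l‖ := by gcongr
  rw [e1]
  have h7 := sq_nonneg (‖q + (g + l)‖ - ‖g + l‖)
  rw [abs_le] at h1 h2 ⊢
  have h8 := sq_nonneg ‖g + l‖
  constructor <;> nlinarith

/-- If `f` is approximated by the partial sums of length `N` and `2N` of a Dirichlet series, with
error terms that consist of a smooth oscillating part and of a small part, then the mean square of
`f` is close to that of the partial sum. -/
theorem abs_integral_norm_sq_sub_le {f : ℝ → ℂ} {x : ℕ → ℂ} {y y' : ℂ} {b g T : ℝ} {N : ℕ}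
    (hT : 2 ≤ T) (hTN : T ≤ N) (hf : ContinuousOn f (Set.Icc 2 T)) (hy : ‖y‖ ≤ g) (hy' : ‖y'‖ ≤ g)
    (h : ∀ t ∈ Set.Icc 2 T, ‖f t - expSum (Finset.Ico 1 N) x (fun n => Real.log n) t -
      y * Complex.exp (-((Real.log N : ℝ) * t) * Complex.I) / ((b : ℂ) + t * Complex.I)‖ ≤
      g * (1 / t ^ 2 + 1 / N))
    (h' : ∀ t ∈ Set.Icc 2 T, ‖f t - expSum (Finset.Ico 1 (2 * N)) x (fun n => Real.log n) t -
      y' * Complex.exp (-((Real.log (2 * N : ℕ) : ℝ) * t) * Complex.I) /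
        ((b : ℂ) + t * Complex.I)‖ ≤
      g * (1 / t ^ 2 + 1 / N)) :
    |(∫ t in (2 : ℝ)..T, ‖f t‖ ^ 2) - (T - 2) * ∑ n ∈ Finset.Ico 1 (2 * N), ‖x n‖ ^ 2| ≤
      25 * (g ^ 2 + (∑ n ∈ Finset.Ico 1 (2 * N), ‖x n‖) ^ 2 +
        ∑ n ∈ Finset.Ico 1 (2 * N), n * ‖x n‖ ^ 2) := by
  have hT0 : 0 < T := by linarith
  have hN0 : (0 : ℝ) < N := by linarith
  have hg0 : 0 ≤ g := (norm_nonneg y).trans hy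
  set S : ℝ := ∑ n ∈ Finset.Ico 1 (2 * N), ‖x n‖ with hS
  set H : ℝ := ∑ n ∈ Finset.Ico 1 (2 * N), n * ‖x n‖ ^ 2 with hH
  have hS0 : 0 ≤ S := Finset.sum_nonneg fun _ _ => norm_nonneg _
  have hH0 : 0 ≤ H := Finset.sum_nonneg fun _ _ => by positivity
  have hsub : Finset.Ico 1 N ⊆ Finset.Ico 1 (2 * N) :=
    Finset.Ico_subset_Ico le_rfl (by omega)
  set p : ℝ → ℂ := expSum (Finset.Ico 1 N) x (fun n => Real.log n) with hp
  set P : ℝ → ℂ := expSum (Finset.Ico 1 (2 * N)) x (fun n => Real.log n) with hP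
  set G : ℝ → ℂ := fun t => y' * Complex.exp (-((Real.log (2 * N : ℕ) : ℝ) * t) * Complex.I) /
        ((b : ℂ) + t * Complex.I) with hG
  have hpc : Continuous p := continuous_expSum _ _ _
  have hPc : Continuous P := continuous_expSum _ _ _
  have hden : ∀ t : ℝ, t ≤ ‖(b : ℂ) + t * Complex.I‖ := fun t => by
    have h := Complex.abs_im_le_norm ((b : ℂ) + t * Complex.I)
    simp at h
    exact (le_abs_self t).trans h
  have hden0 : ∀ t ∈ Set.Icc 2 T, (b : ℂ) + t * Complex.I ≠ 0 := fun t ht =>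
    norm_pos_iff.1 (lt_of_lt_of_le (by linarith [ht.1]) (hden t))
  have hGc : ContinuousOn G (Set.Icc 2 T) := ContinuousOn.div (by fun_prop) (by fun_prop) hden0
  have hGn : ∀ (z : ℂ) (K : ℕ) (t : ℝ), 2 ≤ t → ‖z‖ ≤ g →
      ‖z * Complex.exp (-((Real.log K : ℝ) * t) * Complex.I) / ((b : ℂ) + t * Complex.I)‖ ≤
      g / t := fun z K t ht hz => by
    rw [norm_div, norm_mul, norm_exp_neg_mul_I, mul_one]
    have : 0 < t := by linarith
    gcongr
    exact hden t
  have hNt : ∀ t ∈ Set.Icc 2 T, 1 / (N : ℝ) ≤ 1 / t := fun t ht => by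
    have : 0 < t := by linarith [ht.1]
    gcongr
    exact ht.2.trans hTN
  -- Both approximations have total error at most (1 + 1/2 + 1) g/t, because 1/t² ≤ 1/(2t) and 1/N ≤
  -- 1/t; 25/4 is the square of 5/2.
  have herr : ∀ t ∈ Set.Icc 2 T, ∀ (z : ℂ) (K : ℕ) (R : ℂ), ‖z‖ ≤ g →
      ‖f t - R - z * Complex.exp (-((Real.log K : ℝ) * t) * Complex.I) /
        ((b : ℂ) + t * Complex.I)‖ ≤ g * (1 / t ^ 2 + 1 / N) →
      ‖f t - R‖ ^ 2 ≤ 25 / 4 * g ^ 2 * (1 / t ^ 2) := fun t ht z K R hz hR => by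
    have ht0 : 0 < t := by linarith [ht.1]
    have h1 : ‖f t - R‖ ≤ g / t + g * (1 / t ^ 2 + 1 / N) := by
      have e := norm_add_le (z * Complex.exp (-((Real.log K : ℝ) * t) * Complex.I) /
        ((b : ℂ) + t * Complex.I)) (f t - R - z * Complex.exp (-((Real.log K : ℝ) * t) *
          Complex.I) / ((b : ℂ) + t * Complex.I))
      rw [add_sub_cancel] at e
      exact e.trans (add_le_add (hGn z K t ht.1 hz) hR)
    have h2 : 1 / t ^ 2 ≤ 1 / 2 * (1 / t) := by
      rw [sq, one_div_mul_one_div_rev, mul_comm]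
      have := ht.1
      gcongr
    have h3 : ‖f t - R‖ ≤ 5 / 2 * g * (1 / t) := by
      calc _ ≤ _ := h1
        _ ≤ g / t + g * (1 / 2 * (1 / t) + 1 / t) := by
          have := mul_le_mul_of_nonneg_left (add_le_add h2 (hNt t ht)) hg0
          linarith
        _ = _ := by ring
    calc _ ≤ (5 / 2 * g * (1 / t)) ^ 2 := by gcongr
      _ = _ := by ring
  have hpS : ∀ t, ‖p t‖ ≤ S := fun t => (norm_expSum_le _ _ _ _).trans
    (Finset.sum_le_sum_of_subset_of_nonneg hsub fun _ _ _ => norm_nonneg _)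
  -- With τ = T the 1/N part of the remainder integrates to at most g², and T⁻¹‖p‖² is controlled by
  -- the mean value theorem for p. The factor 125/4 is (1 + 4)·25/4.
  have hpt : ∀ t ∈ Set.Icc 2 T, |‖f t‖ ^ 2 - ‖P t‖ ^ 2 - 2 * (p t * conj (G t)).re| ≤
      2 * S * g * (1 / t ^ 2) + T⁻¹ * ‖p t‖ ^ 2 + T⁻¹ * g ^ 2 +
        125 / 4 * g ^ 2 * (1 / t ^ 2) := fun t ht => by
    have ht0 : 0 < t := by linarith [ht.1]
    have h1 := abs_norm_add_sq_sub_le (p t) (P t - p t) (G t) (f t - P t - G t) hT0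
      (hpS t) (r := g * (1 / t ^ 2)) (r' := g * (1 / N)) (by positivity)
      (by rw [← mul_add]; exact h' t ht)
    rw [add_sub_cancel, add_sub_cancel, add_sub_cancel,
      show P t - p t + (f t - P t) = f t - p t by ring] at h1
    have h2 := herr t ht y N (p t) hy (h t ht)
    have h3 := herr t ht y' (2 * N) (P t) hy' (h' t ht)
    have h4 : T * (g * (1 / N)) ^ 2 ≤ T⁻¹ * g ^ 2 := by
      calc T * (g * (1 / N)) ^ 2 ≤ T * (g * (1 / T)) ^ 2 := by gcongr
        _ = _ := by field_simp
    linarith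
  have iP : IntervalIntegrable (fun t => ‖P t‖ ^ 2) MeasureTheory.volume 2 T :=
    Continuous.intervalIntegrable (by fun_prop) _ _
  have ip : IntervalIntegrable (fun t => ‖p t‖ ^ 2) MeasureTheory.volume 2 T :=
    Continuous.intervalIntegrable (by fun_prop) _ _
  have ipG : IntervalIntegrable (fun t => p t * conj (G t)) MeasureTheory.volume 2 T := by
    refine ContinuousOn.intervalIntegrable ?_
    rw [Set.uIcc_of_le hT]
    exact hpc.continuousOn.mul (Complex.continuous_conj.comp_continuousOn hGc)
  have ipGre : IntervalIntegrable (fun t => 2 * (p t * conj (G t)).re)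
      MeasureTheory.volume 2 T := by
    refine ContinuousOn.intervalIntegrable ?_
    rw [Set.uIcc_of_le hT]
    exact continuousOn_const.mul (Complex.continuous_re.comp_continuousOn
      (hpc.continuousOn.mul (Complex.continuous_conj.comp_continuousOn hGc)))
  have iF : IntervalIntegrable (fun t => ‖f t‖ ^ 2) MeasureTheory.volume 2 T := by
    refine ContinuousOn.intervalIntegrable ?_
    rw [Set.uIcc_of_le hT]
    exact hf.norm.pow 2
  have i2 := intervalIntegrable_one_div_sq hT
  have hcross : |∫ t in (2 : ℝ)..T, 2 * (p t * conj (G t)).re| ≤ 6 * g * S := by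
    have hre : ∫ t in (2 : ℝ)..T, (p t * conj (G t)).re =
        (∫ t in (2 : ℝ)..T, p t * conj (G t)).re := by
      simpa using Complex.reCLM.intervalIntegral_comp_comm ipG
    rw [intervalIntegral.integral_const_mul, hre, abs_mul, abs_two]
    have h1 := norm_integral_expSum_mul_conj_le (S := Finset.Ico 1 N) (M := 2 * N)
      (fun n hn => ⟨(Finset.mem_Ico.1 hn).1, by have := (Finset.mem_Ico.1 hn).2; omega⟩) x y' b hT
    have h2 : ∑ n ∈ Finset.Ico 1 N, ‖x n‖ ≤ S :=
      Finset.sum_le_sum_of_subset_of_nonneg hsub fun _ _ _ => norm_nonneg _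
    have h3 : 3 * ‖y'‖ * ∑ n ∈ Finset.Ico 1 N, ‖x n‖ ≤ 3 * g * S := by gcongr
    have h4 := (Complex.abs_re_le_norm (∫ t in (2 : ℝ)..T, p t * conj (G t))).trans h1
    linarith
  have hpmean : ∫ t in (2 : ℝ)..T, ‖p t‖ ^ 2 ≤ T * H + 2 * Real.pi * H + S ^ 2 := by
    have h1 := (abs_le.1 (abs_integral_norm_expSum_log_sq_sub_le (S := Finset.Ico 1 N)
      (fun n hn => (Finset.mem_Ico.1 hn).1) x 2 T)).2
    have hHN : ∑ n ∈ Finset.Ico 1 N, n * ‖x n‖ ^ 2 ≤ H :=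
      Finset.sum_le_sum_of_subset_of_nonneg hsub fun _ _ _ => by positivity
    have hDH : ∑ n ∈ Finset.Ico 1 N, ‖x n‖ ^ 2 ≤ H := by
      refine le_trans (Finset.sum_le_sum fun n hn => ?_) hHN
      have : (1 : ℝ) ≤ n := by exact_mod_cast (Finset.mem_Ico.1 hn).1
      exact le_mul_of_one_le_left (by positivity) this
    have hSN : ∑ n ∈ Finset.Ico 1 N, ‖x n‖ ≤ S :=
      Finset.sum_le_sum_of_subset_of_nonneg hsub fun _ _ _ => norm_nonneg _
    have a1 : 2 * Real.pi * ∑ n ∈ Finset.Ico 1 N, n * ‖x n‖ ^ 2 ≤ 2 * Real.pi * H := by gcongr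
    have a2 : (∑ n ∈ Finset.Ico 1 N, ‖x n‖) ^ 2 ≤ S ^ 2 := by gcongr
    have a3 : (T - 2) * ∑ n ∈ Finset.Ico 1 N, ‖x n‖ ^ 2 ≤ T * H := by
      refine mul_le_mul (by linarith) hDH (Finset.sum_nonneg fun _ _ => by positivity) hT0.le
    linarith
  have hdiff : |(∫ t in (2 : ℝ)..T, ‖f t‖ ^ 2) - (∫ t in (2 : ℝ)..T, ‖P t‖ ^ 2) -
      ∫ t in (2 : ℝ)..T, 2 * (p t * conj (G t)).re| ≤
      S * g + T⁻¹ * (T * H + 2 * Real.pi * H + S ^ 2) + g ^ 2 + 125 / 8 * g ^ 2 := by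
    rw [← intervalIntegral.integral_sub iF iP, ← intervalIntegral.integral_sub (iF.sub iP) ipGre,
      ← Real.norm_eq_abs]
    have ib : IntervalIntegrable (fun t : ℝ => 2 * S * g * (1 / t ^ 2) + T⁻¹ * ‖p t‖ ^ 2 +
        T⁻¹ * g ^ 2 + 125 / 4 * g ^ 2 * (1 / t ^ 2)) MeasureTheory.volume 2 T :=
      (((i2.const_mul _).add (ip.const_mul _)).add intervalIntegrable_const).add (i2.const_mul _)
    refine (intervalIntegral.norm_integral_le_of_norm_le hT (MeasureTheory.ae_of_all _
      fun t ht => hpt t ⟨ht.1.le, ht.2⟩) ib).trans ?_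
    rw [intervalIntegral.integral_add (((i2.const_mul _).add (ip.const_mul _)).add
        intervalIntegrable_const) (i2.const_mul _),
      intervalIntegral.integral_add ((i2.const_mul _).add (ip.const_mul _))
        intervalIntegrable_const,
      intervalIntegral.integral_add (i2.const_mul _) (ip.const_mul _),
      intervalIntegral.integral_const_mul, intervalIntegral.integral_const_mul,
      intervalIntegral.integral_const_mul, intervalIntegral.integral_const_mul,
      intervalIntegral.integral_const, smul_eq_mul]
    have h1 := integral_one_div_sq_le hT
    have c1 : 2 * S * g * ∫ t in (2 : ℝ)..T, 1 / t ^ 2 ≤ 2 * S * g * (1 / 2) := by gcongr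
    have c2 : 125 / 4 * g ^ 2 * ∫ t in (2 : ℝ)..T, 1 / t ^ 2 ≤ 125 / 4 * g ^ 2 * (1 / 2) := by
      gcongr
    have c3 : T⁻¹ * ∫ t in (2 : ℝ)..T, ‖p t‖ ^ 2 ≤
        T⁻¹ * (T * H + 2 * Real.pi * H + S ^ 2) := by gcongr
    have c4 : T⁻¹ * ((T - 2) * g ^ 2) ≤ g ^ 2 := by
      calc _ ≤ T⁻¹ * (T * g ^ 2) := by gcongr; linarith
        _ = _ := by field_simp
    linarith
  have hPmean := abs_integral_norm_expSum_log_sq_sub_le (S := Finset.Ico 1 (2 * N))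
    (fun n hn => (Finset.mem_Ico.1 hn).1) x 2 T
  have hpi : Real.pi ≤ 4 := Real.pi_le_four
  have hTinv : T⁻¹ * (T * H + 2 * Real.pi * H + S ^ 2) ≤ H + 1 / 2 * (8 * H + S ^ 2) := by
    have hi : T⁻¹ ≤ 1 / 2 := by
      rw [one_div]
      gcongr
    have e : T⁻¹ * (T * H + 2 * Real.pi * H + S ^ 2) = H + T⁻¹ * (2 * Real.pi * H + S ^ 2) := by
      field_simp
      ring
    rw [e]
    gcongr
    linarith
  have hpiH : Real.pi * H ≤ 4 * H := by gcongr
  have hSg : 2 * (S * g) ≤ S ^ 2 + g ^ 2 := by nlinarith [sq_nonneg (S - g)]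
  rw [abs_le] at hcross hdiff hPmean ⊢
  have hg2 := sq_nonneg g
  have hS2 := sq_nonneg S
  constructor <;> linarith [hcross.1, hcross.2, hdiff.1, hdiff.2, hPmean.1, hPmean.2]

end EulerDoubleZeta
namespace EulerDoubleZeta

/-! ### The mean square of the double zeta-function -/

theorem mem_regularSet_inter_tube {s₁ : ℂ} {σ₂ : ℝ} (h2 : 0 < σ₂) (h12 : 1 < s₁.re + σ₂) {t : ℝ}
    (hreg : (s₁, (σ₂ : ℂ) + (t : ℂ) * Complex.I) ∈ regularSet) :
    (s₁, (σ₂ : ℂ) + (t : ℂ) * Complex.I) ∈ regularSet ∩ tube 0 :=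
  ⟨hreg, mem_tube_zero.2 ⟨by simpa using h2, by simpa using h12⟩⟩

theorem zeta₂_eq_doubleZeta_of_two_le {s₁ : ℂ} {σ₂ : ℝ} (h2 : 0 < σ₂) (h12 : 1 < s₁.re + σ₂)
    (hreg : ∀ t : ℝ, 2 ≤ t → (s₁, (σ₂ : ℂ) + (t : ℂ) * Complex.I) ∈ regularSet) {t : ℝ}
    (ht : 2 ≤ t) :
    zeta₂ s₁ ((σ₂ : ℂ) + t * Complex.I) = doubleZeta (s₁, (σ₂ : ℂ) + t * Complex.I) :=
  zeta₂_eq_doubleZeta (mem_regularSet_inter_tube h2 h12 (hreg t ht)) (by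
    simp
    linarith)

theorem continuousOn_zeta₂ {s₁ : ℂ} {σ₂ : ℝ} (h2 : 0 < σ₂) (h12 : 1 < s₁.re + σ₂)
    (hreg : ∀ t : ℝ, 2 ≤ t → (s₁, (σ₂ : ℂ) + (t : ℂ) * Complex.I) ∈ regularSet) :
    ContinuousOn (fun t : ℝ => zeta₂ s₁ ((σ₂ : ℂ) + t * Complex.I)) (Set.Ici 2) := by
  have h : ContinuousOn (fun t : ℝ => doubleZeta (s₁, (σ₂ : ℂ) + t * Complex.I)) (Set.Ici 2) :=
    differentiableOn_doubleZeta.continuousOn.comp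
      (f := fun t : ℝ => (s₁, (σ₂ : ℂ) + t * Complex.I)) (by fun_prop) fun t ht =>
        mem_regularSet_inter_tube h2 h12 (hreg t ht)
  exact h.congr fun t ht => zeta₂_eq_doubleZeta_of_two_le h2 h12 hreg ht

theorem intervalIntegrable_norm_zeta₂_sq {s₁ : ℂ} {σ₂ : ℝ} (h2 : 0 < σ₂) (h12 : 1 < s₁.re + σ₂)
    (hreg : ∀ t : ℝ, 2 ≤ t → (s₁, (σ₂ : ℂ) + (t : ℂ) * Complex.I) ∈ regularSet) {T : ℝ}
    (hT : 2 ≤ T) :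
    IntervalIntegrable (fun t : ℝ => ‖zeta₂ s₁ ((σ₂ : ℂ) + (t : ℂ) * Complex.I)‖ ^ 2)
      MeasureTheory.volume 2 T := by
  refine ContinuousOn.intervalIntegrable ?_
  rw [Set.uIcc_of_le hT]
  exact ((continuousOn_zeta₂ h2 h12 hreg).mono Set.Icc_subset_Ici_self).norm.pow 2

/-- The coefficients `n^{-σ} ∑_{m < n} m^{-s}` of the Dirichlet series in the variable `t₂`. -/
noncomputable def weightedSum (s₁ : ℂ) (σ₂ : ℝ) (n : ℕ) : ℂ :=
  powerSum s₁ n * (n : ℂ) ^ (-(σ₂ : ℂ))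

theorem norm_weightedSum (s₁ : ℂ) (σ₂ : ℝ) {n : ℕ} (hn : 1 ≤ n) :
    ‖weightedSum s₁ σ₂ n‖ = ‖powerSum s₁ n‖ * (n : ℝ) ^ (-σ₂) := by
  rw [weightedSum, norm_mul, norm_natCast_cpow hn]
  simp

theorem zeta₂SqTerm_eq (s₁ : ℂ) (σ₂ : ℝ) {n : ℕ} (hn : 1 ≤ n) :
    zeta₂SqTerm s₁ (2 * σ₂) n = ‖weightedSum s₁ σ₂ n‖ ^ 2 := by
  have hn' : (0 : ℝ) < n := by exact_mod_cast hn
  rw [norm_weightedSum _ _ hn, zeta₂SqTerm, mul_pow, ← powerSum, ← Real.rpow_mul_natCast hn'.le,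
    one_div, ← Real.rpow_neg hn'.le]
  congr 2
  push_cast
  ring

theorem natCast_cpow_neg_add_mul_I {n : ℕ} (hn : 1 ≤ n) (z : ℂ) (t : ℝ) :
    (n : ℂ) ^ (z - t * Complex.I) =
      (n : ℂ) ^ z * Complex.exp (-((Real.log n : ℝ) * t) * Complex.I) := by
  rw [natCast_cpow_eq_exp hn, natCast_cpow_eq_exp hn, ← Complex.exp_add]
  congr 1
  ring

theorem sum_powerSum_mul_cpow_eq (s₁ : ℂ) (σ₂ t : ℝ) (N : ℕ) :
    ∑ n ∈ Finset.Ico 1 N, powerSum s₁ n * (n : ℂ) ^ (-((σ₂ : ℂ) + t * Complex.I)) =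
      expSum (Finset.Ico 1 N) (weightedSum s₁ σ₂) (fun n => Real.log n) t := by
  refine Finset.sum_congr rfl fun n hn => ?_
  rw [neg_add', natCast_cpow_neg_add_mul_I (Finset.mem_Ico.1 hn).1, weightedSum]
  ring

/-- Each of the first n terms is at least n^{-α}. This lets a single n·‖xₙ‖ be absorbed into the sum
that measures all errors. -/
theorem mul_rpow_neg_le_sum {α : ℝ} (hα : 0 ≤ α) {n M : ℕ} (hnM : n < M) :
    (n : ℝ) * (n : ℝ) ^ (-α) ≤ ∑ k ∈ Finset.Ico 1 M, (k : ℝ) ^ (-α) := by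
  calc (n : ℝ) * (n : ℝ) ^ (-α) = ∑ k ∈ Finset.Ico 1 (n + 1), (n : ℝ) ^ (-α) := by simp
    _ ≤ ∑ k ∈ Finset.Ico 1 (n + 1), (k : ℝ) ^ (-α) := by
        refine Finset.sum_le_sum fun k hk => ?_
        obtain ⟨h1, h2⟩ := Finset.mem_Ico.1 hk
        have hk0 : (0 : ℝ) < k := by exact_mod_cast h1
        exact Real.rpow_le_rpow_of_nonpos hk0 (by exact_mod_cast (by omega : k ≤ n)) (by linarith)
    _ ≤ _ := Finset.sum_le_sum_of_subset_of_nonneg (Finset.Ico_subset_Ico le_rfl hnM)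
        fun k _ _ => by positivity

/-- The length of the Dirichlet polynomial which approximates the double zeta-function
up to height `T`. -/
noncomputable def cutoff (K : ℕ) (T : ℝ) : ℕ := 2 * (⌈T⌉₊ + K)

/-- If ‖xₙ‖ ≤ M l n^{-α}, then ∑‖xₙ‖, every n‖xₙ‖ and the size of the oscillating terms are O(lV),
so the whole error is O((lV)²). The factor l leaves room for logarithmic growth; K does not depend
on α, M or l. -/
theorem exists_abs_meanSq_sub_le {s₁ : ℂ} {σ₂ : ℝ} (h2 : 0 < σ₂) (h12 : 1 < s₁.re + σ₂)
    (hreg : ∀ t : ℝ, 2 ≤ t → (s₁, (σ₂ : ℂ) + (t : ℂ) * Complex.I) ∈ regularSet) :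
    ∃ K : ℕ, ∀ α M : ℝ, 0 ≤ α → 0 ≤ M →
      (∀ n : ℕ, 1 ≤ n → (n : ℝ) ^ (1 - s₁.re - σ₂) ≤ M * (n : ℝ) ^ (-α)) →
      ∃ C : ℝ, 0 ≤ C ∧ ∀ T l : ℝ, 2 ≤ T → 1 ≤ l →
        (∀ n : ℕ, 1 ≤ n → n ≤ cutoff K T → ‖weightedSum s₁ σ₂ n‖ ≤ M * l * (n : ℝ) ^ (-α)) →
        |meanSq s₁ σ₂ T - T * ∑ n ∈ Finset.Ico 1 (cutoff K T), zeta₂SqTerm s₁ (2 * σ₂) n| ≤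
          C * (l * ∑ n ∈ Finset.Ico 1 (cutoff K T), (n : ℝ) ^ (-α)) ^ 2 := by
  obtain ⟨A, hA0, hA⟩ := exists_doubleZeta_approx h2 h12 hreg
  -- With N = ⌈T⌉ + K both |s₂| and |s₁ + s₂ - 1| are at most N for all t ≤ T.
  set K : ℕ := ⌈‖s₁‖ + |σ₂| + 1⌉₊ with hK
  refine ⟨K, fun α M hα hM hpow =>
    ⟨25 * ((4 * (1 + A) * M) ^ 2 + M ^ 2 + M ^ 2) + 2 * M ^ 2, by positivity,
      fun T l hT hl hbd => ?_⟩⟩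
  unfold cutoff at hbd ⊢
  set N : ℕ := ⌈T⌉₊ + K with hN
  set V : ℝ := ∑ n ∈ Finset.Ico 1 (2 * N), (n : ℝ) ^ (-α) with hV
  have hV0 : 0 ≤ V := Finset.sum_nonneg fun _ _ => by positivity
  have hNT : T + (‖s₁‖ + |σ₂| + 1) ≤ N := by
    rw [hN]
    push_cast
    exact add_le_add (Nat.le_ceil T) (Nat.le_ceil _)
  have hs0 := norm_nonneg s₁
  have hσ0 := abs_nonneg σ₂
  have hTN : T ≤ N := by linarith
  have hN0 : (0 : ℝ) < N := by linarith
  have hN1 : 1 ≤ N := by exact_mod_cast hN0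
  have hs : ∀ t ∈ Set.Icc 2 T, ‖(σ₂ : ℂ) + t * Complex.I‖ ≤ |σ₂| + T := fun t ht => by
    refine (norm_add_le _ _).trans ?_
    simp only [norm_mul, Complex.norm_real, Complex.norm_I, mul_one, Real.norm_eq_abs]
    rw [abs_of_nonneg (by linarith [ht.1] : (0 : ℝ) ≤ t)]
    linarith [ht.2]
  have hw : ∀ t ∈ Set.Icc 2 T, ‖s₁ + (σ₂ + t * Complex.I) - 1‖ ≤ N := fun t ht => by
    refine (norm_sub_le _ _).trans ?_
    rw [norm_one]
    linarith [norm_add_le s₁ (σ₂ + t * Complex.I), hs t ht]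
  have hl0 : 0 ≤ l := by linarith
  have hMV : M * V ≤ M * l * V := by
    rw [mul_right_comm]
    exact le_mul_of_one_le_right (by positivity) hl
  have key1 : ∀ n : ℕ, 1 ≤ n → n < 2 * N → (n : ℝ) * ‖weightedSum s₁ σ₂ n‖ ≤ M * l * V :=
    fun n hn hnN => by
      calc _ ≤ (n : ℝ) * (M * l * (n : ℝ) ^ (-α)) := by gcongr; exact hbd n hn hnN.le
        _ = M * l * ((n : ℝ) * (n : ℝ) ^ (-α)) := by ring
        _ ≤ _ := by gcongr; exact mul_rpow_neg_le_sum hα hnN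
  have hV2 : ((2 * N : ℕ) : ℝ) * ((2 * N : ℕ) : ℝ) ^ (-α) ≤ 2 * V := by
    have h1 : ((2 * N : ℕ) : ℝ) ^ (-α) ≤ (N : ℝ) ^ (-α) :=
      Real.rpow_le_rpow_of_nonpos hN0 (by push_cast; linarith) (by linarith)
    have h3 := mul_rpow_neg_le_sum hα (by omega : N < 2 * N)
    calc _ ≤ ((2 * N : ℕ) : ℝ) * (N : ℝ) ^ (-α) := by gcongr
      _ = 2 * ((N : ℝ) * (N : ℝ) ^ (-α)) := by push_cast; ring
      _ ≤ _ := by gcongr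
  have hKV : ∀ k : ℕ, k = N ∨ k = 2 * N → 1 ≤ k ∧ k ≤ 2 * N ∧ N ≤ k ∧
      (k : ℝ) * (k : ℝ) ^ (-α) ≤ 2 * V := fun k hk => by
    rcases hk with rfl | rfl
    · refine ⟨hN1, by omega, le_rfl, ?_⟩
      have := mul_rpow_neg_le_sum hα (by omega : N < 2 * N)
      linarith
    · exact ⟨by omega, le_rfl, by omega, hV2⟩
  have hg1 : ∀ k : ℕ, k = N ∨ k = 2 * N → ‖powerSum s₁ k‖ * (k : ℝ) ^ (1 - σ₂) ≤
      2 * (M * l * V) := fun k hk => by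
    obtain ⟨hk1, hk2, hk3, hk4⟩ := hKV k hk
    have hk0 : (0 : ℝ) < k := by exact_mod_cast hk1
    have e : ‖powerSum s₁ k‖ * (k : ℝ) ^ (1 - σ₂) = k * ‖weightedSum s₁ σ₂ k‖ := by
      rw [norm_weightedSum _ _ hk1, show 1 - σ₂ = -σ₂ + 1 by ring, Real.rpow_add_one hk0.ne']
      ring
    rw [e]
    calc _ ≤ (k : ℝ) * (M * l * (k : ℝ) ^ (-α)) := by gcongr; exact hbd k hk1 hk2
      _ = M * l * ((k : ℝ) * (k : ℝ) ^ (-α)) := by ring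
      _ ≤ M * l * (2 * V) := by gcongr
      _ = _ := by ring
  have hg2 : ∀ k : ℕ, k = N ∨ k = 2 * N → (k : ℝ) ^ (2 - s₁.re - σ₂) ≤ 2 * (M * l * V) :=
    fun k hk => by
      obtain ⟨hk1, hk2, hk3, hk4⟩ := hKV k hk
      have hk0 : (0 : ℝ) < k := by exact_mod_cast hk1
      rw [show 2 - s₁.re - σ₂ = 1 - s₁.re - σ₂ + 1 by ring, Real.rpow_add_one hk0.ne']
      calc _ ≤ M * (k : ℝ) ^ (-α) * k := by gcongr; exact hpow k hk1
        _ = M * ((k : ℝ) * (k : ℝ) ^ (-α)) := by ring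
        _ ≤ M * (2 * V) := by gcongr
        _ ≤ _ := by linarith
  have hX0 : 0 ≤ M * l * V := by positivity
  set g : ℝ := 4 * (1 + A) * M * (l * V) with hg
  have hgeq : g = 4 * (M * l * V) + 4 * A * (M * l * V) := by rw [hg]; ring
  have happ : ∀ k : ℕ, k = N ∨ k = 2 * N →
      ‖powerSum s₁ k * (k : ℂ) ^ (1 - (σ₂ : ℂ))‖ ≤ g ∧ ∀ t ∈ Set.Icc 2 T,
      ‖zeta₂ s₁ ((σ₂ : ℂ) + t * Complex.I) -
        expSum (Finset.Ico 1 k) (weightedSum s₁ σ₂) (fun n => Real.log n) t -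
        powerSum s₁ k * (k : ℂ) ^ (1 - (σ₂ : ℂ)) *
          Complex.exp (-((Real.log k : ℝ) * t) * Complex.I) /
            (((σ₂ - 1 : ℝ) : ℂ) + t * Complex.I)‖ ≤ g * (1 / t ^ 2 + 1 / N) := fun k hk => by
    obtain ⟨hk1, hk2, hk3, hk4⟩ := hKV k hk
    have hAX : 0 ≤ A * (M * l * V) := by positivity
    constructor
    · rw [norm_mul, norm_natCast_cpow hk1]
      have := hg1 k hk
      simp only [Complex.sub_re, Complex.one_re, Complex.ofReal_re]
      linarith
    · intro t ht
      have hNk : (N : ℝ) ≤ k := by exact_mod_cast hk3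
      have h1 := hA k t hk1 ht.1 ((hs t ht).trans (by linarith)) ((hw t ht).trans hNk)
      rw [zeta₂_eq_doubleZeta_of_two_le h2 h12 hreg ht.1, ← sum_powerSum_mul_cpow_eq,
        mul_assoc (powerSum s₁ k), ← natCast_cpow_neg_add_mul_I hk1, mul_div_assoc]
      have e1 : (1 : ℂ) - σ₂ - t * Complex.I = 1 - (σ₂ + t * Complex.I) := by ring
      have e2 : (((σ₂ - 1 : ℝ) : ℂ) + t * Complex.I) = σ₂ + t * Complex.I - 1 := by
        push_cast; ring
      rw [e1, e2]
      refine h1.trans ?_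
      have ht0 : 0 < t := by linarith [ht.1]
      gcongr
      · have h3 := mul_le_mul_of_nonneg_left (add_le_add (hg1 k hk) (hg2 k hk)) hA0
        linarith
  have hmain := abs_integral_norm_sq_sub_le (x := weightedSum s₁ σ₂) (b := σ₂ - 1) (g := g) hT hTN
    ((continuousOn_zeta₂ h2 h12 hreg).mono Set.Icc_subset_Ici_self)
    (happ N (Or.inl rfl)).1 (happ (2 * N) (Or.inr rfl)).1
    (happ N (Or.inl rfl)).2 (happ (2 * N) (Or.inr rfl)).2
  have hD : ∑ n ∈ Finset.Ico 1 (2 * N), zeta₂SqTerm s₁ (2 * σ₂) n =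
      ∑ n ∈ Finset.Ico 1 (2 * N), ‖weightedSum s₁ σ₂ n‖ ^ 2 :=
    Finset.sum_congr rfl fun n hn => zeta₂SqTerm_eq s₁ σ₂ (Finset.mem_Ico.1 hn).1
  have hS : ∑ n ∈ Finset.Ico 1 (2 * N), ‖weightedSum s₁ σ₂ n‖ ≤ M * (l * V) := by
    rw [← mul_assoc, hV, Finset.mul_sum]
    exact Finset.sum_le_sum fun n hn =>
      hbd n (Finset.mem_Ico.1 hn).1 (Finset.mem_Ico.1 hn).2.le
  have hS0 : 0 ≤ ∑ n ∈ Finset.Ico 1 (2 * N), ‖weightedSum s₁ σ₂ n‖ :=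
    Finset.sum_nonneg fun _ _ => norm_nonneg _
  have hH : ∑ n ∈ Finset.Ico 1 (2 * N), n * ‖weightedSum s₁ σ₂ n‖ ^ 2 ≤ M ^ 2 * (l * V) ^ 2 := by
    calc _ ≤ ∑ n ∈ Finset.Ico 1 (2 * N), M * l * V * ‖weightedSum s₁ σ₂ n‖ := by
          refine Finset.sum_le_sum fun n hn => ?_
          rw [sq, ← mul_assoc]
          exact mul_le_mul_of_nonneg_right
            (key1 n (Finset.mem_Ico.1 hn).1 (Finset.mem_Ico.1 hn).2) (norm_nonneg _)
      _ = M * l * V * ∑ n ∈ Finset.Ico 1 (2 * N), ‖weightedSum s₁ σ₂ n‖ :=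
          (Finset.mul_sum _ _ _).symm
      _ ≤ M * l * V * (M * (l * V)) := by gcongr
      _ = _ := by ring
  -- The integral starts at 2, so the diagonal comes with T - 2; the missing twice the diagonal sum
  -- is the 2M² in the constant.
  have hDH : ∑ n ∈ Finset.Ico 1 (2 * N), ‖weightedSum s₁ σ₂ n‖ ^ 2 ≤ M ^ 2 * (l * V) ^ 2 := by
    refine le_trans (Finset.sum_le_sum fun n hn => ?_) hH
    have : (1 : ℝ) ≤ n := by exact_mod_cast (Finset.mem_Ico.1 hn).1
    exact le_mul_of_one_le_left (by positivity) this
  have hD0 : 0 ≤ ∑ n ∈ Finset.Ico 1 (2 * N), ‖weightedSum s₁ σ₂ n‖ ^ 2 :=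
    Finset.sum_nonneg fun _ _ => by positivity
  have hS2 : (∑ n ∈ Finset.Ico 1 (2 * N), ‖weightedSum s₁ σ₂ n‖) ^ 2 ≤ M ^ 2 * (l * V) ^ 2 := by
    rw [← mul_pow]
    gcongr
  have hg2' : g ^ 2 = (4 * (1 + A) * M) ^ 2 * (l * V) ^ 2 := by rw [hg, mul_pow]
  rw [hD]
  rw [hg2'] at hmain
  change |meanSq s₁ σ₂ T - _| ≤ _ at hmain
  rw [abs_le] at hmain ⊢
  constructor <;> linarith [hmain.1, hmain.2]

end EulerDoubleZeta
namespace EulerDoubleZeta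

/-! ### Partial sums of powers -/

theorem sum_rpow_Ico_le_of_one_lt {α : ℝ} (hα : 1 < α) (M : ℕ) :
    ∑ n ∈ Finset.Ico 1 M, (n : ℝ) ^ (-α) ≤ 1 + 1 / (α - 1) := by
  have h := sum_range_rpow_tail_le (q := α - 1) (by linarith) le_rfl (M - 1)
  rw [Finset.sum_Ico_eq_sum_range]
  simpa using h

/-- Induction: M^{1-α} grows by at least (1-α)M^{-α}/2, because log((M+1)/M) ≥ 1/(2M). Negative α is
included, as σ₁ may be negative. -/
theorem sum_rpow_Ico_le_of_lt_one {α : ℝ} (hα : α < 1) {M : ℕ} (hM : 1 ≤ M) :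
    ∑ n ∈ Finset.Ico 1 M, (n : ℝ) ^ (-α) ≤ 2 / (1 - α) * (M : ℝ) ^ (1 - α) := by
  have hβ : 0 < 1 - α := by linarith
  induction M, hM using Nat.le_induction with
  | base => simp; positivity
  | succ M hM ih =>
    have hM0 : (0 : ℝ) < M := by exact_mod_cast hM
    have hM1 : (1 : ℝ) ≤ M := by exact_mod_cast hM
    rw [Finset.sum_Ico_succ_top hM]
    have h1 : ((M + 1 : ℕ) : ℝ) ^ (1 - α) =
        (M : ℝ) ^ (1 - α) * Real.exp ((1 - α) * logStep M) := by
      rw [Real.rpow_def_of_pos hM0, Real.rpow_def_of_pos (by positivity), ← Real.exp_add, logStep]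
      congr 1
      push_cast
      ring
    have h2 : (1 - α) * (1 / (2 * M)) ≤ Real.exp ((1 - α) * logStep M) - 1 := by
      have h3 : 1 / (2 * (M : ℝ)) ≤ logStep M :=
        le_trans (by gcongr; linarith) (inv_succ_le_logStep hM)
      have h4 : (1 - α) * (1 / (2 * (M : ℝ))) ≤ (1 - α) * logStep M := by gcongr
      linarith [Real.add_one_le_exp ((1 - α) * logStep M)]
    have h5 : (M : ℝ) ^ (-α) = (M : ℝ) ^ (1 - α) / M := by
      rw [← Real.rpow_sub_one hM0.ne']
      congr 1
      ring
    have h6 : (M : ℝ) ^ (-α) ≤ 2 / (1 - α) * ((M : ℝ) ^ (1 - α) *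
        (Real.exp ((1 - α) * logStep M) - 1)) := by
      calc (M : ℝ) ^ (-α) = 2 / (1 - α) * ((M : ℝ) ^ (1 - α) * ((1 - α) * (1 / (2 * M)))) := by
            rw [h5]; field_simp
        _ ≤ _ := by gcongr
    rw [h1]
    linarith

theorem log_le_sum_inv_Ico {M : ℕ} (hM : 1 ≤ M) :
    Real.log M ≤ ∑ n ∈ Finset.Ico 1 M, 1 / (n : ℝ) ∧
      ∑ n ∈ Finset.Ico 1 M, 1 / (n : ℝ) + 1 / M ≤ Real.log M + 1 := by
  induction M, hM using Nat.le_induction with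
  | base => simp
  | succ M hM ih =>
    have h1 := logStep_le_inv hM
    have h2 := inv_succ_le_logStep hM
    rw [logStep] at h1 h2
    rw [Finset.sum_Ico_succ_top hM]
    push_cast
    constructor <;> linarith

theorem sum_inv_Ico_le {M : ℕ} (hM : 1 ≤ M) :
    ∑ n ∈ Finset.Ico 1 M, 1 / (n : ℝ) ≤ Real.log M + 1 := by
  have h : 0 ≤ 1 / (M : ℝ) := by positivity
  linarith [(log_le_sum_inv_Ico hM).2]

/-! ### The length of the Dirichlet polynomials -/

theorem le_cutoff (K : ℕ) (T : ℝ) : T ≤ cutoff K T := by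
  have h1 := Nat.le_ceil T
  have h2 : (0 : ℝ) ≤ K := Nat.cast_nonneg K
  rw [cutoff]
  push_cast
  linarith

theorem two_le_cutoff (K : ℕ) {T : ℝ} (hT : 2 ≤ T) : 2 ≤ cutoff K T := by
  have := hT.trans (le_cutoff K T)
  exact_mod_cast this

theorem cutoff_le (K : ℕ) {T : ℝ} (hT : 2 ≤ T) : (cutoff K T : ℝ) ≤ (4 + 2 * K) * T := by
  have h1 := (Nat.ceil_lt_add_one (by linarith : 0 ≤ T)).le
  have h2 : (0 : ℝ) ≤ K := Nat.cast_nonneg K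
  rw [cutoff]
  push_cast
  nlinarith

theorem half_le_log {T : ℝ} (hT : 2 ≤ T) : 1 / 2 ≤ Real.log T := by
  have := Real.log_le_log two_pos hT
  linarith [Real.log_two_gt_d9]

theorem log_le_log_cutoff (K : ℕ) {T : ℝ} (hT : 2 ≤ T) : Real.log T ≤ Real.log (cutoff K T) :=
  Real.log_le_log (by linarith) (le_cutoff K T)

theorem log_cutoff_le (K : ℕ) {T : ℝ} (hT : 2 ≤ T) :
    Real.log (cutoff K T) ≤ Real.log T + Real.log (4 + 2 * K) := by
  have h1 := two_le_cutoff K hT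
  have h2 : (0 : ℝ) < cutoff K T := by exact_mod_cast (by omega : 0 < cutoff K T)
  rw [add_comm, ← Real.log_mul (by positivity) (by positivity)]
  exact Real.log_le_log h2 (cutoff_le K hT)

theorem exists_log_cutoff_add_one_le (K : ℕ) :
    ∃ C : ℝ, 0 ≤ C ∧ ∀ T : ℝ, 2 ≤ T → Real.log (cutoff K T) + 1 ≤ C * Real.log T := by
  have h0 : 0 ≤ Real.log (4 + 2 * (K : ℝ)) :=
    Real.log_nonneg (by linarith [(Nat.cast_nonneg K : (0 : ℝ) ≤ K)])
  refine ⟨1 + 2 * (Real.log (4 + 2 * K) + 1), by positivity, fun T hT => ?_⟩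
  have h1 := log_cutoff_le K hT
  have h2 := half_le_log hT
  nlinarith

theorem exists_sum_cutoff_le_of_one_lt {α : ℝ} (hα : 1 < α) (K : ℕ) :
    ∃ C : ℝ, 0 ≤ C ∧ ∀ T : ℝ, 2 ≤ T →
      ∑ n ∈ Finset.Ico 1 (cutoff K T), (n : ℝ) ^ (-α) ≤ C * 1 := by
  have : 0 < α - 1 := by linarith
  exact ⟨1 + 1 / (α - 1), by positivity, fun T _ => by
    rw [mul_one]; exact sum_rpow_Ico_le_of_one_lt hα _⟩

theorem exists_sum_cutoff_le_of_eq_one (K : ℕ) :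
    ∃ C : ℝ, 0 ≤ C ∧ ∀ T : ℝ, 2 ≤ T →
      ∑ n ∈ Finset.Ico 1 (cutoff K T), (n : ℝ) ^ (-1 : ℝ) ≤ C * Real.log T := by
  obtain ⟨C, hC0, hC⟩ := exists_log_cutoff_add_one_le K
  refine ⟨C, hC0, fun T hT => le_trans ?_ (hC T hT)⟩
  simp only [Real.rpow_neg_one, ← one_div]
  exact sum_inv_Ico_le ((two_le_cutoff K hT).trans' one_le_two)

theorem exists_sum_cutoff_le_of_lt_one {α : ℝ} (hα : α < 1) (K : ℕ) :
    ∃ C : ℝ, 0 ≤ C ∧ ∀ T : ℝ, 2 ≤ T →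
      ∑ n ∈ Finset.Ico 1 (cutoff K T), (n : ℝ) ^ (-α) ≤ C * T ^ (1 - α) := by
  have h0 : 0 < 1 - α := by linarith
  refine ⟨2 / (1 - α) * (4 + 2 * K) ^ (1 - α), by positivity, fun T hT => ?_⟩
  have hT0 : 0 ≤ T := by linarith
  refine (sum_rpow_Ico_le_of_lt_one hα ((two_le_cutoff K hT).trans' one_le_two)).trans ?_
  rw [mul_assoc, ← Real.mul_rpow (by positivity) hT0]
  gcongr
  exact cutoff_le K hT

/-! ### Bounds and asymptotics for the coefficients -/

theorem norm_powerSum_le (s : ℂ) (n : ℕ) :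
    ‖powerSum s n‖ ≤ ∑ m ∈ Finset.Ico 1 n, (m : ℝ) ^ (-s.re) := by
  refine norm_sum_le_of_le _ fun m hm => le_of_eq ?_
  rw [one_div, ← Complex.cpow_neg, norm_natCast_cpow (Finset.mem_Ico.1 hm).1, Complex.neg_re]

theorem powerSum_eq {s : ℂ} (hs : 0 < s.re) (hs1 : s ≠ 1) {n : ℕ} (hn : 1 ≤ n) :
    powerSum s n = zetaTail 1 s - zetaTail n s := by
  induction n, hn using Nat.le_induction with
  | base => simp [powerSum]
  | succ n hn ih =>
    rw [powerSum_succ s hn, ih, zetaTail_eq_add hs hs1 hn]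
    ring

theorem powerSum_one_eq (n : ℕ) :
    powerSum 1 n = ((∑ m ∈ Finset.Ico 1 n, 1 / (m : ℝ) : ℝ) : ℂ) := by
  simp [powerSum]

theorem norm_powerSum_one_le {n : ℕ} (hn : 1 ≤ n) : ‖powerSum 1 n‖ ≤ Real.log n + 1 := by
  rw [powerSum_one_eq, Complex.norm_real, Real.norm_of_nonneg
    (Finset.sum_nonneg fun _ _ => by positivity)]
  exact sum_inv_Ico_le hn

/-- On this line n^{1-s}/(s-1) has constant modulus: the partial sums oscillate but stay bounded. -/
theorem exists_norm_powerSum_le_of_re_eq_one {s : ℂ} (hs : s.re = 1) (hs1 : s ≠ 1) :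
    ∃ C : ℝ, 0 ≤ C ∧ ∀ n : ℕ, 1 ≤ n → ‖powerSum s n‖ ≤ C := by
  obtain ⟨C, hC0, hC⟩ := exists_norm_zetaCorr_le ‖s‖ one_pos
  refine ⟨‖zetaTail 1 s‖ + (1 / ‖s - 1‖ + C), by positivity, fun n hn => ?_⟩
  have hn1 : (1 : ℝ) ≤ n := by exact_mod_cast hn
  rw [powerSum_eq (by linarith) hs1 hn]
  refine (norm_sub_le _ _).trans (add_le_add le_rfl ((norm_add_le _ _).trans (add_le_add ?_ ?_)))
  · rw [norm_div, norm_natCast_cpow hn]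
    simp [hs]
  · refine (hC n s hn le_rfl hs.ge).trans ?_
    exact mul_le_of_le_one_right hC0 (Real.rpow_le_one_of_one_le_of_nonpos hn1 (by linarith))

/-- The partial sums are O(n^{1-σ₁}) for σ₁ < 1 and O(1) for σ₁ ≥ 1; the minimum encodes both. -/
theorem exists_norm_weightedSum_le {s₁ : ℂ} (σ₂ : ℝ) (hs1 : s₁ ≠ 1) :
    ∃ M : ℝ, 0 ≤ M ∧ ∀ n : ℕ, 1 ≤ n →
      ‖weightedSum s₁ σ₂ n‖ ≤ M * (n : ℝ) ^ (-min σ₂ (s₁.re + σ₂ - 1)) := by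
  rcases lt_trichotomy s₁.re 1 with h | h | h
  · have h0 : 0 < 1 - s₁.re := by linarith
    refine ⟨2 / (1 - s₁.re), by positivity, fun n hn => ?_⟩
    have hn0 : (0 : ℝ) < n := by exact_mod_cast hn
    rw [norm_weightedSum _ _ hn, min_eq_right (by linarith),
      show -(s₁.re + σ₂ - 1) = 1 - s₁.re + -σ₂ by ring, Real.rpow_add hn0, ← mul_assoc]
    gcongr
    exact (norm_powerSum_le s₁ n).trans (sum_rpow_Ico_le_of_lt_one h hn)
  · obtain ⟨C, hC0, hC⟩ := exists_norm_powerSum_le_of_re_eq_one h hs1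
    refine ⟨C, hC0, fun n hn => ?_⟩
    rw [norm_weightedSum _ _ hn, min_eq_left (by linarith)]
    gcongr
    exact hC n hn
  · have h0 : 0 < s₁.re - 1 := by linarith
    refine ⟨1 + 1 / (s₁.re - 1), by positivity, fun n hn => ?_⟩
    rw [norm_weightedSum _ _ hn, min_eq_left (by linarith)]
    gcongr
    exact (norm_powerSum_le s₁ n).trans (sum_rpow_Ico_le_of_one_lt h n)

theorem log_add_one_le_mul_rpow {ε : ℝ} (hε : 0 < ε) {x : ℝ} (hx : 1 ≤ x) :
    Real.log x + 1 ≤ (1 / ε + 1) * x ^ ε := by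
  have h1 := Real.log_le_rpow_div (by linarith : 0 ≤ x) hε
  have h2 := Real.one_le_rpow hx hε.le
  have h3 : (1 / ε + 1) * x ^ ε = x ^ ε / ε + x ^ ε := by ring
  linarith

theorem exists_norm_weightedSum_one_le {σ₂ α : ℝ} (hα : α < σ₂) :
    ∃ M : ℝ, 0 ≤ M ∧ ∀ n : ℕ, 1 ≤ n → ‖weightedSum 1 σ₂ n‖ ≤ M * (n : ℝ) ^ (-α) := by
  have h0 : 0 < σ₂ - α := by linarith
  refine ⟨1 / (σ₂ - α) + 1, by positivity, fun n hn => ?_⟩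
  have hn0 : (0 : ℝ) < n := by exact_mod_cast hn
  rw [norm_weightedSum _ _ hn, show -α = σ₂ - α + -σ₂ by ring, Real.rpow_add hn0, ← mul_assoc]
  gcongr
  exact (norm_powerSum_one_le hn).trans (log_add_one_le_mul_rpow h0 (by exact_mod_cast hn))

/-! ### Convergence of the series of squares -/

theorem zeta₂SqTerm_nonneg (s₁ : ℂ) (σ : ℝ) (n : ℕ) : 0 ≤ zeta₂SqTerm s₁ σ n := by
  unfold zeta₂SqTerm
  positivity

theorem zeta₂SqTerm_zero (s₁ : ℂ) (σ : ℝ) : zeta₂SqTerm s₁ σ 0 = 0 := by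
  simp [zeta₂SqTerm]

theorem zeta₂SqTerm_le {s₁ : ℂ} {σ₂ α M : ℝ} {n : ℕ} (hn : 1 ≤ n)
    (h : ‖weightedSum s₁ σ₂ n‖ ≤ M * (n : ℝ) ^ (-α)) :
    zeta₂SqTerm s₁ (2 * σ₂) n ≤ M ^ 2 * (n : ℝ) ^ (-(2 * α - 1) - 1) := by
  have hn0 : (0 : ℝ) < n := by exact_mod_cast hn
  rw [zeta₂SqTerm_eq _ _ hn, show -(2 * α - 1) - 1 = -α * (2 : ℕ) by push_cast; ring,
    Real.rpow_mul_natCast hn0.le, ← mul_pow]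
  gcongr

theorem summable_zeta₂SqTerm {s₁ : ℂ} {σ₂ α M : ℝ} (hα : 1 / 2 < α)
    (h : ∀ n : ℕ, 1 ≤ n → ‖weightedSum s₁ σ₂ n‖ ≤ M * (n : ℝ) ^ (-α)) :
    Summable (zeta₂SqTerm s₁ (2 * σ₂)) := by
  rw [← summable_nat_add_iff 1]
  refine .of_nonneg_of_le (fun n => zeta₂SqTerm_nonneg _ _ _) (fun n => ?_)
    ((summable_rpow_tail (q := 2 * α - 1) (by linarith) 1).mul_left (M ^ 2))
  rw [add_comm]
  exact zeta₂SqTerm_le (by omega) (h _ (by omega))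

/-- The bound is required only from N on, so B may depend on N; this is needed for s₁ = 1, where B
contains log N. -/
theorem abs_sum_zeta₂SqTerm_sub_le {s₁ : ℂ} {σ B q : ℝ} (hq : 0 < q) {N : ℕ} (hN : 1 ≤ N)
    (hs : Summable (zeta₂SqTerm s₁ σ))
    (h : ∀ n : ℕ, N ≤ n → zeta₂SqTerm s₁ σ n ≤ B * (n : ℝ) ^ (-q - 1)) :
    |∑ n ∈ Finset.Ico 1 N, zeta₂SqTerm s₁ σ n - zeta₂Sq s₁ σ| ≤
      B * ((1 + 1 / q) * (N : ℝ) ^ (-q)) := by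
  have hB : 0 ≤ B := by
    have hN0 : (0 : ℝ) < N := by exact_mod_cast hN
    exact nonneg_of_mul_nonneg_left ((zeta₂SqTerm_nonneg s₁ σ N).trans (h N le_rfl))
      (by positivity)
  have h1 := hs.sum_add_tsum_nat_add N
  have h2 : ∑ n ∈ Finset.range N, zeta₂SqTerm s₁ σ n =
      ∑ n ∈ Finset.Ico 1 N, zeta₂SqTerm s₁ σ n := by
    rw [Finset.range_eq_Ico, Finset.sum_eq_sum_Ico_succ_bot (by omega), zeta₂SqTerm_zero, zero_add]
  have h3 : ∑' j, zeta₂SqTerm s₁ σ (j + N) ≤ B * ((1 + 1 / q) * (N : ℝ) ^ (-q)) := by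
    calc _ ≤ ∑' j : ℕ, B * ((N + j : ℕ) : ℝ) ^ (-q - 1) := by
          refine Summable.tsum_le_tsum (fun j => ?_) ((summable_nat_add_iff N).2 hs)
            ((summable_rpow_tail hq N).mul_left B)
          rw [add_comm j N]
          exact h _ (by omega)
      _ = B * ∑' j : ℕ, ((N + j : ℕ) : ℝ) ^ (-q - 1) := tsum_mul_left
      _ ≤ _ := by gcongr; exact tsum_rpow_tail_le hq hN
  have h4 : 0 ≤ ∑' j, zeta₂SqTerm s₁ σ (j + N) := tsum_nonneg fun j => zeta₂SqTerm_nonneg _ _ _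
  rw [zeta₂Sq, ← h1, h2, sub_add_cancel_left, abs_neg, abs_of_nonneg h4]
  exact h3

end EulerDoubleZeta
namespace EulerDoubleZeta

/-! ### The mean square in the region of convergence -/

/-- For s₁ = 1 the logarithm costs a small power of n, so α is taken as the midpoint between σ₂ and
the threshold to be exceeded, 1/2 or 1. -/
theorem exists_weightedSum_bound {s₁ : ℂ} {σ₂ : ℝ} (h2 : 1 / 2 < σ₂) (h12 : 3 / 2 < s₁.re + σ₂) :
    ∃ α M : ℝ, 1 / 2 < α ∧ (1 < σ₂ → 2 < s₁.re + σ₂ → 1 < α) ∧ α ≤ s₁.re + σ₂ - 1 ∧ 0 ≤ M ∧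
      ∀ n : ℕ, 1 ≤ n → ‖weightedSum s₁ σ₂ n‖ ≤ M * (n : ℝ) ^ (-α) := by
  rcases eq_or_ne s₁ 1 with rfl | hs1
  · rw [Complex.one_re] at *
    rcases le_or_gt σ₂ 1 with h | h
    · obtain ⟨M, hM0, hM⟩ := exists_norm_weightedSum_one_le (σ₂ := σ₂) (α := σ₂ / 2 + 1 / 4)
        (by linarith)
      exact ⟨_, M, by linarith, fun h' => by linarith, by linarith, hM0, hM⟩
    · obtain ⟨M, hM0, hM⟩ := exists_norm_weightedSum_one_le (σ₂ := σ₂) (α := (1 + σ₂) / 2)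
        (by linarith)
      exact ⟨_, M, by linarith, fun _ _ => by linarith, by linarith, hM0, hM⟩
  · obtain ⟨M, hM0, hM⟩ := exists_norm_weightedSum_le σ₂ hs1
    exact ⟨_, M, lt_min h2 (by linarith), fun h h' => lt_min h (by linarith), min_le_right _ _,
      hM0, hM⟩

theorem summable_zeta₂SqTerm_of_lt {s₁ : ℂ} {σ₂ : ℝ} (h2 : 1 / 2 < σ₂)
    (h12 : 3 / 2 < s₁.re + σ₂) : Summable (zeta₂SqTerm s₁ (2 * σ₂)) := by
  obtain ⟨α, M, hα, -, -, -, hM⟩ := exists_weightedSum_bound h2 h12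
  exact summable_zeta₂SqTerm hα hM

theorem mul_rpow_neg_le_two_mul_sum {α : ℝ} (hα : 0 ≤ α) {N : ℕ} (hN : 2 ≤ N) :
    (N : ℝ) * (N : ℝ) ^ (-α) ≤ 2 * ∑ n ∈ Finset.Ico 1 N, (n : ℝ) ^ (-α) := by
  have h := mul_rpow_neg_le_sum hα (by omega : N - 1 < N)
  have h1 : (0 : ℝ) < (N - 1 : ℕ) := by exact_mod_cast (by omega : 0 < N - 1)
  have h2 : (N : ℝ) ≤ 2 * (N - 1 : ℕ) := by exact_mod_cast (by omega : N ≤ 2 * (N - 1))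
  have h3 : (N : ℝ) ^ (-α) ≤ ((N - 1 : ℕ) : ℝ) ^ (-α) :=
    Real.rpow_le_rpow_of_nonpos h1 (by exact_mod_cast (by omega : N - 1 ≤ N)) (by linarith)
  calc _ ≤ 2 * ((N - 1 : ℕ) : ℝ) * ((N - 1 : ℕ) : ℝ) ^ (-α) := by gcongr
    _ ≤ _ := by linarith

/-- Since T ≤ N, the left side is at most (N·N^{-α})²; so completing the diagonal sum to an infinite
series costs no more than the error already present. -/
theorem mul_cutoff_rpow_le {α T : ℝ} (hα : 0 ≤ α) (K : ℕ) (hT : 2 ≤ T) :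
    T * (cutoff K T : ℝ) ^ (-(2 * α - 1)) ≤
      4 * (∑ n ∈ Finset.Ico 1 (cutoff K T), (n : ℝ) ^ (-α)) ^ 2 := by
  have hN := two_le_cutoff K hT
  have hN0 : (0 : ℝ) < cutoff K T := by exact_mod_cast (by omega : 0 < cutoff K T)
  have h1 := mul_rpow_neg_le_two_mul_sum hα hN
  calc _ ≤ (cutoff K T : ℝ) * (cutoff K T : ℝ) ^ (-(2 * α - 1)) := by gcongr; exact le_cutoff K T
    _ = ((cutoff K T : ℝ) * (cutoff K T : ℝ) ^ (-α)) ^ 2 := by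
        rw [mul_pow, ← Real.rpow_mul_natCast hN0.le,
          show -(2 * α - 1) = -α * (2 : ℕ) + 1 by push_cast; ring, Real.rpow_add_one hN0.ne']
        ring
    _ ≤ (2 * ∑ n ∈ Finset.Ico 1 (cutoff K T), (n : ℝ) ^ (-α)) ^ 2 := by gcongr
    _ = _ := by ring

/-- The mean square and the partial sum of the series of squares, under a bound for the
coefficients. -/
theorem exists_abs_meanSq_sub_sum_le {s₁ : ℂ} {σ₂ α M : ℝ} (h2 : 0 < σ₂) (h12 : 1 < s₁.re + σ₂)
    (hreg : ∀ t : ℝ, 2 ≤ t → (s₁, (σ₂ : ℂ) + (t : ℂ) * Complex.I) ∈ regularSet)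
    (hα : 0 ≤ α) (hα' : α ≤ s₁.re + σ₂ - 1) (hM0 : 0 ≤ M)
    (hM : ∀ n : ℕ, 1 ≤ n → ‖weightedSum s₁ σ₂ n‖ ≤ M * (n : ℝ) ^ (-α)) :
    ∃ (C : ℝ) (K : ℕ), 0 ≤ C ∧ ∀ T : ℝ, 2 ≤ T →
      |meanSq s₁ σ₂ T - T * ∑ n ∈ Finset.Ico 1 (cutoff K T), zeta₂SqTerm s₁ (2 * σ₂) n| ≤
        C * (∑ n ∈ Finset.Ico 1 (cutoff K T), (n : ℝ) ^ (-α)) ^ 2 := by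
  obtain ⟨K, hK⟩ := exists_abs_meanSq_sub_le h2 h12 hreg
  obtain ⟨C, hC0, hC⟩ := hK α (M + 1) hα (by linarith) fun n hn => by
    have hn1 : (1 : ℝ) ≤ n := by exact_mod_cast hn
    calc (n : ℝ) ^ (1 - s₁.re - σ₂) ≤ (n : ℝ) ^ (-α) :=
          Real.rpow_le_rpow_of_exponent_le hn1 (by linarith)
      _ ≤ _ := le_mul_of_one_le_left (by positivity) (by linarith)
  refine ⟨C, K, hC0, fun T hT => ?_⟩
  have h := hC T 1 hT le_rfl fun n hn _ => by
    refine (hM n hn).trans ?_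
    gcongr
    linarith
  rwa [one_mul] at h

theorem exists_abs_meanSq_sub_zeta₂Sq_le {s₁ : ℂ} {σ₂ α M : ℝ} {v : ℝ → ℝ} (h2 : 0 < σ₂)
    (h12 : 1 < s₁.re + σ₂)
    (hreg : ∀ t : ℝ, 2 ≤ t → (s₁, (σ₂ : ℂ) + (t : ℂ) * Complex.I) ∈ regularSet)
    (hα : 1 / 2 < α) (hα' : α ≤ s₁.re + σ₂ - 1) (hM0 : 0 ≤ M)
    (hM : ∀ n : ℕ, 1 ≤ n → ‖weightedSum s₁ σ₂ n‖ ≤ M * (n : ℝ) ^ (-α))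
    (hv : ∀ K : ℕ, ∃ C : ℝ, 0 ≤ C ∧ ∀ T : ℝ, 2 ≤ T →
      ∑ n ∈ Finset.Ico 1 (cutoff K T), (n : ℝ) ^ (-α) ≤ C * v T) :
    ∃ C : ℝ, ∀ T : ℝ, 2 ≤ T →
      |meanSq s₁ σ₂ T - zeta₂Sq s₁ (2 * σ₂) * T| ≤ C * v T ^ 2 := by
  obtain ⟨C, K, hC0, hC⟩ := exists_abs_meanSq_sub_sum_le h2 h12 hreg (by linarith) hα' hM0 hM
  obtain ⟨B, hB0, hB⟩ := hv K
  have hq : 0 < 2 * α - 1 := by linarith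
  refine ⟨(C + M ^ 2 * (1 + 1 / (2 * α - 1)) * 4) * B ^ 2, fun T hT => ?_⟩
  set N : ℕ := cutoff K T with hN
  set V : ℝ := ∑ n ∈ Finset.Ico 1 N, (n : ℝ) ^ (-α) with hV
  have hV0 : 0 ≤ V := Finset.sum_nonneg fun _ _ => by positivity
  have h1 := hC T hT
  have hN1 : 1 ≤ N := (two_le_cutoff K hT).trans' one_le_two
  have h3 := abs_sum_zeta₂SqTerm_sub_le hq hN1 (summable_zeta₂SqTerm hα hM)
    fun n hn => zeta₂SqTerm_le (hN1.trans hn) (hM n (hN1.trans hn))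
  have hT0 : 0 ≤ T := by linarith
  have h4 : T * |∑ n ∈ Finset.Ico 1 N, zeta₂SqTerm s₁ (2 * σ₂) n - zeta₂Sq s₁ (2 * σ₂)| ≤
      M ^ 2 * (1 + 1 / (2 * α - 1)) * (4 * V ^ 2) := by
    calc _ ≤ T * (M ^ 2 * ((1 + 1 / (2 * α - 1)) * (N : ℝ) ^ (-(2 * α - 1)))) := by gcongr
      _ = M ^ 2 * (1 + 1 / (2 * α - 1)) * (T * (N : ℝ) ^ (-(2 * α - 1))) := by ring
      _ ≤ _ := mul_le_mul_of_nonneg_left (mul_cutoff_rpow_le (by linarith) K hT) (by positivity)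
  have h5 : V ^ 2 ≤ (B * v T) ^ 2 := by
    gcongr
    exact hB T hT
  have e : meanSq s₁ σ₂ T - zeta₂Sq s₁ (2 * σ₂) * T =
      (meanSq s₁ σ₂ T - T * ∑ n ∈ Finset.Ico 1 N, zeta₂SqTerm s₁ (2 * σ₂) n) +
      T * (∑ n ∈ Finset.Ico 1 N, zeta₂SqTerm s₁ (2 * σ₂) n - zeta₂Sq s₁ (2 * σ₂)) := by ring
  rw [e]
  refine (abs_add_le _ _).trans ?_
  rw [abs_mul T, abs_of_nonneg hT0]
  calc _ ≤ C * V ^ 2 + M ^ 2 * (1 + 1 / (2 * α - 1)) * (4 * V ^ 2) := add_le_add h1 h4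
    _ = (C + M ^ 2 * (1 + 1 / (2 * α - 1)) * 4) * V ^ 2 := by ring
    _ ≤ (C + M ^ 2 * (1 + 1 / (2 * α - 1)) * 4) * (B * v T) ^ 2 := by gcongr
    _ = _ := by ring

/-- The case `s₁ = 1`, in which the coefficients grow like the logarithm. -/
theorem exists_abs_meanSq_one_sub_sum_le {σ₂ : ℝ} (h2 : 0 < σ₂)
    (hreg : ∀ t : ℝ, 2 ≤ t → ((1 : ℂ), (σ₂ : ℂ) + (t : ℂ) * Complex.I) ∈ regularSet) :
    ∃ (C : ℝ) (K : ℕ), 0 ≤ C ∧ ∀ T : ℝ, 2 ≤ T →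
      |meanSq 1 σ₂ T - T * ∑ n ∈ Finset.Ico 1 (cutoff K T), zeta₂SqTerm 1 (2 * σ₂) n| ≤
        C * (Real.log T * ∑ n ∈ Finset.Ico 1 (cutoff K T), (n : ℝ) ^ (-σ₂)) ^ 2 := by
  obtain ⟨K, hK⟩ := exists_abs_meanSq_sub_le (s₁ := 1) h2 (by simp; linarith) hreg
  obtain ⟨A, hA0, hA⟩ := exists_log_cutoff_add_one_le K
  obtain ⟨C, hC0, hC⟩ := hK σ₂ (A + 1) h2.le (by linarith) fun n hn => by
    rw [Complex.one_re, sub_self, zero_sub]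
    exact le_mul_of_one_le_left (by positivity) (by linarith)
  refine ⟨C * 2 ^ 2, K, by positivity, fun T hT => ?_⟩
  have hlog := half_le_log hT
  -- The factor 2 secures l ≥ 1, as log T ≥ 1/2.
  have h := hC T (2 * Real.log T) hT (by linarith) fun n hn hnN => by
    have hn0 : (0 : ℝ) < n := by exact_mod_cast hn
    rw [norm_weightedSum _ _ hn]
    gcongr
    refine (norm_powerSum_one_le hn).trans ?_
    have h1 : Real.log n ≤ Real.log (cutoff K T) :=
      Real.log_le_log hn0 (by exact_mod_cast hnN)
    have h3 := hA T hT
    have h4 : 0 ≤ A * Real.log T := by positivity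
    linarith
  rwa [mul_assoc, mul_pow, ← mul_assoc] at h

/-- Splitting log x = log y + log(x/y) freezes the logarithm at y at the price of (x/y)^ε. In a tail
sum from y = N the powers of N cancel, so nothing beyond the logarithm is lost. -/
theorem log_add_one_le_mul_div_rpow {ε x y : ℝ} (hε : 0 < ε) (hy : 1 ≤ y) (hxy : y ≤ x) :
    Real.log x + 1 ≤ (1 / ε + 1) * (Real.log y + 1) * y ^ (-ε) * x ^ ε := by
  have hy0 : 0 < y := by linarith
  have hx0 : 0 < x := by linarith
  have h1 : 1 ≤ x / y := (one_le_div hy0).2 hxy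
  have h2 := log_add_one_le_mul_rpow hε h1
  have h3 := Real.one_le_rpow h1 hε.le
  have h4 : Real.log x = Real.log y + Real.log (x / y) := by
    rw [Real.log_div hx0.ne' hy0.ne']
    ring
  have h5 : y ^ (-ε) * x ^ ε = (x / y) ^ ε := by
    rw [Real.div_rpow hx0.le hy0.le, Real.rpow_neg hy0.le]
    ring
  have h6 := Real.log_nonneg hy
  have h7 : 0 ≤ 1 / ε := by positivity
  rw [mul_assoc, h5, h4]
  have h8 : Real.log y * 1 ≤ Real.log y * (x / y) ^ ε := by gcongr
  have h9 : 0 ≤ 1 / ε * (Real.log y * (x / y) ^ ε) := by positivity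
  nlinarith

theorem exists_abs_meanSq_one_sub_zeta₂Sq_le {σ₂ : ℝ} {v : ℝ → ℝ} (h2 : 1 / 2 < σ₂)
    (hreg : ∀ t : ℝ, 2 ≤ t → ((1 : ℂ), (σ₂ : ℂ) + (t : ℂ) * Complex.I) ∈ regularSet)
    (hv : ∀ K : ℕ, ∃ C : ℝ, 0 ≤ C ∧ ∀ T : ℝ, 2 ≤ T →
      ∑ n ∈ Finset.Ico 1 (cutoff K T), (n : ℝ) ^ (-σ₂) ≤ C * v T) :
    ∃ C : ℝ, ∀ T : ℝ, 2 ≤ T →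
      |meanSq 1 σ₂ T - zeta₂Sq 1 (2 * σ₂) * T| ≤ C * (Real.log T * v T) ^ 2 := by
  obtain ⟨C, K, hC0, hC⟩ := exists_abs_meanSq_one_sub_sum_le (by linarith) hreg
  obtain ⟨B, hB0, hB⟩ := hv K
  obtain ⟨A, hA0, hA⟩ := exists_log_cutoff_add_one_le K
  -- Small enough that the exponent 2(σ₂ - ε) still exceeds 1; afterwards N^{-2ε}N^{-q} =
  -- N^{-(2σ₂-1)} no longer involves ε.
  set ε : ℝ := (σ₂ - 1 / 2) / 2 with hε
  have hε0 : 0 < ε := by rw [hε]; linarith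
  set q : ℝ := 2 * (σ₂ - ε) - 1 with hq
  have hq0 : 0 < q := by rw [hq, hε]; linarith
  refine ⟨(C + (1 / ε + 1) ^ 2 * A ^ 2 * (1 + 1 / q) * 4) * B ^ 2, fun T hT => ?_⟩
  set N : ℕ := cutoff K T with hN
  set V : ℝ := ∑ n ∈ Finset.Ico 1 N, (n : ℝ) ^ (-σ₂) with hV
  have hV0 : 0 ≤ V := Finset.sum_nonneg fun _ _ => by positivity
  have h1 := hC T hT
  have hN1 : 1 ≤ N := (two_le_cutoff K hT).trans' one_le_two
  have hN1' : (1 : ℝ) ≤ N := by exact_mod_cast hN1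
  have hN0 : (0 : ℝ) < N := by linarith
  have hlogN := Real.log_nonneg hN1'
  have hsum : Summable (zeta₂SqTerm 1 (2 * σ₂)) :=
    summable_zeta₂SqTerm_of_lt h2 (by simp; linarith)
  have h3 := abs_sum_zeta₂SqTerm_sub_le hq0 hN1 hsum fun n hn => by
    have hn1 : 1 ≤ n := hN1.trans hn
    have hn0 : (0 : ℝ) < n := by exact_mod_cast hn1
    refine zeta₂SqTerm_le (α := σ₂ - ε)
      (M := (1 / ε + 1) * (Real.log N + 1) * (N : ℝ) ^ (-ε)) hn1 ?_
    rw [norm_weightedSum _ _ hn1, show -(σ₂ - ε) = ε + -σ₂ by ring, Real.rpow_add hn0, ← mul_assoc]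
    gcongr
    exact (norm_powerSum_one_le hn1).trans
      (log_add_one_le_mul_div_rpow hε0 hN1' (by exact_mod_cast hn))
  have hT0 : 0 ≤ T := by linarith
  have h4 : T * |∑ n ∈ Finset.Ico 1 N, zeta₂SqTerm 1 (2 * σ₂) n - zeta₂Sq 1 (2 * σ₂)| ≤
      (1 / ε + 1) ^ 2 * (A * Real.log T) ^ 2 * (1 + 1 / q) * (4 * V ^ 2) := by
    calc _ ≤ T * (((1 / ε + 1) * (Real.log N + 1) * (N : ℝ) ^ (-ε)) ^ 2 *
          ((1 + 1 / q) * (N : ℝ) ^ (-q))) := by gcongr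
      _ = (1 / ε + 1) ^ 2 * (Real.log N + 1) ^ 2 * (1 + 1 / q) *
          (T * ((N : ℝ) ^ (-ε * (2 : ℕ)) * (N : ℝ) ^ (-q))) := by
        rw [Real.rpow_mul_natCast hN0.le]
        ring
      _ = (1 / ε + 1) ^ 2 * (Real.log N + 1) ^ 2 * (1 + 1 / q) *
          (T * (N : ℝ) ^ (-(2 * σ₂ - 1))) := by
        rw [← Real.rpow_add hN0]
        congr 3
        rw [hq]
        push_cast
        ring
      _ ≤ _ := by
        refine mul_le_mul ?_ (mul_cutoff_rpow_le (by linarith) K hT) (by positivity)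
          (by positivity)
        gcongr
        exact hA T hT
  have h5 : (Real.log T * V) ^ 2 ≤ (Real.log T * (B * v T)) ^ 2 := by
    have := half_le_log hT
    gcongr
    exact hB T hT
  have e : meanSq 1 σ₂ T - zeta₂Sq 1 (2 * σ₂) * T =
      (meanSq 1 σ₂ T - T * ∑ n ∈ Finset.Ico 1 N, zeta₂SqTerm 1 (2 * σ₂) n) +
      T * (∑ n ∈ Finset.Ico 1 N, zeta₂SqTerm 1 (2 * σ₂) n - zeta₂Sq 1 (2 * σ₂)) := by ring
  rw [e]
  refine (abs_add_le _ _).trans ?_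
  rw [abs_mul T, abs_of_nonneg hT0]
  calc _ ≤ C * (Real.log T * V) ^ 2 +
        (1 / ε + 1) ^ 2 * (A * Real.log T) ^ 2 * (1 + 1 / q) * (4 * V ^ 2) := add_le_add h1 h4
    _ = (C + (1 / ε + 1) ^ 2 * A ^ 2 * (1 + 1 / q) * 4) * (Real.log T * V) ^ 2 := by ring
    _ ≤ (C + (1 / ε + 1) ^ 2 * A ^ 2 * (1 + 1 / q) * 4) * (Real.log T * (B * v T)) ^ 2 := by gcongr
    _ = _ := by ring

/-! ### The boundary cases -/

/-- At α = 1/2 the error V² is O(T), and the cutoff is a bounded multiple of T, so its logarithm may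
be replaced by log T. -/
theorem exists_abs_meanSq_sub_mul_log_le {s₁ : ℂ} {σ₂ M κ D : ℝ} (h2 : 0 < σ₂)
    (h12 : 3 / 2 ≤ s₁.re + σ₂)
    (hreg : ∀ t : ℝ, 2 ≤ t → (s₁, (σ₂ : ℂ) + (t : ℂ) * Complex.I) ∈ regularSet) (hM0 : 0 ≤ M)
    (hM : ∀ n : ℕ, 1 ≤ n → ‖weightedSum s₁ σ₂ n‖ ≤ M * (n : ℝ) ^ (-(1 / 2 : ℝ)))
    (hD : ∀ N : ℕ, 1 ≤ N →
      |∑ n ∈ Finset.Ico 1 N, zeta₂SqTerm s₁ (2 * σ₂) n - κ * Real.log N| ≤ D) :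
    ∃ C : ℝ, ∀ T : ℝ, 2 ≤ T → |meanSq s₁ σ₂ T - κ * (T * Real.log T)| ≤ C * T := by
  obtain ⟨C, K, hC0, hC⟩ := exists_abs_meanSq_sub_sum_le h2 (by linarith) hreg (by norm_num)
    (by linarith) hM0 hM
  obtain ⟨B, hB0, hB⟩ := exists_sum_cutoff_le_of_lt_one (α := 1 / 2) (by norm_num) K
  refine ⟨C * B ^ 2 + D + |κ| * Real.log (4 + 2 * K), fun T hT => ?_⟩
  have hT0 : 0 ≤ T := by linarith
  set N : ℕ := cutoff K T with hN
  have h1 := hC T hT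
  have h3 := hD N ((two_le_cutoff K hT).trans' one_le_two)
  have h4 : |Real.log N - Real.log T| ≤ Real.log (4 + 2 * K) := by
    rw [abs_of_nonneg (sub_nonneg.2 (log_le_log_cutoff K hT))]
    linarith [log_cutoff_le K hT]
  have h5 : (∑ n ∈ Finset.Ico 1 N, (n : ℝ) ^ (-(1 / 2 : ℝ))) ^ 2 ≤ B ^ 2 * T := by
    calc _ ≤ (B * T ^ (1 - 1 / 2 : ℝ)) ^ 2 := by
          have : 0 ≤ ∑ n ∈ Finset.Ico 1 N, (n : ℝ) ^ (-(1 / 2 : ℝ)) :=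
            Finset.sum_nonneg fun _ _ => by positivity
          gcongr
          exact hB T hT
      _ = _ := by
          rw [mul_pow, ← Real.rpow_mul_natCast hT0]
          norm_num
  have e : meanSq s₁ σ₂ T - κ * (T * Real.log T) =
      (meanSq s₁ σ₂ T - T * ∑ n ∈ Finset.Ico 1 N, zeta₂SqTerm s₁ (2 * σ₂) n) +
      T * (∑ n ∈ Finset.Ico 1 N, zeta₂SqTerm s₁ (2 * σ₂) n - κ * Real.log N) +
      T * (κ * (Real.log N - Real.log T)) := by ring
  rw [e]
  refine (abs_add_three _ _ _).trans ?_
  rw [abs_mul T, abs_mul T, abs_mul κ, abs_of_nonneg hT0]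
  calc _ ≤ C * (B ^ 2 * T) + T * D + T * (|κ| * Real.log (4 + 2 * K)) := by
        gcongr
        exact h1.trans (by gcongr)
    _ = _ := by ring

theorem abs_sq_norm_sub_sq_norm_le (a p : ℂ) :
    |‖a‖ ^ 2 - ‖p‖ ^ 2| ≤ ‖a - p‖ * (‖a‖ + ‖p‖) := by
  rw [sq_sub_sq, abs_mul, mul_comm, abs_of_nonneg (by positivity : 0 ≤ ‖a‖ + ‖p‖)]
  gcongr
  exact abs_norm_sub_norm_le a p

/-- Asymptotics of a sum from asymptotics of its terms. -/
theorem abs_sum_sub_mul_log_le {f r b : ℕ → ℝ} {κ B R : ℝ}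
    (hf : ∀ n : ℕ, 1 ≤ n → |f n - κ * (1 / n) - r n| ≤ b n)
    (hb : ∀ N : ℕ, 1 ≤ N → ∑ n ∈ Finset.Ico 1 N, b n ≤ B)
    (hr : ∀ N : ℕ, 1 ≤ N → |∑ n ∈ Finset.Ico 1 N, r n| ≤ R) {N : ℕ} (hN : 1 ≤ N) :
    |∑ n ∈ Finset.Ico 1 N, f n - κ * Real.log N| ≤ B + R + |κ| := by
  have h1 : |∑ n ∈ Finset.Ico 1 N, (f n - κ * (1 / n) - r n)| ≤ B := by
    refine (Finset.abs_sum_le_sum_abs _ _).trans (le_trans (Finset.sum_le_sum fun n hn => ?_)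
      (hb N hN))
    exact hf n (Finset.mem_Ico.1 hn).1
  obtain ⟨h2, h3⟩ := log_le_sum_inv_Ico hN
  have hN0 : 0 ≤ 1 / (N : ℝ) := by positivity
  have h4 : |κ * (∑ n ∈ Finset.Ico 1 N, 1 / (n : ℝ) - Real.log N)| ≤ |κ| := by
    rw [abs_mul]
    refine mul_le_of_le_one_right (abs_nonneg κ) (abs_le.2 ⟨?_, ?_⟩) <;> linarith
  have e : ∑ n ∈ Finset.Ico 1 N, f n - κ * Real.log N =
      ∑ n ∈ Finset.Ico 1 N, (f n - κ * (1 / n) - r n) + ∑ n ∈ Finset.Ico 1 N, r n +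
        κ * (∑ n ∈ Finset.Ico 1 N, 1 / (n : ℝ) - Real.log N) := by
    rw [Finset.sum_sub_distrib, Finset.sum_sub_distrib, ← Finset.mul_sum]
    ring
  rw [e]
  exact (abs_add_three _ _ _).trans (add_le_add (add_le_add h1 (hr N hN)) h4)

end EulerDoubleZeta
namespace EulerDoubleZeta
open scoped ComplexConjugate

/-! ### Asymptotics of the sum of squares in the boundary cases -/

theorem zeta₂SqTerm_one (s₁ : ℂ) (n : ℕ) :
    zeta₂SqTerm s₁ (2 * (1 / 2)) n = ‖powerSum s₁ n‖ ^ 2 * (1 / n) := by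
  rw [zeta₂SqTerm, ← powerSum, mul_one_div_cancel two_ne_zero, Real.rpow_one]

theorem exists_norm_powerSum_sub_zeta_le {s₁ : ℂ} (h1 : 1 < s₁.re) :
    ∃ C : ℝ, 0 ≤ C ∧ ∀ n : ℕ, 1 ≤ n →
      ‖powerSum s₁ n - riemannZeta s₁‖ ≤ C * (n : ℝ) ^ (1 - s₁.re) := by
  have hs1 : s₁ ≠ 1 := by rintro rfl; simp at h1
  obtain ⟨C, hC0, hC⟩ := exists_norm_zetaCorr_le ‖s₁‖ (by linarith : 0 < s₁.re)
  refine ⟨1 / ‖s₁ - 1‖ + C, by positivity, fun n hn => ?_⟩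
  have hn1 : (1 : ℝ) ≤ n := by exact_mod_cast hn
  rw [powerSum_eq (by linarith) hs1 hn, zetaTail_one_eq_riemannZeta h1.le hs1, sub_sub_cancel_left,
    norm_neg, add_mul]
  refine (norm_add_le _ _).trans (add_le_add (le_of_eq ?_) ?_)
  · rw [norm_div, norm_natCast_cpow hn, Complex.sub_re, Complex.one_re]
    ring
  · refine (hC n s₁ hn le_rfl le_rfl).trans ?_
    gcongr
    linarith

theorem exists_abs_sum_zeta₂SqTerm_sub_of_one_lt {s₁ : ℂ} (h1 : 1 < s₁.re) :
    ∃ D : ℝ, ∀ N : ℕ, 1 ≤ N →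
      |∑ n ∈ Finset.Ico 1 N, zeta₂SqTerm s₁ (2 * (1 / 2)) n -
        ‖riemannZeta s₁‖ ^ 2 * Real.log N| ≤ D := by
  obtain ⟨C, hC0, hC⟩ := exists_norm_powerSum_sub_zeta_le h1
  set B : ℝ := 1 + 1 / (s₁.re - 1) + ‖riemannZeta s₁‖ with hB
  have hs0 : 0 < s₁.re - 1 := by linarith
  refine ⟨C * B * (1 + 1 / (s₁.re - 1)) + 0 + |‖riemannZeta s₁‖ ^ 2|, fun N hN =>
    abs_sum_sub_mul_log_le (r := fun _ => 0) (b := fun n => C * B * (n : ℝ) ^ (-s₁.re))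
      (fun n hn => ?_) (fun N _ => ?_) (fun N _ => by simp) hN⟩
  · have hn0 : (0 : ℝ) < n := by exact_mod_cast hn
    rw [zeta₂SqTerm_one, sub_zero, ← sub_mul, abs_mul, abs_of_pos (by positivity : 0 < 1 / (n : ℝ))]
    have h2 : ‖powerSum s₁ n‖ ≤ 1 + 1 / (s₁.re - 1) :=
      (norm_powerSum_le s₁ n).trans (sum_rpow_Ico_le_of_one_lt h1 n)
    calc _ ≤ C * (n : ℝ) ^ (1 - s₁.re) * B * (1 / n) := by
          gcongr
          refine (abs_sq_norm_sub_sq_norm_le _ _).trans ?_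
          gcongr
          · exact hC n hn
          · linarith
      _ = _ := by
          rw [show 1 - s₁.re = -s₁.re + 1 by ring, Real.rpow_add_one hn0.ne']
          field_simp
  · rw [← Finset.mul_sum]
    gcongr
    exact sum_rpow_Ico_le_of_one_lt h1 N

/-- A finite identity that needs no condition on Re s, unlike the formula through `zetaTail`; the
case σ₁ < 1 includes σ₁ ≤ 0. -/
theorem powerSum_eq_sub_add_sum_zetaStep {s : ℂ} (hs : s ≠ 1) {n : ℕ} (hn : 1 ≤ n) :
    powerSum s n =
      -((n : ℂ) ^ (1 - s) / (s - 1)) + (1 / (s - 1) + ∑ m ∈ Finset.Ico 1 n, zetaStep m s) := by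
  induction n, hn using Nat.le_induction with
  | base => simp [powerSum]
  | succ n hn ih =>
    rw [powerSum_succ s hn, ih, Finset.sum_Ico_succ_top hn, zetaStep_eq hn hs]
    ring

theorem exists_norm_powerSum_add_le {s : ℂ} (hs : s.re < 1) :
    ∃ δ C : ℝ, 0 < δ ∧ 0 ≤ C ∧ ∀ n : ℕ, 1 ≤ n →
      ‖powerSum s n - -((n : ℂ) ^ (1 - s) / (s - 1))‖ ≤ C * (n : ℝ) ^ (1 - s.re - δ) := by
  have hs1 : s ≠ 1 := by rintro rfl; simp at hs
  obtain ⟨A, hA0, hA⟩ := exists_norm_zetaStep_le ‖s‖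
  -- δ ≤ 1 weakens the decay m^{-σ-1} to m^{-σ-δ}; σ + δ < 1 makes the resulting sums, and the
  -- constant 1/(s-1), O(n^{1-σ-δ}).
  set δ : ℝ := min 1 ((1 - s.re) / 2) with hδ
  have hδ0 : 0 < δ := lt_min one_pos (by linarith)
  have hδ1 : δ ≤ 1 := min_le_left _ _
  have hδ2 : δ ≤ (1 - s.re) / 2 := min_le_right _ _
  have h0 : 0 < 1 - (s.re + δ) := by linarith
  refine ⟨δ, 1 / ‖s - 1‖ + A * (2 / (1 - (s.re + δ))), hδ0, by positivity, fun n hn => ?_⟩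
  have hn1 : (1 : ℝ) ≤ n := by exact_mod_cast hn
  rw [powerSum_eq_sub_add_sum_zetaStep hs1 hn, add_sub_cancel_left, add_mul]
  refine (norm_add_le _ _).trans (add_le_add ?_ ?_)
  · rw [norm_div, norm_one]
    exact le_mul_of_one_le_right (by positivity) (Real.one_le_rpow hn1 (by linarith))
  · calc _ ≤ ∑ m ∈ Finset.Ico 1 n, A * (m : ℝ) ^ (-(s.re + δ)) := by
          refine norm_sum_le_of_le _ fun m hm => ?_
          have hm1 : (1 : ℝ) ≤ m := by exact_mod_cast (Finset.mem_Ico.1 hm).1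
          refine (hA m s (Finset.mem_Ico.1 hm).1 le_rfl).trans ?_
          gcongr
          linarith
      _ = A * ∑ m ∈ Finset.Ico 1 n, (m : ℝ) ^ (-(s.re + δ)) := (Finset.mul_sum _ _ _).symm
      _ ≤ A * (2 / (1 - (s.re + δ)) * (n : ℝ) ^ (1 - (s.re + δ))) := by
          gcongr
          exact sum_rpow_Ico_le_of_lt_one (by linarith) hn
      _ = _ := by rw [show 1 - (s.re + δ) = 1 - s.re - δ by ring]; ring

/-- The coefficients have modulus n^{1-σ₁}/|s₁-1| up to a power saving, and σ₁ + σ₂ = 3/2 turns the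
weighted squares into |s₁-1|^{-2}/n plus a summable error. -/
theorem exists_abs_sum_zeta₂SqTerm_sub_of_lt_one {s₁ : ℂ} {σ₂ : ℝ} (h1 : s₁.re < 1)
    (h12 : s₁.re + σ₂ = 3 / 2) :
    ∃ D : ℝ, ∀ N : ℕ, 1 ≤ N →
      |∑ n ∈ Finset.Ico 1 N, zeta₂SqTerm s₁ (2 * σ₂) n - (‖s₁ - 1‖ ^ 2)⁻¹ * Real.log N| ≤ D := by
  obtain ⟨δ, C, hδ, hC0, hC⟩ := exists_norm_powerSum_add_le h1
  have h0 : 0 < 1 - s₁.re := by linarith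
  set B : ℝ := 2 / (1 - s₁.re) + 1 / ‖s₁ - 1‖ with hB
  refine ⟨C * B * (1 + 1 / (1 + δ - 1)) + 0 + |(‖s₁ - 1‖ ^ 2)⁻¹|, fun N hN =>
    abs_sum_sub_mul_log_le (r := fun _ => 0) (b := fun n => C * B * (n : ℝ) ^ (-(1 + δ)))
      (fun n hn => ?_) (fun N _ => ?_) (fun N _ => by simp) hN⟩
  · have hn0 : (0 : ℝ) < n := by exact_mod_cast hn
    set p : ℂ := -((n : ℂ) ^ (1 - s₁) / (s₁ - 1)) with hp
    have hpn : ‖p‖ = 1 / ‖s₁ - 1‖ * (n : ℝ) ^ (1 - s₁.re) := by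
      rw [hp, norm_neg, norm_div, norm_natCast_cpow hn, Complex.sub_re, Complex.one_re]
      ring
    have han : ‖powerSum s₁ n‖ ≤ 2 / (1 - s₁.re) * (n : ℝ) ^ (1 - s₁.re) :=
      (norm_powerSum_le s₁ n).trans (sum_rpow_Ico_le_of_lt_one h1 hn)
    have hmain : (‖s₁ - 1‖ ^ 2)⁻¹ * (1 / (n : ℝ)) = ‖p‖ ^ 2 * (1 / (n : ℝ) ^ (2 * σ₂)) := by
      rw [hpn, mul_pow, ← Real.rpow_mul_natCast hn0.le, one_div ((n : ℝ) ^ (2 * σ₂)),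
        ← Real.rpow_neg hn0.le, mul_assoc, ← Real.rpow_add hn0,
        show (1 - s₁.re) * (2 : ℕ) + -(2 * σ₂) = -1 by push_cast; linarith, Real.rpow_neg_one]
      simp
    rw [hmain, zeta₂SqTerm, ← powerSum, sub_zero, ← sub_mul, abs_mul,
      abs_of_pos (by positivity : 0 < 1 / (n : ℝ) ^ (2 * σ₂))]
    calc _ ≤ C * (n : ℝ) ^ (1 - s₁.re - δ) * (B * (n : ℝ) ^ (1 - s₁.re)) *
          (1 / (n : ℝ) ^ (2 * σ₂)) := by
          gcongr
          refine (abs_sq_norm_sub_sq_norm_le _ _).trans ?_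
          gcongr
          · exact hC n hn
          · rw [hpn, hB, add_mul]
            linarith
      _ = C * B * ((n : ℝ) ^ (1 - s₁.re - δ) * (n : ℝ) ^ (1 - s₁.re) * (n : ℝ) ^ (-(2 * σ₂))) := by
          rw [one_div, ← Real.rpow_neg hn0.le]
          ring
      _ = _ := by
          rw [← Real.rpow_add hn0, ← Real.rpow_add hn0]
          congr 2
          linarith
  · rw [← Finset.mul_sum]
    gcongr
    exact sum_rpow_Ico_le_of_one_lt (by linarith) N

/-- Here aₙ = ζ(s₁) - n^{1-s₁}/(s₁-1) + O(1/n), with two terms of constant modulus. Their squares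
give the two constants. The cross term divided by n is a multiple of Re(c n^{-s₁}), whose sums are
bounded because the partial sums of n^{-s₁} are. -/
theorem exists_abs_sum_zeta₂SqTerm_sub_of_re_eq_one {s₁ : ℂ} (h1 : s₁.re = 1) (hs1 : s₁ ≠ 1) :
    ∃ D : ℝ, ∀ N : ℕ, 1 ≤ N →
      |∑ n ∈ Finset.Ico 1 N, zeta₂SqTerm s₁ (2 * (1 / 2)) n -
        ((‖s₁ - 1‖ ^ 2)⁻¹ + ‖riemannZeta s₁‖ ^ 2) * Real.log N| ≤ D := by
  obtain ⟨A, hA0, hA⟩ := exists_norm_powerSum_le_of_re_eq_one h1 hs1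
  obtain ⟨C, hC0, hC⟩ := exists_norm_zetaCorr_le ‖s₁‖ one_pos
  set z : ℂ := riemannZeta s₁ with hz
  set B : ℝ := A + (‖z‖ + 1 / ‖s₁ - 1‖) with hB
  set κ : ℝ := (‖s₁ - 1‖ ^ 2)⁻¹ + ‖z‖ ^ 2 with hκ
  refine ⟨C * B * (1 + 1 / (2 - 1)) + 2 * (A * ‖conj z / (s₁ - 1)‖) + |κ|, fun N hN =>
    abs_sum_sub_mul_log_le
      (r := fun n => -2 * (1 / (n : ℂ) ^ s₁ * (conj z / (s₁ - 1))).re)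
      (b := fun n => C * B * (n : ℝ) ^ (-2 : ℝ))
      (fun n hn => ?_) (fun N _ => ?_) (fun N hN => ?_) hN⟩
  · have hn0 : (0 : ℝ) < n := by exact_mod_cast hn
    have hn0' : (n : ℂ) ≠ 0 := by exact_mod_cast hn0.ne'
    set p : ℂ := (n : ℂ) ^ (1 - s₁) / (s₁ - 1) with hp
    have hpn : ‖p‖ = 1 / ‖s₁ - 1‖ := by
      rw [hp, norm_div, norm_natCast_cpow hn]
      simp [h1]
    have happ : ‖powerSum s₁ n - (z - p)‖ ≤ C * (n : ℝ) ^ (-1 : ℝ) := by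
      rw [powerSum_eq (by linarith) hs1 hn, zetaTail_one_eq_riemannZeta h1.ge hs1, zetaTail,
        show riemannZeta s₁ - ((n : ℂ) ^ (1 - s₁) / (s₁ - 1) + zetaCorr n s₁) - (z - p) =
          -zetaCorr n s₁ by rw [hz, hp]; ring, norm_neg, ← h1]
      exact hC n s₁ hn le_rfl h1.ge
    have hq : ‖z - p‖ ≤ ‖z‖ + 1 / ‖s₁ - 1‖ := hpn ▸ norm_sub_le z p
    have hsq : ‖z - p‖ ^ 2 = κ - 2 * (p * conj z).re := by
      rw [norm_sub_rev, ← Complex.normSq_eq_norm_sq, Complex.normSq_sub, Complex.normSq_eq_norm_sq,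
        Complex.normSq_eq_norm_sq, hpn, hκ]
      ring
    have hr : (1 / (n : ℂ) ^ s₁ * (conj z / (s₁ - 1))).re = (p * conj z).re * (1 / n) := by
      have e : 1 / (n : ℂ) ^ s₁ * (conj z / (s₁ - 1)) = ((1 / n : ℝ) : ℂ) * (p * conj z) := by
        rw [hp, Complex.cpow_sub _ _ hn0', Complex.cpow_one]
        push_cast
        field_simp
      rw [e, Complex.re_ofReal_mul]
      ring
    have e : zeta₂SqTerm s₁ (2 * (1 / 2)) n - κ * (1 / n) -
        -2 * (1 / (n : ℂ) ^ s₁ * (conj z / (s₁ - 1))).re =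
        (‖powerSum s₁ n‖ ^ 2 - ‖z - p‖ ^ 2) * (1 / n) := by
      rw [zeta₂SqTerm_one, hr, hsq]
      ring
    rw [e, abs_mul, abs_of_pos (by positivity : 0 < 1 / (n : ℝ))]
    calc _ ≤ C * (n : ℝ) ^ (-1 : ℝ) * B * (1 / n) := by
          gcongr
          refine (abs_sq_norm_sub_sq_norm_le _ _).trans ?_
          gcongr
          exact add_le_add (hA n hn) hq
      _ = _ := by
          rw [show (-2 : ℝ) = -1 - 1 by norm_num, Real.rpow_sub_one hn0.ne']
          ring
  · rw [← Finset.mul_sum]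
    gcongr
    exact sum_rpow_Ico_le_of_one_lt one_lt_two N
  · rw [← Finset.mul_sum, ← Complex.re_sum, ← Finset.sum_mul, ← powerSum, abs_mul, abs_neg, abs_two]
    gcongr
    refine (Complex.abs_re_le_norm _).trans ?_
    rw [norm_mul]
    gcongr
    exact hA N hN

/-- A discrete form of (log³/3)' = log²/x. The error is written as a multiple of 1/n - 1/(n+1), with
A fixed, so that it telescopes too. -/
theorem abs_log_sq_div_sub_le {n : ℕ} (hn : 1 ≤ n) {A : ℝ} (hA : Real.log n ≤ A) :
    |Real.log n ^ 2 * (1 / n) - (Real.log (n + 1 : ℕ) ^ 3 - Real.log n ^ 3) / 3| ≤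
      2 * (A + 1) ^ 2 * (1 / n - 1 / (n + 1 : ℕ)) := by
  have hn0 : (0 : ℝ) < n := by exact_mod_cast hn
  have hn1 : (1 : ℝ) ≤ n := by exact_mod_cast hn
  set x : ℝ := Real.log n with hx
  have hx0 : 0 ≤ x := Real.log_nonneg hn1
  set L : ℝ := logStep n with hL
  have hL0 : 0 ≤ L := logStep_nonneg hn
  have hL1 : L ≤ 1 / n := logStep_le_inv hn
  have hL2 : 1 / ((n : ℝ) + 1) ≤ L := inv_succ_le_logStep hn
  have e : Real.log (n + 1 : ℕ) = x + L := by
    rw [hL, logStep, hx]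
    push_cast
    ring
  set d : ℝ := 1 / n - 1 / (n + 1 : ℕ) with hd
  have hd' : d = 1 / ((n : ℝ) * (n + 1)) := by
    rw [hd]
    push_cast
    field_simp
    ring
  have hd0 : 0 ≤ d := by rw [hd']; positivity
  have hLd : 1 / (n : ℝ) - L ≤ d := by
    rw [hd]
    push_cast
    linarith
  have hLL : L ^ 2 ≤ 2 * d := by
    calc L ^ 2 ≤ (1 / (n : ℝ)) ^ 2 := by gcongr
      _ = 2 * (1 / ((n : ℝ) * (n + n))) := by field_simp; ring
      _ ≤ 2 * d := by rw [hd']; gcongr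
  have hLle : L ≤ 1 := hL1.trans (div_le_one_of_le₀ hn1 hn0.le)
  have hA2 : x ^ 2 ≤ (A + 1) ^ 2 := by gcongr; linarith
  have hA1 : x + 1 ≤ (A + 1) ^ 2 := by nlinarith
  have e2 : x ^ 2 * (1 / n) - ((x + L) ^ 3 - x ^ 3) / 3 =
      x ^ 2 * (1 / n - L) - L ^ 2 * (x + L / 3) := by ring
  have b1 : x ^ 2 * (1 / n - L) ≤ (A + 1) ^ 2 * d := by gcongr
  have b2 : L ^ 2 * (x + L / 3) ≤ 2 * d * (A + 1) ^ 2 := by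
    refine mul_le_mul hLL (by linarith) (by positivity) (by positivity)
  have b3 : 0 ≤ x ^ 2 * (1 / n - L) := mul_nonneg (sq_nonneg x) (by linarith)
  have b4 : 0 ≤ L ^ 2 * (x + L / 3) := by positivity
  have b5 : 0 ≤ (A + 1) ^ 2 * d := by positivity
  rw [e, e2, abs_le]
  constructor <;> linarith

theorem abs_sum_log_sq_div_sub_le {N : ℕ} (hN : 1 ≤ N) :
    |∑ n ∈ Finset.Ico 1 N, Real.log n ^ 2 * (1 / n) - Real.log N ^ 3 / 3| ≤
      2 * (Real.log N + 1) ^ 2 := by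
  set A : ℝ := Real.log N with hA
  have key : ∀ k : ℕ, 1 ≤ k → k ≤ N →
      |∑ n ∈ Finset.Ico 1 k, Real.log n ^ 2 * (1 / n) - Real.log k ^ 3 / 3| ≤
        2 * (A + 1) ^ 2 * (1 - 1 / k) := by
    intro k hk
    induction k, hk using Nat.le_induction with
    | base => simp
    | succ k hk ih =>
      intro hkN
      have hk0 : (0 : ℝ) < k := by exact_mod_cast hk
      have h1 := ih (by omega)
      have h2 := abs_log_sq_div_sub_le hk (A := A)
        (Real.log_le_log hk0 (by exact_mod_cast (by omega : k ≤ N)))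
      rw [Finset.sum_Ico_succ_top hk]
      rw [abs_le] at h1 h2 ⊢
      constructor <;> linarith [h1.1, h1.2, h2.1, h2.2]
  refine (key N hN le_rfl).trans (mul_le_of_le_one_right (by positivity) ?_)
  have : 0 ≤ 1 / (N : ℝ) := by positivity
  linarith

/-- The harmonic sums lie between log n and log n + 1, so replacing them by log n costs O((log N)²)
in total. -/
theorem abs_sum_zeta₂SqTerm_one_sub_le {N : ℕ} (hN : 1 ≤ N) :
    |∑ n ∈ Finset.Ico 1 N, zeta₂SqTerm 1 (2 * (1 / 2)) n - Real.log N ^ 3 / 3| ≤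
      4 * (Real.log N + 1) ^ 2 := by
  have hN1 : (1 : ℝ) ≤ N := by exact_mod_cast hN
  have hlog := Real.log_nonneg hN1
  have h1 : |∑ n ∈ Finset.Ico 1 N, zeta₂SqTerm 1 (2 * (1 / 2)) n -
      ∑ n ∈ Finset.Ico 1 N, Real.log n ^ 2 * (1 / n)| ≤ 2 * (Real.log N + 1) ^ 2 := by
    rw [← Finset.sum_sub_distrib]
    calc _ ≤ ∑ n ∈ Finset.Ico 1 N, 2 * (Real.log N + 1) * (1 / (n : ℝ)) := by
          refine (Finset.abs_sum_le_sum_abs _ _).trans (Finset.sum_le_sum fun n hn => ?_)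
          obtain ⟨hn1, hnN⟩ := Finset.mem_Ico.1 hn
          have hn0 : (0 : ℝ) < n := by exact_mod_cast hn1
          have hl0 : 0 ≤ Real.log n := Real.log_nonneg (by exact_mod_cast hn1)
          have hlN : Real.log n ≤ Real.log N :=
            Real.log_le_log hn0 (by exact_mod_cast hnN.le)
          rw [zeta₂SqTerm_one, ← sub_mul, abs_mul, abs_of_pos (by positivity : 0 < 1 / (n : ℝ))]
          gcongr
          have h2 := norm_powerSum_one_le hn1
          have h3 : Real.log n ≤ ‖powerSum 1 n‖ := by
            rw [powerSum_one_eq, Complex.norm_real]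
            exact (log_le_sum_inv_Ico hn1).1.trans (le_abs_self _)
          rw [abs_le]
          constructor <;> nlinarith
      _ = 2 * (Real.log N + 1) * ∑ n ∈ Finset.Ico 1 N, 1 / (n : ℝ) := (Finset.mul_sum _ _ _).symm
      _ ≤ 2 * (Real.log N + 1) * (Real.log N + 1) := by gcongr; exact sum_inv_Ico_le hN
      _ = _ := by ring
  have h2 := abs_sum_log_sq_div_sub_le hN
  rw [abs_le] at h1 h2 ⊢
  constructor <;> linarith [h1.1, h1.2, h2.1, h2.2]

theorem exists_abs_meanSq_one_half_sub_le
    (hreg : ∀ t : ℝ, 2 ≤ t → ((1 : ℂ), ((1 / 2 : ℝ) : ℂ) + (t : ℂ) * Complex.I) ∈ regularSet) :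
    ∃ C : ℝ, ∀ T : ℝ, 2 ≤ T →
      |meanSq 1 (1 / 2) T - T * Real.log T ^ 3 / 3| ≤ C * (T * Real.log T ^ 2) := by
  obtain ⟨C, K, hC0, hC⟩ := exists_abs_meanSq_one_sub_sum_le (by norm_num) hreg
  obtain ⟨B, hB0, hB⟩ := exists_sum_cutoff_le_of_lt_one (α := 1 / 2) (by norm_num) K
  obtain ⟨A, hA0, hA⟩ := exists_log_cutoff_add_one_le K
  set c : ℝ := Real.log (4 + 2 * K) with hc
  have hc0 : 0 ≤ c := Real.log_nonneg (by linarith [(Nat.cast_nonneg K : (0 : ℝ) ≤ K)])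
  refine ⟨C * B ^ 2 + 4 * A ^ 2 + c * A ^ 2, fun T hT => ?_⟩
  have hT0 : 0 ≤ T := by linarith
  set N : ℕ := cutoff K T with hN
  have hlog := half_le_log hT
  have hlog2 := log_le_log_cutoff K hT
  have hlog3 := log_cutoff_le K hT
  have hlog4 := hA T hT
  have h1 := hC T hT
  have h3 := abs_sum_zeta₂SqTerm_one_sub_le ((two_le_cutoff K hT).trans' one_le_two)
  have h5 : (Real.log T * ∑ n ∈ Finset.Ico 1 N, (n : ℝ) ^ (-(1 / 2 : ℝ))) ^ 2 ≤
      B ^ 2 * (T * Real.log T ^ 2) := by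
    calc _ ≤ (Real.log T * (B * T ^ (1 - 1 / 2 : ℝ))) ^ 2 := by
          have : 0 ≤ ∑ n ∈ Finset.Ico 1 N, (n : ℝ) ^ (-(1 / 2 : ℝ)) :=
            Finset.sum_nonneg fun _ _ => by positivity
          gcongr
          exact hB T hT
      _ = _ := by
          rw [mul_pow, mul_pow, ← Real.rpow_mul_natCast hT0]
          norm_num
          ring
  have h6 : 4 * (Real.log N + 1) ^ 2 ≤ 4 * A ^ 2 * Real.log T ^ 2 := by
    have : (Real.log N + 1) ^ 2 ≤ (A * Real.log T) ^ 2 := by gcongr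
    linarith [mul_pow A (Real.log T) 2]
  have h7 : |(Real.log N ^ 3 - Real.log T ^ 3) / 3| ≤ c * A ^ 2 * Real.log T ^ 2 := by
    have e : Real.log N ^ 3 - Real.log T ^ 3 = (Real.log N - Real.log T) *
        (Real.log N ^ 2 + Real.log N * Real.log T + Real.log T ^ 2) := by ring
    have g1 : Real.log N ^ 2 ≤ (A * Real.log T) ^ 2 := by gcongr; linarith
    have g2 : Real.log T ^ 2 ≤ Real.log N ^ 2 := by gcongr
    have g3 : Real.log N * Real.log T ≤ Real.log N ^ 2 := by rw [sq]; gcongr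
    have g0 : 0 ≤ Real.log N * Real.log T := mul_nonneg (by linarith) (by linarith)
    rw [e, abs_of_nonneg (by
      have : 0 ≤ Real.log N - Real.log T := by linarith
      positivity)]
    have g4 : (Real.log N - Real.log T) *
        (Real.log N ^ 2 + Real.log N * Real.log T + Real.log T ^ 2) ≤
        c * (3 * (A * Real.log T) ^ 2) := by
      refine mul_le_mul (by linarith) (by linarith) (by positivity) hc0
    calc _ ≤ c * (3 * (A * Real.log T) ^ 2) / 3 := by gcongr
      _ = _ := by ring
  have e : meanSq 1 (1 / 2) T - T * Real.log T ^ 3 / 3 =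
      (meanSq 1 (1 / 2) T - T * ∑ n ∈ Finset.Ico 1 N, zeta₂SqTerm 1 (2 * (1 / 2)) n) +
      T * (∑ n ∈ Finset.Ico 1 N, zeta₂SqTerm 1 (2 * (1 / 2)) n - Real.log N ^ 3 / 3) +
      T * ((Real.log N ^ 3 - Real.log T ^ 3) / 3) := by ring
  rw [e]
  refine (abs_add_three _ _ _).trans ?_
  rw [abs_mul T, abs_mul T, abs_of_nonneg hT0]
  calc _ ≤ C * (B ^ 2 * (T * Real.log T ^ 2)) + T * (4 * A ^ 2 * Real.log T ^ 2) +
        T * (c * A ^ 2 * Real.log T ^ 2) := by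
        gcongr
        · exact h1.trans (by gcongr)
        · exact h3.trans h6
    _ = _ := by ring

/-! ### The main term is not linear -/

/-- A main term G dominating both T and the error would be o(G), impossible for an eventually
nonvanishing G. -/
theorem not_isLittleO_sub_mul {F G E : ℝ → ℝ} (hF : (fun T => F T - G T) =O[𝓟 (Set.Ici 2)] E)
    (hE : E =o[atTop] G) (hid : (fun T : ℝ => T) =o[atTop] G) (hG : ∀ᶠ T in atTop, G T ≠ 0)
    (C : ℝ) : ¬ (fun T => F T - C * T) =o[atTop] fun T : ℝ => T := by
  intro h
  have h1 : (fun T => F T - G T) =o[atTop] G :=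
    (hF.mono (le_principal_iff.2 (Ici_mem_atTop 2))).trans_isLittleO hE
  have h2 : (fun T : ℝ => C * T) =o[atTop] G := hid.const_mul_left C
  have h3 := ((h.trans hid).sub h1).add h2
  have h4 : G =o[atTop] G := h3.congr_left fun T => by ring
  exact isLittleO_irrefl hG.frequently h4

theorem isLittleO_mul_log_pow (j : ℕ) {k : ℕ} (hjk : j < k) :
    (fun T : ℝ => T * Real.log T ^ j) =o[atTop] fun T : ℝ => T * Real.log T ^ k :=
  (isBigO_refl _ _).mul_isLittleO
    ((isLittleO_pow_pow_atTop_of_lt hjk).comp_tendsto Real.tendsto_log_atTop)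

theorem eventually_mul_log_pow_ne_zero (k : ℕ) : ∀ᶠ T : ℝ in atTop, T * Real.log T ^ k ≠ 0 := by
  filter_upwards [eventually_ge_atTop 2] with T hT
  have := half_le_log hT
  positivity

end EulerDoubleZeta

namespace EulerDoubleZeta

/-! ### The mean value estimates -/

theorem isBigO_principal_Ici_of_abs_le {F g : ℝ → ℝ} (hg : ∀ T : ℝ, 2 ≤ T → 0 ≤ g T)
    (h : ∃ C : ℝ, ∀ T : ℝ, 2 ≤ T → |F T| ≤ C * g T) : F =O[𝓟 (Set.Ici 2)] g := by
  obtain ⟨C, hC⟩ := h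
  refine isBigO_principal.2 ⟨C, fun T hT => ?_⟩
  rw [Real.norm_eq_abs, Real.norm_of_nonneg (hg T hT)]
  exact hC T hT

theorem rpow_sq_eq {T : ℝ} (hT : 2 ≤ T) {a b : ℝ} (h : 2 * a = b) : (T ^ a) ^ 2 = T ^ b := by
  rw [← Real.rpow_natCast, ← Real.rpow_mul (by linarith), Nat.cast_ofNat, mul_comm, h]

variable {s₁ : ℂ} {σ₂ : ℝ}

/-- The exponent b becomes 2 - 2σ₂ or 4 - 2σ₁ - 2σ₂ according to which entry of the minimum is
smaller. -/
theorem isBigO_meanSq_sub_of_lt_one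
    (hreg : ∀ t : ℝ, 2 ≤ t → (s₁, (σ₂ : ℂ) + (t : ℂ) * Complex.I) ∈ regularSet) (hs1 : s₁ ≠ 1)
    (hα : 1 / 2 < min σ₂ (s₁.re + σ₂ - 1)) (hα1 : min σ₂ (s₁.re + σ₂ - 1) < 1) {b : ℝ}
    (hb : b = 2 - 2 * min σ₂ (s₁.re + σ₂ - 1)) :
    (fun T : ℝ => meanSq s₁ σ₂ T - zeta₂Sq s₁ (2 * σ₂) * T) =O[𝓟 (Set.Ici 2)]
      fun T : ℝ => T ^ b := by
  obtain ⟨M, hM0, hM⟩ := exists_norm_weightedSum_le σ₂ hs1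
  have h2 := hα.trans_le (min_le_left _ _)
  have h12 := hα.trans_le (min_le_right _ _)
  obtain ⟨C, hC⟩ := exists_abs_meanSq_sub_zeta₂Sq_le (by linarith) (by linarith) hreg hα
    (min_le_right _ _) hM0 hM (exists_sum_cutoff_le_of_lt_one hα1)
  refine isBigO_principal_Ici_of_abs_le (fun T hT => Real.rpow_nonneg (by linarith) _)
    ⟨C, fun T hT => ?_⟩
  rw [← rpow_sq_eq hT (a := 1 - min σ₂ (s₁.re + σ₂ - 1)) (by rw [hb]; ring)]
  exact hC T hT

theorem isBigO_meanSq_sub_of_eq_one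
    (hreg : ∀ t : ℝ, 2 ≤ t → (s₁, (σ₂ : ℂ) + (t : ℂ) * Complex.I) ∈ regularSet) (hs1 : s₁ ≠ 1)
    (hα : min σ₂ (s₁.re + σ₂ - 1) = 1) :
    (fun T : ℝ => meanSq s₁ σ₂ T - zeta₂Sq s₁ (2 * σ₂) * T) =O[𝓟 (Set.Ici 2)]
      fun T : ℝ => Real.log T ^ 2 := by
  obtain ⟨M, hM0, hM⟩ := exists_norm_weightedSum_le σ₂ hs1
  have h2 := hα.symm.le.trans (min_le_left _ _)
  have h12 := hα.symm.le.trans (min_le_right _ _)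
  rw [hα] at hM
  exact isBigO_principal_Ici_of_abs_le (fun T _ => sq_nonneg _)
    (exists_abs_meanSq_sub_zeta₂Sq_le (by linarith) (by linarith) hreg (by norm_num) h12 hM0 hM
      exists_sum_cutoff_le_of_eq_one)

theorem isBigO_meanSq_sub_of_one_lt
    (hreg : ∀ t : ℝ, 2 ≤ t → (s₁, (σ₂ : ℂ) + (t : ℂ) * Complex.I) ∈ regularSet)
    (h2 : 1 < σ₂) (h12 : 2 < s₁.re + σ₂) :
    (fun T : ℝ => meanSq s₁ σ₂ T - zeta₂Sq s₁ (2 * σ₂) * T) =O[𝓟 (Set.Ici 2)]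
      fun _ : ℝ => (1 : ℝ) := by
  obtain ⟨α, M, hα, hα1, hα', hM0, hM⟩ :=
    exists_weightedSum_bound (s₁ := s₁) (σ₂ := σ₂) (by linarith) (by linarith)
  refine isBigO_principal_Ici_of_abs_le (fun T _ => zero_le_one) ?_
  simpa using exists_abs_meanSq_sub_zeta₂Sq_le (v := fun _ => 1) (by linarith) (by linarith) hreg hα
    hα' hM0 hM (exists_sum_cutoff_le_of_one_lt (hα1 h2 h12))

theorem isBigO_meanSq_one_sub_of_lt_one
    (hreg : ∀ t : ℝ, 2 ≤ t → ((1 : ℂ), (σ₂ : ℂ) + (t : ℂ) * Complex.I) ∈ regularSet)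
    (h2 : 1 / 2 < σ₂) (h2' : σ₂ < 1) :
    (fun T : ℝ => meanSq 1 σ₂ T - zeta₂Sq 1 (2 * σ₂) * T) =O[𝓟 (Set.Ici 2)]
      fun T : ℝ => T ^ (2 - 2 * σ₂) * Real.log T ^ 2 := by
  obtain ⟨C, hC⟩ :=
    exists_abs_meanSq_one_sub_zeta₂Sq_le h2 hreg (exists_sum_cutoff_le_of_lt_one h2')
  refine isBigO_principal_Ici_of_abs_le
    (fun T hT => mul_nonneg (Real.rpow_nonneg (by linarith) _) (sq_nonneg _)) ⟨C, fun T hT => ?_⟩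
  rw [← rpow_sq_eq hT (a := 1 - σ₂) (by ring), ← mul_pow, mul_comm (T ^ _)]
  exact hC T hT

theorem isBigO_meanSq_one_one_sub
    (hreg : ∀ t : ℝ, 2 ≤ t → ((1 : ℂ), ((1 : ℝ) : ℂ) + (t : ℂ) * Complex.I) ∈ regularSet) :
    (fun T : ℝ => meanSq 1 1 T - zeta₂Sq 1 (2 * 1) * T) =O[𝓟 (Set.Ici 2)]
      fun T : ℝ => Real.log T ^ 4 := by
  obtain ⟨C, hC⟩ :=
    exists_abs_meanSq_one_sub_zeta₂Sq_le (by norm_num) hreg exists_sum_cutoff_le_of_eq_one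
  refine isBigO_principal_Ici_of_abs_le (fun T _ => by positivity) ⟨C, fun T hT => ?_⟩
  convert hC T hT using 2
  ring

theorem isBigO_meanSq_sub_mul_log {κ : ℝ}
    (hreg : ∀ t : ℝ, 2 ≤ t → (s₁, (σ₂ : ℂ) + (t : ℂ) * Complex.I) ∈ regularSet) (hs1 : s₁ ≠ 1)
    (hα : min σ₂ (s₁.re + σ₂ - 1) = 1 / 2)
    (hD : ∃ D : ℝ, ∀ N : ℕ, 1 ≤ N →
      |∑ n ∈ Finset.Ico 1 N, zeta₂SqTerm s₁ (2 * σ₂) n - κ * Real.log N| ≤ D) :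
    (fun T : ℝ => meanSq s₁ σ₂ T - κ * (T * Real.log T)) =O[𝓟 (Set.Ici 2)] fun T : ℝ => T := by
  obtain ⟨M, hM0, hM⟩ := exists_norm_weightedSum_le σ₂ hs1
  obtain ⟨D, hD⟩ := hD
  have h2 := hα.symm.le.trans (min_le_left _ _)
  have h12 := hα.symm.le.trans (min_le_right _ _)
  rw [hα] at hM
  exact isBigO_principal_Ici_of_abs_le (fun T hT => by linarith)
    (exists_abs_meanSq_sub_mul_log_le (by linarith) (by linarith) hreg hM0 hM hD)

theorem not_isLittleO_sub_mul_of_mul_log {F : ℝ → ℝ} {κ : ℝ} (hκ : κ ≠ 0)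
    (hF : (fun T => F T - κ * (T * Real.log T)) =O[𝓟 (Set.Ici 2)] fun T : ℝ => T) (C : ℝ) :
    ¬ (fun T => F T - C * T) =o[atTop] fun T : ℝ => T := by
  have h : (fun T : ℝ => T) =o[atTop] fun T : ℝ => κ * (T * Real.log T) := by
    simpa using (isLittleO_mul_log_pow 0 zero_lt_one).const_mul_right hκ
  refine not_isLittleO_sub_mul hF h h ?_ C
  filter_upwards [eventually_mul_log_pow_ne_zero 1] with T hT
  exact mul_ne_zero hκ (by simpa using hT)

theorem not_isLittleO_sub_mul_of_mul_log_cube {F : ℝ → ℝ}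
    (hF : (fun T => F T - T * Real.log T ^ 3 / 3) =O[𝓟 (Set.Ici 2)]
      fun T : ℝ => T * Real.log T ^ 2) (C : ℝ) :
    ¬ (fun T => F T - C * T) =o[atTop] fun T : ℝ => T := by
  have h (j : ℕ) (hj : j < 3) :
      (fun T : ℝ => T * Real.log T ^ j) =o[atTop] fun T : ℝ => T * Real.log T ^ 3 / 3 := by
    simpa only [div_eq_inv_mul] using
      (isLittleO_mul_log_pow j hj).const_mul_right (inv_ne_zero (three_ne_zero (α := ℝ)))
  refine not_isLittleO_sub_mul hF (h 2 (by norm_num)) (by simpa using h 0 (by norm_num)) ?_ C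
  filter_upwards [eventually_mul_log_pow_ne_zero 3] with T hT
  exact div_ne_zero hT three_ne_zero

end EulerDoubleZeta
-- Assembly of the cases
theorem theorem1p2 (s₁ : ℂ) (σ₂ : ℝ) :
    -- the series `ζ₂^{[2]}(s₁, 2σ₂)` converges
    (1 / 2 < σ₂ → 3 / 2 < s₁.re + σ₂ →
      Summable (EulerDoubleZeta.zeta₂SqTerm s₁ (2 * σ₂))) ∧
    -- assume that `(s₁, σ₂ + i t)`, `t ≥ 2`, meets no singularity
    ((∀ t : ℝ, 2 ≤ t →
        (s₁, (σ₂ : ℂ) + (t : ℂ) * Complex.I) ∈ EulerDoubleZeta.regularSet) →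
      -- the integral exists in all the cases below
      (1 / 2 ≤ σ₂ → 3 / 2 ≤ s₁.re + σ₂ → ∀ T : ℝ, 2 ≤ T →
        IntervalIntegrable
          (fun t : ℝ => ‖EulerDoubleZeta.zeta₂ s₁ ((σ₂ : ℂ) + (t : ℂ) * Complex.I)‖ ^ 2)
          MeasureTheory.volume 2 T) ∧
      (1 < σ₂ → 2 < s₁.re + σ₂ →
        (fun T : ℝ => EulerDoubleZeta.meanSq s₁ σ₂ T
            - EulerDoubleZeta.zeta₂Sq s₁ (2 * σ₂) * T)
          =O[𝓟 (Set.Ici 2)] fun _ : ℝ => (1 : ℝ)) ∧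
      (1 < s₁.re → 1 / 2 < σ₂ → σ₂ < 1 →
        (fun T : ℝ => EulerDoubleZeta.meanSq s₁ σ₂ T
            - EulerDoubleZeta.zeta₂Sq s₁ (2 * σ₂) * T)
          =O[𝓟 (Set.Ici 2)] fun T : ℝ => T ^ (2 - 2 * σ₂)) ∧
      (1 < s₁.re → σ₂ = 1 →
        (fun T : ℝ => EulerDoubleZeta.meanSq s₁ σ₂ T
            - EulerDoubleZeta.zeta₂Sq s₁ (2 * σ₂) * T)
          =O[𝓟 (Set.Ici 2)] fun T : ℝ => Real.log T ^ 2) ∧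
      (s₁.re ≤ 1 → s₁ ≠ 1 → 3 / 2 < s₁.re + σ₂ → s₁.re + σ₂ < 2 →
        (fun T : ℝ => EulerDoubleZeta.meanSq s₁ σ₂ T
            - EulerDoubleZeta.zeta₂Sq s₁ (2 * σ₂) * T)
          =O[𝓟 (Set.Ici 2)] fun T : ℝ => T ^ (4 - 2 * s₁.re - 2 * σ₂)) ∧
      (s₁.re ≤ 1 → s₁ ≠ 1 → s₁.re + σ₂ = 2 →
        (fun T : ℝ => EulerDoubleZeta.meanSq s₁ σ₂ T
            - EulerDoubleZeta.zeta₂Sq s₁ (2 * σ₂) * T)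
          =O[𝓟 (Set.Ici 2)] fun T : ℝ => Real.log T ^ 2) ∧
      (s₁ = 1 → 1 / 2 < σ₂ → σ₂ < 1 →
        (fun T : ℝ => EulerDoubleZeta.meanSq s₁ σ₂ T
            - EulerDoubleZeta.zeta₂Sq s₁ (2 * σ₂) * T)
          =O[𝓟 (Set.Ici 2)] fun T : ℝ => T ^ (2 - 2 * σ₂) * Real.log T ^ 2) ∧
      (s₁ = 1 → σ₂ = 1 →
        (fun T : ℝ => EulerDoubleZeta.meanSq s₁ σ₂ T
            - EulerDoubleZeta.zeta₂Sq s₁ (2 * σ₂) * T)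
          =O[𝓟 (Set.Ici 2)] fun T : ℝ => Real.log T ^ 4) ∧
      (1 < s₁.re → σ₂ = 1 / 2 →
        (fun T : ℝ => EulerDoubleZeta.meanSq s₁ σ₂ T
            - ‖riemannZeta s₁‖ ^ 2 * (T * Real.log T))
          =O[𝓟 (Set.Ici 2)] fun T : ℝ => T) ∧
      (s₁.re + σ₂ = 3 / 2 → 1 / 2 < σ₂ →
        (fun T : ℝ => EulerDoubleZeta.meanSq s₁ σ₂ T
            - (‖s₁ - 1‖ ^ 2)⁻¹ * (T * Real.log T))
          =O[𝓟 (Set.Ici 2)] fun T : ℝ => T) ∧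
      (σ₂ = 1 / 2 → s₁.re = 1 → s₁ ≠ 1 →
        (fun T : ℝ => EulerDoubleZeta.meanSq s₁ σ₂ T
            - ((‖s₁ - 1‖ ^ 2)⁻¹ + ‖riemannZeta s₁‖ ^ 2) * (T * Real.log T))
          =O[𝓟 (Set.Ici 2)] fun T : ℝ => T) ∧
      (σ₂ = 1 / 2 → s₁ = 1 →
        (fun T : ℝ => EulerDoubleZeta.meanSq s₁ σ₂ T - T * Real.log T ^ 3 / 3)
          =O[𝓟 (Set.Ici 2)] fun T : ℝ => T * Real.log T ^ 2) ∧
      -- on the line `σ₁ + σ₂ = 3/2` the main term is not of the form `C T`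
      (s₁.re + σ₂ = 3 / 2 → 1 / 2 ≤ σ₂ →
        ∀ C : ℝ, ¬ (fun T : ℝ => EulerDoubleZeta.meanSq s₁ σ₂ T - C * T)
          =o[atTop] fun T : ℝ => T)) := by
  refine ⟨EulerDoubleZeta.summable_zeta₂SqTerm_of_lt, fun hreg => ?_⟩
  have hinv (hs1 : s₁ ≠ 1) : 0 < (‖s₁ - 1‖ ^ 2)⁻¹ :=
    inv_pos.2 (pow_pos (norm_pos_iff.2 (sub_ne_zero.2 hs1)) 2)
  have hne (h : s₁.re ≠ 1) : s₁ ≠ 1 := by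
    rintro rfl
    exact h Complex.one_re
  have below (h12 : s₁.re + σ₂ = 3 / 2) (h2 : 1 / 2 < σ₂) :=
    EulerDoubleZeta.isBigO_meanSq_sub_mul_log hreg (hne (by linarith))
      (by rw [min_eq_right] <;> linarith)
      (EulerDoubleZeta.exists_abs_sum_zeta₂SqTerm_sub_of_lt_one (by linarith) h12)
  have corner (h2 : σ₂ = 1 / 2) (h1 : s₁.re = 1) (hs1 : s₁ ≠ 1) :=
    EulerDoubleZeta.isBigO_meanSq_sub_mul_log hreg hs1 (by rw [min_eq_left] <;> linarith)
      (h2 ▸ EulerDoubleZeta.exists_abs_sum_zeta₂SqTerm_sub_of_re_eq_one h1 hs1)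
  have vertex (h2 : σ₂ = 1 / 2) (hs1 : s₁ = 1) :
      (fun T : ℝ => EulerDoubleZeta.meanSq s₁ σ₂ T - T * Real.log T ^ 3 / 3)
        =O[𝓟 (Set.Ici 2)] fun T : ℝ => T * Real.log T ^ 2 := by
    subst h2 hs1
    exact EulerDoubleZeta.isBigO_principal_Ici_of_abs_le
      (fun T hT => mul_nonneg (by linarith) (sq_nonneg _))
      (EulerDoubleZeta.exists_abs_meanSq_one_half_sub_le hreg)
  refine ⟨fun h2 h12 T hT => EulerDoubleZeta.intervalIntegrable_norm_zeta₂_sq (by linarith)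
      (by linarith) hreg hT,
    EulerDoubleZeta.isBigO_meanSq_sub_of_one_lt hreg, fun h1 h2 h2' => ?_, fun h1 h2 => ?_,
    fun h1 hs1 h12 h12' => ?_, fun h1 hs1 h12 => ?_, fun hs1 h2 h2' => ?_, fun hs1 h2 => ?_,
    fun h1 h2 => ?_, below, corner, vertex, fun h12 h2 C => ?_⟩
  · have hm : min σ₂ (s₁.re + σ₂ - 1) = σ₂ := min_eq_left (by linarith)
    exact EulerDoubleZeta.isBigO_meanSq_sub_of_lt_one hreg (hne h1.ne') (by rwa [hm])
      (by rwa [hm]) (by rw [hm])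
  · exact EulerDoubleZeta.isBigO_meanSq_sub_of_eq_one hreg (hne h1.ne')
      (by rw [min_eq_left] <;> linarith)
  · have hm : min σ₂ (s₁.re + σ₂ - 1) = s₁.re + σ₂ - 1 := min_eq_right (by linarith)
    exact EulerDoubleZeta.isBigO_meanSq_sub_of_lt_one hreg hs1 (by rw [hm]; linarith)
      (by rw [hm]; linarith) (by rw [hm]; ring)
  · exact EulerDoubleZeta.isBigO_meanSq_sub_of_eq_one hreg hs1
      (by rw [min_eq_right] <;> linarith)
  · subst hs1
    exact EulerDoubleZeta.isBigO_meanSq_one_sub_of_lt_one hreg h2 h2'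
  · subst hs1 h2
    exact EulerDoubleZeta.isBigO_meanSq_one_one_sub hreg
  · exact EulerDoubleZeta.isBigO_meanSq_sub_mul_log hreg (hne h1.ne')
      (by rw [min_eq_left] <;> linarith)
      (h2 ▸ EulerDoubleZeta.exists_abs_sum_zeta₂SqTerm_sub_of_one_lt h1)
  -- On the line σ₁ + σ₂ = 3/2 the endpoint σ₂ = 1/2 forces σ₁ = 1. It gives the cubed logarithm if
  -- s₁ = 1; elsewhere on the line the coefficient of T log T is positive.
  · rcases h2.eq_or_lt with h2 | h2
    · rcases eq_or_ne s₁ 1 with hs1 | hs1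
      · exact EulerDoubleZeta.not_isLittleO_sub_mul_of_mul_log_cube (vertex h2.symm hs1) C
      · exact EulerDoubleZeta.not_isLittleO_sub_mul_of_mul_log
          (add_pos_of_pos_of_nonneg (hinv hs1) (sq_nonneg _)).ne'
          (corner h2.symm (by linarith) hs1) C
    · exact EulerDoubleZeta.not_isLittleO_sub_mul_of_mul_log (hinv (hne (by linarith))).ne'
        (below h12 h2) C
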